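/- **Conventions.** Vector spaces are over $\mathbb C$ and $\mathbb Z/2$-graded, brackets are supercommutators, $z,x$ are even and $\theta,\xi,\varepsilon,\delta$ odd variables, and $\mathbf x=(x,\theta)$. An *$N_W=1$ SUSY vertex algebra* is a super vector space $V$ with an even vector $|0\rangle$, an even operator $\partial$ and an odd operator $D$ with $D^2=0$, $[\partial,D]=0$, $\partial|0\rangle=D|0\rangle=0$, and an even bilinear operation $a\otimes b\mapsto Y(a,z,\theta)b\in V((z))[\theta]$ such that $Y(a,z,\theta)|0\rangle\in V[[z]][\theta]$ has value $a$ at $z=\theta=0$, $Y(|0\rangle,z,\theta)=\mathrm{id}$, $[\partial,Y(a,z,\theta)]=\partial_zY(a,z,\theta)$, $[D,Y(a,z,\theta)]=\partial_\theta Y(a,z,\theta)$, and $(z-w)^n[Y(a,z,\theta),Y(b,w,\xi)]=0$ for $n\gg0$. A *module* is a super vector space $M$ with an even operation $Y^M(a,z,\theta)m\in M((z))[\theta]$ such that $Y^M(|0\rangle,z,\theta)=\mathrm{id}$ and associativity holds: $Y^M(a,z,\theta)Y^M(b,w,\xi)$, $(-1)^{|a||b|}Y^M(b,w,\xi)Y^M(a,z,\theta)$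 and $Y^M(Y(a,z-w,\theta-\xi)b,w,\xi)$ are the expansions of one function with poles on $z=0$, $w=0$, $z=w$ in $|z|>|w|$, $|w|>|z|$, $|w|>|z-w|$ (Borcherds identity). $V$ is *quasi-conformal* if it carries even operators $L_n$ $(n\ge-1)$, $J_n$ $(n\ge0)$ and odd operators $Q_n$ $(n\ge-1)$, $H_n$ $(n\ge0)$ with $$[L_m,L_n]=(m-n)L_{m+n},\quad [L_m,J_n]=-nJ_{m+n},\quad [L_m,H_n]=-nH_{m+n},\quad [L_m,Q_n]=(m-n)Q_{m+n},$$ $$[J_m,Q_n]=Q_{m+n},\quad [J_m,H_n]=-H_{m+n},\quad [H_m,Q_n]=L_{m+n}-mJ_{m+n},\quad [J_m,J_n]=[Q_m,Q_n]=[H_m,H_n]=0,$$ such that for all $a\in V$ $$\begin{aligned}[J_n,Y(a,z,\theta)]&=\textstyle\sum_{j\ge0}\binom nj z^{n-j}\bigl(Y(J_ja,z,\theta)+\theta Y(Q_{j-1}a,z,\theta)\bigr),\\ [H_n,Y(a,z,\theta)]&=\textstyle\sum_{j\ge0}\binom nj z^{n-j}\bigl(Y(H_ja,z,\theta)-\theta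 Y((L_{j-1}-jJ_{j-1})a,z,\theta)\bigr),\\ [Q_n,Y(a,z,\theta)]&=\textstyle\sum_{j\ge-1}\binom{n+1}{j+1}z^{n-j}Y(Q_ja,z,\theta),\\ [L_n,Y(a,z,\theta)]&=\textstyle\sum_{j\ge-1}\binom{n+1}{j+1}z^{n-j}\bigl(Y(L_ja,z,\theta)+(j+1)\theta Y(Q_{j-1}a,z,\theta)\bigr),\end{aligned}$$ $L_{-1}=\partial$, $Q_{-1}=D$, and $L_0,J_0$ are diagonalizable with integer eigenvalues, finite dimensional joint eigenspaces, and $L_0$-eigenvalues $\ge0$. A module $M$ has *positive energy* if it carries operators $L_n,Q_n,J_n,H_n$ with the same properties, $Y$ being replaced by $Y^M$ and the conditions on $L_{-1},Q_{-1}$ being omitted. **Setting.** Let $V$ be a quasi-conformal $N_W=1$ SUSY vertex algebra and $M$ a positive energy $V$-module. Let $q,y$ be even and $\varepsilon,\delta$ odd parameters, and $\Lambda=\mathbb C[\varepsilon,\delta]$ the Grassmann algebra. Let $$\mathbf q=\exp(\varepsilon H_0)\,y^{-J_0}q^{-L_0}\exp(-\delta Q_0),$$ acting on $V$ and $M$ as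 $\mathbf q_V$ and $\mathbf q_M$ and on $\mathbb G_m^{1|1}$ by $\mathbf q\cdot(x,\theta)=\bigl(q(x+\varepsilon\theta),\,q(y-\varepsilon\delta)\theta+q\delta x\bigr)$, with Berezinian $\mathrm{Ber}\,\mathbf q=y^{-1}$. The elliptic supercurve is $E=\mathbb G_m^{1|1}\times S/\mathbb Z$ with $\mathbb Z$ generated by $\mathbf q$; the marked point is $\mathbf x_0=(1,0)$. Everything is considered in a formal neighbourhood of $q=0$. A *section* $f$ (of the chiral algebra of $V$, off the marked point) is a finite sum of products $g\otimes v$ with $v\in V$ and $g=\sum_{i,j}g_{ij}(x,\theta)q^iy^j$ a formal series, with powers of $q$ bounded below, whose coefficients are $\Lambda[\theta]$-valued rational functions of $x$ with poles only at $0,1,\infty$. Let $f_-$ and $f_+$ be its expansions in $|q|<|x|<1$ and $1<|x|<|q|^{-1}$, i.e. obtained by expanding all $g_{ij}$ at $x=0$, respectively $x=\infty$. The generator of $\mathbb Z$ acts by $(\mathbf q\cdot a)(\mathbf x)=\mathrm{Ber}(\mathbf q)\,\mathbf q_V\,a(\mathbf q\cdot\mathbf x)$. The section $f$ is *$\mathbb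 Z$-equivariant* if $\mathbf q\cdot f_-=f_+$; such $f$ are the sections of the chiral algebra of $E$ with poles only along the orbit of the marked point. If $a$ is a section in which only finitely many monomials $q^iy^j$ occur, we write $f=\pi_*a=\sum_{n\in\mathbb Z}\mathbf q^n\cdot a$, and say that this sum is well defined, if $f$ is a section with $f_-=\sum_{n\ge0}\mathbf q^n\cdot a_-+\sum_{n<0}\mathbf q^n\cdot a_+$, where each coefficient of a monomial in $x,q,y,\theta,\varepsilon,\delta$ has only finitely many nonzero contributions. For $b\in V$ put $$h(f)\cdot b=\mathrm{res}_{\mathbf x-\mathbf x_0}\,Y\bigl(f(x,\theta),x-1,\theta\bigr)b,$$ where the residue is the coefficient of $\theta(x-1)^{-1}$, an odd functional acting from the left. Call $f$ *compatible with $M$* if for all $i,n,j$ only finitely many charges $c$ occurring in the weight $n$ part of $M$ are such that $q^iy^{j-c}$ occurs in $f$, so that the powers of $y$ in products with traces over $M$ can be collected. (This is automatic if the coefficient of each $q^i$ in $f$ is a Laurent polynomial in $y$, or if each weight space of $M$ has finitely many charges.) **Proposition.** Let $$\varphi_M(a)=\mathrm{str}_M\,Y^M(a,\mathbf x)\,\mathbf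 q_M^{-1}\big|_{\mathbf x=(1,0)},\qquad \mathbf q_M^{-1}=\exp(\delta Q_0)\,q^{L_0}y^{J_0}\exp(-\varepsilon H_0),$$ extended linearly over the parameters $q,y,\varepsilon,\delta$. 1. $\varphi_M$ is well defined: for $a\in V$ each coefficient of $q^iy^j$ in the supertrace is a sum of finitely many nonzero supertraces over finite dimensional joint eigenspaces of $L_0,J_0$ (and it is a Laurent polynomial in $x$ at $\theta=0$); it depends linearly on $a$, and it vanishes for $i<0$. 2. $\varphi_M$ is a conformal block on $E$: for every $\mathbb Z$-equivariant section $f$ compatible with $M$ and every $b\in V$, the products defining the coefficients of $\varphi_M(h(f)\cdot b)$ are finite sums, and $$\varphi_M\bigl(h(f)\cdot b\bigr)=0 .$$ 3. In particular, if $\pi_*a$ is well defined, then it is $\mathbb Z$-equivariant, and $\varphi_M(h(\pi_*a)\cdot b)=0$ for all $b\in V$ whenever $\pi_*a$ is compatible with $M$. -/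

import Mathlib

open scoped BigOperators

/-! ## Super vector spaces, Grassmann coefficients -/

/-- A super vector space over `ℂ`: the grading is recorded by the parity involution, which is `1` on
the even part and `-1` on the odd part. -/
structure SuperSpace (W : Type*) [AddCommGroup W] [Module ℂ W] where
  par : W →ₗ[ℂ] W
  par_par : ∀ w, par (par w) = w

/-- `w` is homogeneous of parity `p`. -/
def SuperSpace.HasParity {W : Type*} [AddCommGroup W] [Module ℂ W] (S : SuperSpace W)
    (p : Fin 2) (w : W) : Prop :=
  S.par w = (-1 : ℂ) ^ (p : ℕ) • w

/-- An even operator of a super vector space. -/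
def SuperSpace.EvenOp {W : Type*} [AddCommGroup W] [Module ℂ W] (S : SuperSpace W)
    (T : Module.End ℂ W) : Prop := ∀ w, S.par (T w) = T (S.par w)

/-- An odd operator of a super vector space. -/
def SuperSpace.OddOp {W : Type*} [AddCommGroup W] [Module ℂ W] (S : SuperSpace W)
    (T : Module.End ℂ W) : Prop := ∀ w, S.par (T w) = - T (S.par w)

/-- `W ⊗ ℂ[ε, δ]` with two odd parameters `ε, δ`: the function `w` stands for
`∑ ε ^ e δ ^ d w e d` (scalars on the left, in this order). -/
abbrev Gr (W : Type*) := Fin 2 → Fin 2 → W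

namespace Gr

variable {W W' : Type*} [AddCommGroup W] [Module ℂ W] [AddCommGroup W'] [Module ℂ W']

/-- Left multiplication by `ε`. -/
def eps : Gr W →ₗ[ℂ] Gr W where
  toFun w e d := if e = 1 then w 0 d else 0
  map_add' u w := by funext e d; by_cases h : e = 1 <;> simp [h]
  map_smul' c w := by funext e d; by_cases h : e = 1 <;> simp [h]

/-- Left multiplication by `δ`; the sign is that of `δ ε = - ε δ`. -/
def del : Gr W →ₗ[ℂ] Gr W where
  toFun w e d := if d = 1 then (-1 : ℂ) ^ (e : ℕ) • w e 0 else 0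
  map_add' u w := by funext e d; by_cases h : d = 1 <;> simp [h]
  map_smul' c w := by
    funext e d; by_cases h : d = 1 <;> simp [h, smul_comm c]

/-- The extension of an even operator by linearity over `ℂ[ε, δ]`. -/
def even (T : W →ₗ[ℂ] W') : Gr W →ₗ[ℂ] Gr W' where
  toFun w e d := T (w e d)
  map_add' u w := by funext e d; simp
  map_smul' c w := by funext e d; simp

/-- The extension of an odd operator by super-linearity: it anticommutes with `ε` and `δ`. -/
def odd (T : W →ₗ[ℂ] W') : Gr W →ₗ[ℂ] Gr W' where
  toFun w e d := (-1 : ℂ) ^ ((e : ℕ) + (d : ℕ)) • T (w e d)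
  map_add' u w := by funext e d; simp
  map_smul' c w := by funext e d; simp [smul_comm c]

/-- The inclusion `W → W ⊗ ℂ[ε, δ]`. -/
def base : W →ₗ[ℂ] Gr W where
  toFun w e d := if e = 0 ∧ d = 0 then w else 0
  map_add' u w := by funext e d; by_cases h : e = 0 ∧ d = 0 <;> simp [h]
  map_smul' c w := by funext e d; by_cases h : e = 0 ∧ d = 0 <;> simp [h]

/-- The coefficient of `ε ^ e δ ^ d`. -/
def comp (e d : Fin 2) : Gr W →ₗ[ℂ] W where
  toFun w := w e d
  map_add' _ _ := rfl
  map_smul' _ _ := rfl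

end Gr

/-! ## SUSY vertex algebras and their modules -/

/-- Families of modes of superfields: `Y s n a` is the coefficient of `z ^ (-1 - n) θ ^ s` in
`Y(a, z, θ)`, with the odd coordinate `θ` written on the left, so that
`Y(a, z, θ) w = ∑ₙ z ^ (-1 - n) (Y 0 n a w + θ Y 1 n a w)`. -/
abbrev Modes (V W : Type*) [AddCommGroup V] [Module ℂ V] [AddCommGroup W] [Module ℂ W] :=
  Fin 2 → ℤ → V →ₗ[ℂ] W →ₗ[ℂ] W

/-- An `N_W = 1` SUSY vertex algebra. -/
structure SUSYVertexAlgebra (V : Type*) [AddCommGroup V] [Module ℂ V] extends SuperSpace V where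
  /-- the vacuum vector -/
  vac : V
  /-- the even derivation `∂` -/
  T : Module.End ℂ V
  /-- the odd derivation `D` -/
  D : Module.End ℂ V
  /-- the state-field correspondence -/
  Y : Modes V V
  par_vac : par vac = vac
  T_even : toSuperSpace.EvenOp T
  D_odd : toSuperSpace.OddOp D
  T_D : T * D = D * T
  D_D : D * D = 0
  T_vac : T vac = 0
  D_vac : D vac = 0
  /-- `Y(a, z, θ) b` lies in `V((z))[θ]`. -/
  trunc : ∀ a b, ∃ N : ℤ, ∀ s n, N ≤ n → Y s n a b = 0
  /-- The operation `a ⊗ b ↦ Y(a, z, θ) b` is even (`θ` being odd). -/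
  Y_par : ∀ s n a b, par (Y s n a b) = (-1 : ℂ) ^ (s : ℕ) • Y s n (par a) (par b)
  /-- `Y(a, z, θ) |0⟩` lies in `V[[z]][θ]`. -/
  creation_regular : ∀ s n a, 0 ≤ n → Y s n a vac = 0
  /-- `Y(a, z, θ) |0⟩ = a` at `z = θ = 0`. -/
  creation : ∀ a, Y 0 (-1) a vac = a
  /-- `Y(|0⟩, z, θ) = id`. -/
  vac_zero : ∀ n b, Y 0 n vac b = if n = -1 then b else 0
  vac_one : ∀ n b, Y 1 n vac b = 0
  /-- `[∂, Y(a, z, θ)] = ∂_z Y(a, z, θ)`. -/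
  T_cov : ∀ s n a b, T (Y s n a b) - Y s n a (T b) = (-n : ℂ) • Y s (n - 1) a b
  /-- The two components in `θ` of `[D, Y(a, z, θ)] = ∂_θ Y(a, z, θ)` (supercommutator). -/
  D_cov_zero : ∀ n a b, D (Y 0 n a b) - Y 0 n (par a) (D b) = Y 1 n a b
  D_cov_one : ∀ n a b, D (Y 1 n a b) + Y 1 n (par a) (D b) = 0
  /-- Locality: `(z - w) ^ N [Y(a, z, θ), Y(b, w, ξ)] = 0` for large `N`, in components: the
  coefficient of `θ ^ s ξ ^ t` is, up to a sign, the supercommutator of a field of parity `p + s`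
  and a field of parity `r + t`. -/
  locality : ∀ (p r : Fin 2) (a b : V), toSuperSpace.HasParity p a → toSuperSpace.HasParity r b →
    ∃ N : ℕ, ∀ (s t : Fin 2) (m n : ℤ) (c : V),
      ∑ k ∈ Finset.range (N + 1), ((-1 : ℂ) ^ k * (N.choose k : ℂ)) •
        (Y s (m + N - k) a (Y t (n + k) b c)
          - (-1 : ℂ) ^ (((p : ℕ) + s) * ((r : ℕ) + t)) • Y t (n + k) b (Y s (m + N - k) a c)) = 0

/-- A module over an `N_W = 1` SUSY vertex algebra. Associativity,
`Y(a, z, θ) Y(b, w, ξ) = Y(Y(a, z - w, θ - ξ) b, w, ξ)` as an equality of expansions of one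
function with poles at `z = 0`, `w = 0`, `z = w` (the product in the other order being its third
expansion), is stated through modes by the Borcherds identity, for each coefficient
`θ ^ s ξ ^ t`. -/
structure SUSYModule {V : Type*} [AddCommGroup V] [Module ℂ V] (A : SUSYVertexAlgebra V)
    (M : Type*) [AddCommGroup M] [Module ℂ M] extends SuperSpace M where
  Y : Modes V M
  trunc : ∀ a x, ∃ N : ℤ, ∀ s n, N ≤ n → Y s n a x = 0
  Y_par : ∀ s n a x, par (Y s n a x) = (-1 : ℂ) ^ (s : ℕ) • Y s n (A.par a) (par x)
  vac_zero : ∀ n x, Y 0 n A.vac x = if n = -1 then x else 0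
  vac_one : ∀ n x, Y 1 n A.vac x = 0
  borcherds : ∀ (p r : Fin 2) (a b : V), A.HasParity p a → A.HasParity r b →
    ∀ (s t : Fin 2) (m k n : ℤ) (x : M),
      ∑ᶠ j : ℕ, ((Ring.choose m j : ℤ) : ℂ) •
          (Y t (m + k - j) (A.Y s (n + j) a b) x
            - if s = 0 ∧ t = 1 then Y 0 (m + k - j) (A.Y 1 (n + j) a b) x else 0)
        = (-1 : ℂ) ^ ((t : ℕ) * ((p : ℕ) + s)) •
          ∑ᶠ j : ℕ, ((-1 : ℂ) ^ j * ((Ring.choose n j : ℤ) : ℂ)) •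
            (Y s (m + n - j) a (Y t (k + j) b x)
              - ((-1 : ℂ) ^ (((p : ℕ) + s) * ((r : ℕ) + t)) * (-1 : ℂ) ^ n) •
                  Y t (n + k - j) b (Y s (m + j) a x))

/-! ## The annihilation subalgebra of the topological algebra -/

/-- The joint eigenspace of two operators for a pair of integers. -/
def jointEigenspace {W : Type*} [AddCommGroup W] [Module ℂ W] (A B : Module.End ℂ W)
    (p : ℤ × ℤ) : Submodule ℂ W :=
  Module.End.eigenspace A (p.1 : ℂ) ⊓ Module.End.eigenspace B (p.2 : ℂ)

/-- A representation of the annihilation subalgebra of the topological algebra, spanned by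
`L n, Q n` for `n ≥ -1` and `J n, H n` for `n ≥ 0` (the values of `L, Q, J, H` at other integers are
irrelevant; the central charge does not enter), for which `L 0` and `J 0` are diagonalizable with
integer eigenvalues, finite dimensional joint eigenspaces, and `L 0`-eigenvalues bounded below by
`0`. -/
structure AnnihilationRep {W : Type*} [AddCommGroup W] [Module ℂ W] (S : SuperSpace W) where
  L : ℤ → Module.End ℂ W
  Q : ℤ → Module.End ℂ W
  J : ℤ → Module.End ℂ W
  H : ℤ → Module.End ℂ W
  L_even : ∀ n, -1 ≤ n → S.EvenOp (L n)
  Q_odd : ∀ n, -1 ≤ n → S.OddOp (Q n)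
  J_even : ∀ n, 0 ≤ n → S.EvenOp (J n)
  H_odd : ∀ n, 0 ≤ n → S.OddOp (H n)
  L_L : ∀ m n, -1 ≤ m → -1 ≤ n → L m * L n - L n * L m = ((m : ℂ) - n) • L (m + n)
  L_J : ∀ m n, -1 ≤ m → 0 ≤ n → L m * J n - J n * L m = (-n : ℂ) • J (m + n)
  L_H : ∀ m n, -1 ≤ m → 0 ≤ n → L m * H n - H n * L m = (-n : ℂ) • H (m + n)
  L_Q : ∀ m n, -1 ≤ m → -1 ≤ n → L m * Q n - Q n * L m = ((m : ℂ) - n) • Q (m + n)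
  J_J : ∀ m n, 0 ≤ m → 0 ≤ n → J m * J n - J n * J m = 0
  J_Q : ∀ m n, 0 ≤ m → -1 ≤ n → J m * Q n - Q n * J m = Q (m + n)
  J_H : ∀ m n, 0 ≤ m → 0 ≤ n → J m * H n - H n * J m = - H (m + n)
  H_Q : ∀ m n, 0 ≤ m → -1 ≤ n → H m * Q n + Q n * H m = L (m + n) - (m : ℂ) • J (m + n)
  Q_Q : ∀ m n, -1 ≤ m → -1 ≤ n → Q m * Q n + Q n * Q m = 0
  H_H : ∀ m n, 0 ≤ m → 0 ≤ n → H m * H n + H n * H m = 0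
  diagonal : DirectSum.IsInternal (jointEigenspace (L 0) (J 0))
  finite_dim : ∀ p, FiniteDimensional ℂ (jointEigenspace (L 0) (J 0) p)
  positive : ∀ p : ℤ × ℤ, p.1 < 0 → jointEigenspace (L 0) (J 0) p = ⊥

namespace AnnihilationRep

variable {W : Type*} [AddCommGroup W] [Module ℂ W] {S : SuperSpace W} (R : AnnihilationRep S)

/-- The vectors of conformal weight `p.1` and charge `p.2`. -/
def wt (p : ℤ × ℤ) : Submodule ℂ W := jointEigenspace (R.L 0) (R.J 0) p

/-- The component of a vector of conformal weight `p.1` and charge `p.2`. -/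
noncomputable def component (p : ℤ × ℤ) : W →ₗ[ℂ] R.wt p :=
  (DirectSum.component ℂ (ℤ × ℤ) (fun p => jointEigenspace (R.L 0) (R.J 0) p) p).comp
    (LinearEquiv.ofBijective (DirectSum.coeLinearMap (jointEigenspace (R.L 0) (R.J 0)))
      R.diagonal).symm.toLinearMap

/-- The projection of `W` onto the joint eigenspace of `L 0` and `J 0` for `p`. -/
noncomputable def proj (p : ℤ × ℤ) : Module.End ℂ W := (R.wt p).subtype ∘ₗ R.component p

/-- The supertrace of the diagonal block of `T` on the joint eigenspace for `p`. -/
noncomputable def blockStr (T : Module.End ℂ W) (p : ℤ × ℤ) : ℂ :=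
  LinearMap.trace ℂ (R.wt p) (R.component p ∘ₗ S.par ∘ₗ T ∘ₗ (R.wt p).subtype)

/-- The supertrace of an operator with finitely many nonzero diagonal blocks. -/
noncomputable def str (T : Module.End ℂ W) : ℂ := ∑ᶠ p, R.blockStr T p

/-- The action on `W` of the inverse of the element
`𝐪 = exp (ε H₀) y ^ (-J₀) q ^ (-L₀) exp (-δ Q₀)` of `GL(1|1)`, namely
`𝐪⁻¹ = exp (δ Q₀) q ^ L₀ y ^ J₀ exp (-ε H₀)`: its coefficient of `q ^ i y ^ j`. -/
noncomputable def qInv (i j : ℤ) : Module.End ℂ (Gr W) :=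
  (1 + Gr.del * Gr.odd (R.Q 0)) * Gr.even (R.proj (i, j)) * (1 - Gr.eps * Gr.odd (R.H 0))

end AnnihilationRep

/-- The commutation relations of the operators `L n, Q n, J n, H n` with the superfields
`Y(a, z, θ)` of `V` acting on `W`, in components: `s = 0` is the coefficient of `θ ^ 0`, and `s = 1`
that of `θ` (supercommutators; a sign appears when an odd operator passes `θ`). The sums for
`J, H` run over `0 ≤ j ≤ n`, those for `Q, L` over `-1 ≤ i - 1 ≤ N - 1`, where `n = N - 1`. -/
structure FieldCovariance {V W : Type*} [AddCommGroup V] [Module ℂ V] [AddCommGroup W] [Module ℂ W]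
    {SV : SuperSpace V} {SW : SuperSpace W} (Y : Modes V W) (A : AnnihilationRep SV) (B : AnnihilationRep SW) :
    Prop where
  J_zero : ∀ (n : ℕ) (k : ℤ) (a : V) (w : W),
    B.J n (Y 0 k a w) - Y 0 k a (B.J n w)
      = ∑ j ∈ Finset.range (n + 1), (n.choose j : ℂ) • Y 0 (k + n - j) (A.J j a) w
  J_one : ∀ (n : ℕ) (k : ℤ) (a : V) (w : W),
    B.J n (Y 1 k a w) - Y 1 k a (B.J n w)
      = ∑ j ∈ Finset.range (n + 1), (n.choose j : ℂ) •
          (Y 1 (k + n - j) (A.J j a) w + Y 0 (k + n - j) (A.Q ((j : ℤ) - 1) a) w)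
  H_zero : ∀ (n : ℕ) (k : ℤ) (a : V) (w : W),
    B.H n (Y 0 k a w) - Y 0 k (SV.par a) (B.H n w)
      = ∑ j ∈ Finset.range (n + 1), (n.choose j : ℂ) • Y 0 (k + n - j) (A.H j a) w
  H_one : ∀ (n : ℕ) (k : ℤ) (a : V) (w : W),
    -(B.H n (Y 1 k a w) + Y 1 k (SV.par a) (B.H n w))
      = ∑ j ∈ Finset.range (n + 1), (n.choose j : ℂ) •
          (Y 1 (k + n - j) (A.H j a) w
            - Y 0 (k + n - j) (A.L ((j : ℤ) - 1) a - (j : ℂ) • A.J ((j : ℤ) - 1) a) w)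
  Q_zero : ∀ (N : ℕ) (k : ℤ) (a : V) (w : W),
    B.Q ((N : ℤ) - 1) (Y 0 k a w) - Y 0 k (SV.par a) (B.Q ((N : ℤ) - 1) w)
      = ∑ i ∈ Finset.range (N + 1), (N.choose i : ℂ) • Y 0 (k + N - i) (A.Q ((i : ℤ) - 1) a) w
  Q_one : ∀ (N : ℕ) (k : ℤ) (a : V) (w : W),
    -(B.Q ((N : ℤ) - 1) (Y 1 k a w) + Y 1 k (SV.par a) (B.Q ((N : ℤ) - 1) w))
      = ∑ i ∈ Finset.range (N + 1), (N.choose i : ℂ) • Y 1 (k + N - i) (A.Q ((i : ℤ) - 1) a) w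
  L_zero : ∀ (N : ℕ) (k : ℤ) (a : V) (w : W),
    B.L ((N : ℤ) - 1) (Y 0 k a w) - Y 0 k a (B.L ((N : ℤ) - 1) w)
      = ∑ i ∈ Finset.range (N + 1), (N.choose i : ℂ) • Y 0 (k + N - i) (A.L ((i : ℤ) - 1) a) w
  L_one : ∀ (N : ℕ) (k : ℤ) (a : V) (w : W),
    B.L ((N : ℤ) - 1) (Y 1 k a w) - Y 1 k a (B.L ((N : ℤ) - 1) w)
      = ∑ i ∈ Finset.range (N + 1), (N.choose i : ℂ) •
          (Y 1 (k + N - i) (A.L ((i : ℤ) - 1) a) w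
            + (i : ℂ) • Y 0 (k + N - i) (A.Q ((i : ℤ) - 2) a) w)

/-- A quasi-conformal structure on an `N_W = 1` SUSY vertex algebra. -/
structure QuasiConformal {V : Type*} [AddCommGroup V] [Module ℂ V] (A : SUSYVertexAlgebra V)
    extends AnnihilationRep A.toSuperSpace where
  covariant : FieldCovariance A.Y toAnnihilationRep toAnnihilationRep
  L_neg_one : L (-1) = A.T
  Q_neg_one : Q (-1) = A.D

/-- A positive energy structure on a module over a quasi-conformal SUSY vertex algebra. -/
structure PositiveEnergy {V M : Type*} [AddCommGroup V] [Module ℂ V] [AddCommGroup M] [Module ℂ M]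
    {A : SUSYVertexAlgebra V} (C : QuasiConformal A) (N : SUSYModule A M)
    extends AnnihilationRep N.toSuperSpace where
  covariant : FieldCovariance N.Y C.toAnnihilationRep toAnnihilationRep

/-! ## The supertrace functional -/

namespace PositiveEnergy

variable {V M : Type*} [AddCommGroup V] [Module ℂ V] [AddCommGroup M] [Module ℂ M]
  {A : SUSYVertexAlgebra V} {C : QuasiConformal A} {N : SUSYModule A M} (P : PositiveEnergy C N)

/-- The mode `Y 0 n v` extended super-linearly to `M ⊗ ℂ[ε, δ]`: moving `v` past
`ε ^ e δ ^ d` yields the sign `(-1) ^ ((e + d) |v|)`. -/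
def fieldMode (N : SUSYModule A M) (v : V) (n : ℤ) : Module.End ℂ (Gr M) where
  toFun w e d := N.Y 0 n ((A.par ^ ((e : ℕ) + (d : ℕ))) v) (w e d)
  map_add' u w := by funext e d; simp
  map_smul' c w := by funext e d; simp

/-- The operator on `M` whose supertrace is the coefficient of `ε ^ e δ ^ d q ^ i y ^ j x ^ (-1 - n)`
in `str Y(v, x, 0) 𝐪⁻¹`. The supertrace over `ℂ[ε, δ]` of a linear operator on `M ⊗ ℂ[ε, δ]` is read
off from its values on `M`. -/
noncomputable def traceOp (v : V) (i j n : ℤ) (e d : Fin 2) : Module.End ℂ M :=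
  Gr.comp e d ∘ₗ fieldMode N v n ∘ₗ P.qInv i j ∘ₗ Gr.base

/-- The functional `φ_M(v) = str_M Y(v, 𝐱) 𝐪_M⁻¹` at `𝐱 = (x, θ) = (1, 0)`: the coefficient of
`q ^ i y ^ j`, an element of `ℂ[ε, δ]`. -/
noncomputable def phi (v : V) (i j : ℤ) : Gr ℂ :=
  fun e d => ∑ᶠ n : ℤ, P.str (P.traceOp v i j n e d)

/-- For a formal series `U = ∑ U i j q ^ i y ^ j` with coefficients in `V ⊗ ℂ[ε, δ]`, the
contribution of `U p.1 p.2` to the coefficient of `q ^ i y ^ j` of `φ_M(U)`, where `φ_M` is extended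
linearly over the parameters `q, y, ε, δ`. -/
noncomputable def phiTerm (U : ℤ → ℤ → Gr V) (i j : ℤ) (p : ℤ × ℤ) : Gr ℂ :=
  ∑ e : Fin 2, ∑ d : Fin 2,
    ((Gr.eps ^ (e : ℕ) * Gr.del ^ (d : ℕ) : Module.End ℂ (Gr ℂ)))
      (P.phi (U p.1 p.2 e d) (i - p.1) (j - p.2))

/-- `φ_M(U) = 0`, as a formal series in `q, y` with coefficients in `ℂ[ε, δ]`; each of its
coefficients is a sum with only finitely many nonzero terms. -/
def Annihilates (U : ℤ → ℤ → Gr V) : Prop :=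
  ∀ i j : ℤ, (Function.support (P.phiTerm U i j)).Finite ∧ ∑ᶠ p, P.phiTerm U i j p = 0

end PositiveEnergy

/-! ## Sections of the chiral algebra -/

/-- A rational function of `x` regular on `ℂ \ {0, 1}`. -/
def IsRegularFunction (g : RatFunc ℂ) : Prop :=
  ∃ (a b : ℕ) (P : Polynomial ℂ),
    g * RatFunc.X ^ a * (RatFunc.X - 1) ^ b = algebraMap (Polynomial ℂ) (RatFunc ℂ) P

/-- The coefficient of `x ^ m` in the Laurent expansion at `x = 0`, that is in `|x| < 1`. -/
noncomputable def coeffZero (g : RatFunc ℂ) (m : ℤ) : ℂ :=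
  (RatFunc.eval (HahnSeries.C : ℂ →+* LaurentSeries ℂ) (HahnSeries.single 1 1) g).coeff m

/-- The coefficient of `x ^ m` in the Laurent expansion at `x = ∞`, that is in `|x| > 1`. -/
noncomputable def coeffInfty (g : RatFunc ℂ) (m : ℤ) : ℂ :=
  (RatFunc.eval (HahnSeries.C : ℂ →+* LaurentSeries ℂ) (HahnSeries.single (-1) 1) g).coeff (-m)

/-- The coefficient of `(x - 1) ^ m` in the Laurent expansion at `x = 1`. -/
noncomputable def coeffOne (g : RatFunc ℂ) (m : ℤ) : ℂ :=
  (RatFunc.eval (HahnSeries.C : ℂ →+* LaurentSeries ℂ) (1 + HahnSeries.single 1 1) g).coeff m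

/-- A section of the chiral algebra, over a formal neighbourhood of `q = 0`, on the complement of
the marked point in `𝔾_m^{1|1}`. Through the global coordinates `x, θ` it is a function with values
in `V`, here the finite sum over `k` of
`∑ ε ^ e δ ^ d q ^ i y ^ j g k i j s e d (x) θ ^ s ⊗ v k`
with rational functions `g` whose only poles on `ℂ^*` are at `x = 1`, and with powers of `q` bounded
below. -/
structure FormalSection (V : Type*) where
  r : ℕ
  v : Fin r → V
  g : Fin r → ℤ → ℤ → Fin 2 → Gr (RatFunc ℂ)
  regular : ∀ k i j s e d, IsRegularFunction (g k i j s e d)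
  bounded : ∃ B : ℤ, ∀ k i j, i < B → g k i j = 0

/-- Formal distributions: the coefficients of `x ^ m q ^ i y ^ j θ ^ s` (arguments in this order), in
`V ⊗ ℂ[ε, δ]`; odd variables are ordered as `ε ^ e δ ^ d θ ^ s`, to the left of `V`. -/
abbrev Distr (V : Type*) := ℤ → ℤ → ℤ → Fin 2 → Gr V

namespace Distr

variable {V : Type*} [AddCommGroup V] [Module ℂ V]

/-- Left multiplication by `ε`. -/
def eps (F : Distr V) : Distr V := fun m i j s => Gr.eps (F m i j s)

/-- Left multiplication by `δ`. -/
def del (F : Distr V) : Distr V := fun m i j s => Gr.del (F m i j s)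

/-- The action on values of an odd operator, with the sign from passing `ε, δ, θ`. -/
def odd (T : Module.End ℂ V) (F : Distr V) : Distr V :=
  fun m i j s => (-1 : ℂ) ^ (s : ℕ) • Gr.odd T (F m i j s)

/-- The odd vector field `θ ∂_x` applied to a distribution. -/
def thetaDx (F : Distr V) : Distr V := fun m i j s e d =>
  if s = 1 then ((-1 : ℂ) ^ ((e : ℕ) + (d : ℕ)) * ((m : ℂ) + 1)) • F (m + 1) i j 0 e d else 0

/-- The odd vector field `x ∂_θ` applied to a distribution. -/
def xDtheta (F : Distr V) : Distr V := fun m i j s e d =>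
  if s = 0 then (-1 : ℂ) ^ ((e : ℕ) + (d : ℕ)) • F (m - 1) i j 1 e d else 0

/-- The operator `y ^ (c θ ∂_θ) q ^ (c (x ∂_x + θ ∂_θ))`, for an integer `c`. -/
def scale (c : ℤ) (F : Distr V) : Distr V :=
  fun m i j s => F m (i - c * (m + (s : ℕ))) (j - c * (s : ℕ)) s

/-- The action `y ^ (-c J₀) q ^ (-c L₀)` on values, for an integer `c`. -/
noncomputable def scaleVal {S : SuperSpace V} (R : AnnihilationRep S) (c : ℤ) (F : Distr V) : Distr V :=
  fun m i j s e d => ∑ᶠ p : ℤ × ℤ, R.proj p (F m (i + c * p.1) (j + c * p.2) s e d)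

/-- Pull-back along `𝐪 : (x, θ) ↦ (q (x + ε θ), q (y - ε δ) θ + q δ x)`, that is
`(1 + ε θ ∂_x) y ^ (θ ∂_θ) q ^ (x ∂_x + θ ∂_θ) (1 + δ x ∂_θ)`. -/
def pullback (F : Distr V) : Distr V :=
  let F₁ := F + del (xDtheta F)
  let F₂ := scale 1 F₁
  F₂ + eps (thetaDx F₂)

/-- Pull-back along `𝐪⁻¹`. -/
def pullbackInv (F : Distr V) : Distr V :=
  let F₁ := F - eps (thetaDx F)
  let F₂ := scale (-1) F₁
  F₂ - del (xDtheta F₂)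

/-- The action of `𝐪_V = exp (ε H₀) y ^ (-J₀) q ^ (-L₀) exp (-δ Q₀)` on values. -/
noncomputable def actVal {S : SuperSpace V} (R : AnnihilationRep S) (F : Distr V) : Distr V :=
  let F₁ := F - del (odd (R.Q 0) F)
  let F₂ := scaleVal R 1 F₁
  F₂ + eps (odd (R.H 0) F₂)

/-- The action of `𝐪_V⁻¹` on values. -/
noncomputable def actValInv {S : SuperSpace V} (R : AnnihilationRep S) (F : Distr V) : Distr V :=
  let F₁ := F - eps (odd (R.H 0) F)
  let F₂ := scaleVal R (-1) F₁
  F₂ + del (odd (R.Q 0) F₂)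

/-- Multiplication by `y ^ c`. -/
def mulY (c : ℤ) (F : Distr V) : Distr V := fun m i j => F m i (j - c)

/-- The action of the generator of `ℤ`, `a(𝐱) ↦ Ber(𝐪) 𝐪_V a(𝐪 𝐱)` with `Ber(𝐪) = y⁻¹`. -/
noncomputable def act {S : SuperSpace V} (R : AnnihilationRep S) (F : Distr V) : Distr V :=
  mulY (-1) (actVal R (pullback F))

/-- The action of the inverse of the generator of `ℤ`. -/
noncomputable def actInv {S : SuperSpace V} (R : AnnihilationRep S) (F : Distr V) : Distr V :=
  mulY 1 (actValInv R (pullbackInv F))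

end Distr

namespace FormalSection

variable {V : Type*} [AddCommGroup V] [Module ℂ V]

/-- The expansion of a section in the annulus `|q| < |x| < 1`. -/
noncomputable def inner (f : FormalSection V) : Distr V :=
  fun m i j s e d => ∑ k, coeffZero (f.g k i j s e d) m • f.v k

/-- The expansion of a section in the annulus `1 < |x| < |q|⁻¹`. -/
noncomputable def outer (f : FormalSection V) : Distr V :=
  fun m i j s e d => ∑ k, coeffInfty (f.g k i j s e d) m • f.v k

/-- Equivariance under the action of `ℤ` generated by `𝐪`: this action maps the expansion in
`|q| < |x| < 1` to that in `1 < |x| < |q|⁻¹`, so that the section descends to a section of the chiral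
algebra of the elliptic supercurve `E = 𝔾_m^{1|1} / ℤ` with poles only at the marked point. -/
def IsEquivariant {S : SuperSpace V} (R : AnnihilationRep S) (f : FormalSection V) : Prop :=
  f.outer = Distr.act R f.inner

/-- The translate `𝐪 ^ n · a` of a section, expanded in `|q| < |x| < 1`: its pole is near
`x = q ^ (-n)`, outside of this annulus for `n ≥ 0` and inside of it for `n < 0`. -/
noncomputable def translate {S : SuperSpace V} (R : AnnihilationRep S) (a : FormalSection V) : ℤ → Distr V
  | Int.ofNat n => (Distr.act R)^[n] a.inner
  | Int.negSucc n => (Distr.actInv R)^[n + 1] a.outer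

/-- `f = π_* a = ∑ₙ 𝐪 ^ n · a`, the sum over `ℤ` being well defined coefficientwise. -/
def IsOrbitSum {S : SuperSpace V} (R : AnnihilationRep S) (a f : FormalSection V) : Prop :=
  ∀ m i j s e d,
    (Function.support fun n : ℤ => a.translate R n m i j s e d).Finite ∧
      f.inner m i j s e d = ∑ᶠ n : ℤ, a.translate R n m i j s e d

/-- Only finitely many monomials `q ^ i y ^ j` occur: the section depends algebraically on the
parameters. -/
def IsAlgebraic (a : FormalSection V) : Prop :=
  {p : ℤ × ℤ | ∃ k, a.g k p.1 p.2 ≠ 0}.Finite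

/-- The powers of `y` in the section are such that products with the traces over `M` are defined
as formal series: for every power `q ^ i` in the section, every conformal weight `n` of `M` and every
`j`, only finitely many charges `c` of the weight `n` part of `M` and powers `y ^ (j - c)` of the
section contribute to `y ^ j`. -/
def CompatibleWith {M : Type*} [AddCommGroup M] [Module ℂ M] {S : SuperSpace M} (R : AnnihilationRep S)
    (f : FormalSection V) : Prop :=
  ∀ i n j : ℤ, {c : ℤ | R.wt (n, c) ≠ ⊥ ∧ ∃ k, f.g k i (j - c) ≠ 0}.Finite

/-- The action of the class of the section `f` in the de Rham cohomology `h` on `b` in the fibre `V` at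
`𝐱₀ = (1, 0)`: `h(f) b = res Y(f(x, θ), x - 1, θ) b`. The residue is an odd functional acting from the
left: it is the coefficient of `(x - 1)⁻¹ θ` with `θ` moved to the left of `ε` and `δ`, whence the sign
`(-1) ^ (e + d)`. The result is a series in `q, y` with coefficients in `V ⊗ ℂ[ε, δ]`. -/
noncomputable def hAct (A : SUSYVertexAlgebra V) (f : FormalSection V) (b : V) :
    ℤ → ℤ → Gr V :=
  fun i j e d => (-1 : ℂ) ^ ((e : ℕ) + (d : ℕ)) • ∑ k, ∑ᶠ n : ℤ,
    (coeffOne (f.g k i j 1 e d) n • A.Y 0 n (f.v k) b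
      + coeffOne (f.g k i j 0 e d) n • A.Y 1 n (f.v k) b)

end FormalSection

/-! ## Laurent expansions of rational functions -/

/-! The conformal block property is a residue theorem placed under a trace. Let f_- and f_+ be the
two expansions of the section, and write res Y(F) for the residue of Y(F(x,θ),x,θ). Moving a contour
across the marked point gives Y(h(f)b) = res Y(f_+) Y(b) ∓ Y(b) res Y(f_-). This is the Borcherds
identity for the functions x^m (x-1)^n, which span the coefficients of f (`residueIdentity`,
`hasPointwiseSum_hOp`). Multiply by 𝐪⁻¹ and take supertraces. By cyclicity the first term becomes ±
str Y(b) 𝐪⁻¹ res Y(f_+). Covariance of the fields says 𝐪⁻¹ res Y(𝐪·F) = res Y(F) 𝐪⁻¹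
(`sum_qTuple_smear`). Since f_+ = 𝐪·f_-, the two terms cancel (`sum_strLin_commutator`).

Finiteness makes this rigorous. The coefficients of 𝐪⁻¹ factor through finite dimensional joint
eigenspaces, so all products with them lie in an ideal (`traceable`) on which the supertrace is
additive, satisfies the signed cyclicity rule and commutes with pointwise finite sums
(`str_mul_comm`, `str_hasPointwiseSum`). For one coefficient of q^i y^j only finitely many weights w
of M contribute. The cancellation takes place for each mode and each degree D in (x,θ), but only
after summation over w, because 𝐪 exchanges weights of M with powers of q and y.

For an orbit sum, 𝐪 shifts the summation index. The only defect is at n = -1, where a_+ appears in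
place of a_-; hence 𝐪·f_- = f_- + a_+ - a_-. It remains to see that f - a has equal expansions on
both sides of the marked point (`IsOrbitSum.outer_sub`). In a component of weight p and degree D,
the translate by 𝐪^n moves the power of q by n(D - p). As a has finitely many powers of q, a fixed
coefficient of q^i receives terms with n ≠ 0 only for D in a bounded range. So f - a is
coefficientwise a Laurent polynomial. -/

theorem eval₂_ne_zero_of_ne_C {z : LaurentSeries ℂ} (hz : ∀ c : ℂ, z ≠ HahnSeries.C c)
    {p : Polynomial ℂ} (hp : p ≠ 0) : p.eval₂ HahnSeries.C z ≠ 0 := by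
  -- Over `ℂ` the polynomial splits, and no linear factor `z - c` vanishes, since `z` is not
  -- constant.
  rw [(IsAlgClosed.splits p).eq_prod_roots, Polynomial.eval₂_mul, Polynomial.eval₂_multiset_prod]
  refine mul_ne_zero (by simpa using hp) (Multiset.prod_ne_zero ?_)
  simp only [Multiset.map_map, Multiset.mem_map, Function.comp_apply, not_exists, not_and]
  intro c _ h
  rw [Polynomial.eval₂_sub, Polynomial.eval₂_X, Polynomial.eval₂_C, sub_eq_zero] at h
  exact hz c h

/-- Substitution of a nonconstant Laurent series for the variable of a rational function. -/
noncomputable def ratEval (z : LaurentSeries ℂ) (hz : ∀ c : ℂ, z ≠ HahnSeries.C c) :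
    RatFunc ℂ →+* LaurentSeries ℂ where
  toFun g := RatFunc.eval HahnSeries.C z g
  map_zero' := RatFunc.eval_zero ..
  map_one' := RatFunc.eval_one ..
  map_add' _ _ := RatFunc.eval_add _ _ (eval₂_ne_zero_of_ne_C hz (RatFunc.denom_ne_zero _))
    (eval₂_ne_zero_of_ne_C hz (RatFunc.denom_ne_zero _))
  map_mul' _ _ := RatFunc.eval_mul _ _ (eval₂_ne_zero_of_ne_C hz (RatFunc.denom_ne_zero _))
    (eval₂_ne_zero_of_ne_C hz (RatFunc.denom_ne_zero _))

theorem ratEval_X (z : LaurentSeries ℂ) (hz) : ratEval z hz RatFunc.X = z := RatFunc.eval_X ..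

theorem ratEval_C (z : LaurentSeries ℂ) (hz) (c : ℂ) :
    ratEval z hz (RatFunc.C c) = HahnSeries.C c := RatFunc.eval_C ..

theorem ne_C_of_coeff {z : LaurentSeries ℂ} {n : ℤ} (hn : n ≠ 0) (h : z.coeff n ≠ 0) (c : ℂ) :
    z ≠ HahnSeries.C c := by
  rintro rfl
  exact h (by simp [HahnSeries.C_apply, HahnSeries.coeff_single_of_ne hn])

theorem single_ne_C (n : ℤ) (hn : n ≠ 0) (c : ℂ) :
    (HahnSeries.single n 1 : LaurentSeries ℂ) ≠ HahnSeries.C c :=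
  ne_C_of_coeff hn (by simp) c

theorem one_add_single_ne_C (c : ℂ) :
    (1 + HahnSeries.single 1 1 : LaurentSeries ℂ) ≠ HahnSeries.C c :=
  ne_C_of_coeff one_ne_zero (by simp [HahnSeries.coeff_one]) c

noncomputable def evalZero : RatFunc ℂ →+* LaurentSeries ℂ :=
  ratEval (HahnSeries.single 1 1) (single_ne_C 1 one_ne_zero)

noncomputable def evalInfty : RatFunc ℂ →+* LaurentSeries ℂ :=
  ratEval (HahnSeries.single (-1) 1) (single_ne_C (-1) (by norm_num))

noncomputable def evalOne : RatFunc ℂ →+* LaurentSeries ℂ :=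
  ratEval (1 + HahnSeries.single 1 1) one_add_single_ne_C

theorem evalZero_X : evalZero RatFunc.X = HahnSeries.single 1 1 := ratEval_X ..

theorem evalInfty_X : evalInfty RatFunc.X = HahnSeries.single (-1) 1 := ratEval_X ..

theorem evalOne_X : evalOne RatFunc.X = 1 + HahnSeries.single 1 1 := ratEval_X ..

theorem coeffZero_eq (g : RatFunc ℂ) (m : ℤ) : coeffZero g m = (evalZero g).coeff m := rfl

theorem coeffInfty_eq (g : RatFunc ℂ) (m : ℤ) : coeffInfty g m = (evalInfty g).coeff (-m) := rfl

theorem coeffOne_eq (g : RatFunc ℂ) (m : ℤ) : coeffOne g m = (evalOne g).coeff m := rfl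

theorem LaurentSeries.exists_coeff_eq_zero (z : LaurentSeries ℂ) :
    ∃ B : ℤ, ∀ m < B, z.coeff m = 0 :=
  ⟨z.order, fun _ h => HahnSeries.coeff_eq_zero_of_lt_order h⟩

theorem coeffZero_bounded (g : RatFunc ℂ) : ∃ B : ℤ, ∀ m < B, coeffZero g m = 0 :=
  LaurentSeries.exists_coeff_eq_zero _

theorem coeffOne_bounded (g : RatFunc ℂ) : ∃ B : ℤ, ∀ m < B, coeffOne g m = 0 :=
  LaurentSeries.exists_coeff_eq_zero _

theorem coeffInfty_bounded (g : RatFunc ℂ) : ∃ B : ℤ, ∀ m > B, coeffInfty g m = 0 := by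
  obtain ⟨B, hB⟩ := LaurentSeries.exists_coeff_eq_zero (evalInfty g)
  exact ⟨-B, fun m hm => hB _ (by omega)⟩

/-- The coefficient functionals, linearly in the rational function. -/
theorem coeffZero_add (g h : RatFunc ℂ) (m : ℤ) :
    coeffZero (g + h) m = coeffZero g m + coeffZero h m := by simp [coeffZero_eq]

theorem coeffInfty_add (g h : RatFunc ℂ) (m : ℤ) :
    coeffInfty (g + h) m = coeffInfty g m + coeffInfty h m := by simp [coeffInfty_eq]

theorem coeffOne_add (g h : RatFunc ℂ) (m : ℤ) :
    coeffOne (g + h) m = coeffOne g m + coeffOne h m := by simp [coeffOne_eq]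

theorem coeffZero_C_mul (c : ℂ) (g : RatFunc ℂ) (m : ℤ) :
    coeffZero (RatFunc.C c * g) m = c * coeffZero g m := by
  simp [coeffZero_eq, evalZero, ratEval_C, HahnSeries.C_apply]

theorem coeffInfty_C_mul (c : ℂ) (g : RatFunc ℂ) (m : ℤ) :
    coeffInfty (RatFunc.C c * g) m = c * coeffInfty g m := by
  simp [coeffInfty_eq, evalInfty, ratEval_C, HahnSeries.C_apply]

theorem coeffOne_C_mul (c : ℂ) (g : RatFunc ℂ) (m : ℤ) :
    coeffOne (RatFunc.C c * g) m = c * coeffOne g m := by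
  simp [coeffOne_eq, evalOne, ratEval_C, HahnSeries.C_apply]

@[simp] theorem coeffZero_zero (m : ℤ) : coeffZero 0 m = 0 := by simp [coeffZero_eq]

@[simp] theorem coeffInfty_zero (m : ℤ) : coeffInfty 0 m = 0 := by simp [coeffInfty_eq]

@[simp] theorem coeffOne_zero (m : ℤ) : coeffOne 0 m = 0 := by simp [coeffOne_eq]

/-- A ring homomorphism to a field maps the binomial series to a power of `1 + X`. -/
theorem map_binomialSeries {F : Type*} [Field F] (φ : PowerSeries ℂ →+* F) (n : ℤ) :
    φ (PowerSeries.binomialSeries ℂ n) = (1 + φ PowerSeries.X) ^ n := by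
  obtain ⟨k, rfl | rfl⟩ := n.eq_nat_or_neg
  · rw [PowerSeries.binomialSeries_nat]; simp
  -- Negative exponents follow from the additivity of the binomial series in its exponent: the
  -- images for `-k` and `k` are mutually inverse.
  · have h : φ (PowerSeries.binomialSeries ℂ (-(k : ℤ))) *
        φ (PowerSeries.binomialSeries ℂ (k : ℤ)) = 1 := by
      rw [← map_mul, ← PowerSeries.binomialSeries_add]
      simp
    have hk : φ (PowerSeries.binomialSeries ℂ (k : ℤ)) = (1 + φ PowerSeries.X) ^ k := by
      rw [PowerSeries.binomialSeries_nat]; simp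
    rw [hk] at h
    rw [zpow_neg, zpow_natCast]
    exact eq_inv_of_mul_eq_one_left h

theorem coeff_one_add_zpow (n : ℤ) (j : ℕ) :
    ((1 + HahnSeries.single 1 1 : LaurentSeries ℂ) ^ n).coeff j = ((Ring.choose n j : ℤ) : ℂ) := by
  have h := map_binomialSeries (HahnSeries.ofPowerSeries ℤ ℂ) n
  rw [HahnSeries.ofPowerSeries_X] at h
  rw [← h, HahnSeries.ofPowerSeries_apply_coeff]
  simp

theorem coeff_one_add_zpow_neg (n : ℤ) {l : ℤ} (hl : l < 0) :
    ((1 + HahnSeries.single 1 1 : LaurentSeries ℂ) ^ n).coeff l = 0 := by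
  have h := map_binomialSeries (HahnSeries.ofPowerSeries ℤ ℂ) n
  rw [HahnSeries.ofPowerSeries_X] at h
  rw [← h, PowerSeries.coeff_coe, if_pos hl]

theorem one_sub_single_zpow (n : ℤ) : (1 - HahnSeries.single 1 1 : LaurentSeries ℂ) ^ n =
    HahnSeries.ofPowerSeries ℤ ℂ (PowerSeries.rescale (-1 : ℂ) (PowerSeries.binomialSeries ℂ n)) := by
  have h := map_binomialSeries
    ((HahnSeries.ofPowerSeries ℤ ℂ).comp (PowerSeries.rescale (-1 : ℂ))) n
  have hX : PowerSeries.rescale (-1 : ℂ) PowerSeries.X = -PowerSeries.X := by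
    ext k; by_cases hk : k = 1 <;> simp [PowerSeries.coeff_X, hk]
  rw [RingHom.comp_apply, RingHom.comp_apply, hX, map_neg, HahnSeries.ofPowerSeries_X,
    ← sub_eq_add_neg] at h
  exact h.symm

theorem coeff_one_sub_zpow (n : ℤ) (j : ℕ) :
    ((1 - HahnSeries.single 1 1 : LaurentSeries ℂ) ^ n).coeff j
      = (-1) ^ j * ((Ring.choose n j : ℤ) : ℂ) := by
  rw [one_sub_single_zpow, HahnSeries.ofPowerSeries_apply_coeff, PowerSeries.coeff_rescale]
  simp

theorem coeff_one_sub_zpow_neg (n : ℤ) {l : ℤ} (hl : l < 0) :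
    ((1 - HahnSeries.single 1 1 : LaurentSeries ℂ) ^ n).coeff l = 0 := by
  rw [one_sub_single_zpow, PowerSeries.coeff_coe, if_pos hl]

/-- The functions `x ^ m (x - 1) ^ n`, which span the regular functions. -/
noncomputable def binomFun (m n : ℤ) : RatFunc ℂ := RatFunc.X ^ m * (RatFunc.X - 1) ^ n

theorem single_zpow_int (k m : ℤ) :
    (HahnSeries.single k 1 : LaurentSeries ℂ) ^ m = HahnSeries.single (k * m) 1 := by
  obtain ⟨j, rfl | rfl⟩ := m.eq_nat_or_neg
  · rw [zpow_natCast, HahnSeries.single_pow]; simp [mul_comm]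
  · rw [zpow_neg, zpow_natCast, HahnSeries.single_pow]
    refine inv_eq_of_mul_eq_one_right ?_
    rw [HahnSeries.single_mul_single]
    simp [mul_comm]

theorem evalOne_binomFun (m n : ℤ) : evalOne (binomFun m n) =
    HahnSeries.single n 1 * (1 + HahnSeries.single 1 1 : LaurentSeries ℂ) ^ m := by
  rw [binomFun, map_mul, map_zpow₀, map_zpow₀, map_sub, map_one evalOne, evalOne_X,
    add_sub_cancel_left, single_zpow_int, one_mul, mul_comm]

theorem evalZero_binomFun (m n : ℤ) : evalZero (binomFun m n) =
    HahnSeries.single m ((-1) ^ n) * (1 - HahnSeries.single 1 1 : LaurentSeries ℂ) ^ n := by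
  -- At the origin `x - 1 = -(1 - x)`. This produces the factor `(-1) ^ n` of the second product in
  -- the Borcherds identity.
  have h : (HahnSeries.single 1 1 - 1 : LaurentSeries ℂ)
    = HahnSeries.C (-1) * (1 - HahnSeries.single 1 1) := by simp
  rw [binomFun, map_mul, map_zpow₀, map_zpow₀, map_sub, map_one evalZero, evalZero_X, h, mul_zpow,
    ← mul_assoc, single_zpow_int, one_mul, ← map_zpow₀, HahnSeries.C_apply,
    HahnSeries.single_mul_single, one_mul, add_zero]

theorem evalInfty_binomFun (m n : ℤ) : evalInfty (binomFun m n) =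
    HahnSeries.single (-m - n) 1 * (1 - HahnSeries.single 1 1 : LaurentSeries ℂ) ^ n := by
  -- With `t = x⁻¹` the local parameter at infinity, `x - 1 = t⁻¹ (1 - t)`.
  have h : (HahnSeries.single (-1) 1 - 1 : LaurentSeries ℂ)
      = HahnSeries.single (-1) 1 * (1 - HahnSeries.single 1 1) := by
    rw [mul_sub, HahnSeries.single_mul_single]; simp
  rw [binomFun, map_mul, map_zpow₀, map_zpow₀, map_sub, map_one evalInfty, evalInfty_X, h, mul_zpow,
    ← mul_assoc, single_zpow_int, single_zpow_int, HahnSeries.single_mul_single]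
  congr 3 <;> ring

theorem coeffOne_binomFun (m n : ℤ) (j : ℕ) :
    coeffOne (binomFun m n) (n + j) = ((Ring.choose m j : ℤ) : ℂ) := by
  rw [coeffOne_eq, evalOne_binomFun, HahnSeries.coeff_single_mul, add_sub_cancel_left,
    coeff_one_add_zpow, one_mul]

theorem coeffOne_binomFun_of_lt (m n : ℤ) {l : ℤ} (h : l < n) :
    coeffOne (binomFun m n) l = 0 := by
  rw [coeffOne_eq, evalOne_binomFun, HahnSeries.coeff_single_mul,
    coeff_one_add_zpow_neg _ (by omega), mul_zero]

theorem coeffZero_binomFun (m n : ℤ) (j : ℕ) :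
    coeffZero (binomFun m n) (m + j) = (-1) ^ n * ((-1) ^ j * ((Ring.choose n j : ℤ) : ℂ)) := by
  rw [coeffZero_eq, evalZero_binomFun, HahnSeries.coeff_single_mul, add_sub_cancel_left,
    coeff_one_sub_zpow]

theorem coeffZero_binomFun_of_lt (m n : ℤ) {l : ℤ} (h : l < m) :
    coeffZero (binomFun m n) l = 0 := by
  rw [coeffZero_eq, evalZero_binomFun, HahnSeries.coeff_single_mul,
    coeff_one_sub_zpow_neg _ (by omega), mul_zero]

theorem coeffInfty_binomFun (m n : ℤ) (j : ℕ) :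
    coeffInfty (binomFun m n) (m + n - j) = (-1) ^ j * ((Ring.choose n j : ℤ) : ℂ) := by
  rw [coeffInfty_eq, evalInfty_binomFun, HahnSeries.coeff_single_mul,
    show -(m + n - (j : ℤ)) - (-m - n) = j by ring, coeff_one_sub_zpow, one_mul]

theorem coeffInfty_binomFun_of_gt (m n : ℤ) {l : ℤ} (h : m + n < l) :
    coeffInfty (binomFun m n) l = 0 := by
  rw [coeffInfty_eq, evalInfty_binomFun, HahnSeries.coeff_single_mul,
    coeff_one_sub_zpow_neg _ (by omega), mul_zero]

/-- Regular functions are combinations of the functions `x ^ m (x - 1) ^ n`. -/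
theorem IsRegularFunction.induction {p : RatFunc ℂ → Prop} (hadd : ∀ g h, p g → p h → p (g + h))
    (hsmul : ∀ (c : ℂ) g, p g → p (RatFunc.C c * g)) (hb : ∀ m n, p (binomFun m n))
    {g : RatFunc ℂ} (hg : IsRegularFunction g) : p g := by
  obtain ⟨a, b, P, h⟩ := hg
  have hX : (RatFunc.X : RatFunc ℂ) ≠ 0 := RatFunc.X_ne_zero
  have hX1 : (RatFunc.X - 1 : RatFunc ℂ) ≠ 0 := by
    intro h
    have := congrArg evalOne h
    rw [map_sub, map_one evalOne, map_zero, evalOne_X, add_sub_cancel_left] at this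
    simp at this
  have hgP : g = algebraMap (Polynomial ℂ) (RatFunc ℂ) P * binomFun (-a) (-b) := by
    rw [← h, binomFun, zpow_neg, zpow_neg, zpow_natCast, zpow_natCast]
    field_simp
  rw [hgP]
  clear h hgP
  induction P using Polynomial.induction_on' with
  | add P Q hP hQ => rw [map_add, add_mul]; exact hadd _ _ hP hQ
  | monomial n c =>
    have : algebraMap (Polynomial ℂ) (RatFunc ℂ) (Polynomial.monomial n c) * binomFun (-a) (-b)
        = RatFunc.C c * binomFun (n - a) (-b) := by
      rw [RatFunc.algebraMap_monomial, binomFun, binomFun,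
        sub_eq_add_neg (n : ℤ), zpow_add₀ hX, zpow_natCast]
      ring
    rw [this]
    exact hsmul _ _ (hb _ _)

/-! ## Consequences of the Borcherds identity -/

/-- Residues are sums over all integers, the Borcherds identity has sums over natural numbers; this
passes from one to the other by discarding indices where a Laurent expansion vanishes. -/
theorem finsum_eq_finsum_comp {α β E : Type*} [AddCommMonoid E] {H : α → E} {φ : β → α}
    (hφ : Function.Injective φ) (h : ∀ l, (∀ j, φ j ≠ l) → H l = 0) :
    ∑ᶠ l, H l = ∑ᶠ j, H (φ j) := by
  rw [← finsum_mem_range hφ, ← finsum_mem_univ H]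
  refine finsum_mem_inter_support_eq H _ _ (Set.ext fun l => ?_)
  refine ⟨fun hl => ⟨?_, hl.2⟩, fun hl => ⟨trivial, hl.2⟩⟩
  by_contra hr
  exact hl.2 (h l fun j hj => hr ⟨j, hj⟩)

/-- Signs, and hence the Borcherds identity, are only defined for homogeneous vectors; additive
statements extend by splitting a vector into its even and odd halves. -/
theorem SuperSpace.hasParity_induction {W : Type*} [AddCommGroup W] [Module ℂ W] (S : SuperSpace W)
    {P : W → Prop} (hadd : ∀ u v, P u → P v → P (u + v))
    (h : ∀ p w, S.HasParity p w → P w) (w : W) : P w := by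
  have h0 : S.HasParity 0 ((1 / 2 : ℂ) • (w + S.par w)) := by
    simp [HasParity, S.par_par, add_comm]
  have h1 : S.HasParity 1 ((1 / 2 : ℂ) • (w - S.par w)) := by
    simp only [HasParity, map_smul, map_sub, S.par_par]
    simp only [Fin.val_one, pow_one]
    module
  have : w = (1 / 2 : ℂ) • (w + S.par w) + (1 / 2 : ℂ) • (w - S.par w) := by module
  rw [this]
  exact hadd _ _ (h _ _ h0) (h _ _ h1)

section

variable {V M : Type*} [AddCommGroup V] [Module ℂ V] [AddCommGroup M] [Module ℂ M]

theorem SUSYVertexAlgebra.hasParity_vac (A : SUSYVertexAlgebra V) : A.HasParity 0 A.vac := by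
  simp [SuperSpace.HasParity, A.par_vac]

/-- Presenting `D a` as a product with the vacuum makes it accessible to the Borcherds identity, so
that a derivative formula on modules can be deduced and need not be assumed. -/
theorem SUSYVertexAlgebra.D_eq (A : SUSYVertexAlgebra V) (a : V) :
    A.D a = A.Y 1 (-1) a A.vac := by
  simpa [A.D_vac, A.creation] using A.D_cov_zero (-1) a A.vac

theorem SUSYVertexAlgebra.T_eq (A : SUSYVertexAlgebra V) (a : V) :
    A.T a = A.Y 0 (-2) a A.vac := by
  simpa [A.T_vac, A.creation] using A.T_cov 0 (-1) a A.vac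

theorem choose_neg_one (j : ℕ) : Ring.choose (-1 : ℤ) j = (-1) ^ j := by
  rw [Ring.choose_neg, show (1 : ℤ) + j - 1 = (j : ℕ) by ring, Ring.choose_natCast, Nat.choose_self]
  simp [Units.smul_def, Int.coe_negOnePow_natCast]

theorem choose_neg_two (j : ℕ) : Ring.choose (-2 : ℤ) j = (-1) ^ j * (j + 1) := by
  rw [Ring.choose_neg, show (2 : ℤ) + j - 1 = (j + 1 : ℕ) by push_cast; ring, Ring.choose_natCast,
    Nat.choose_succ_self_right]
  simp [Units.smul_def, Int.coe_negOnePow_natCast, mul_add]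

namespace SUSYModule

variable {A : SUSYVertexAlgebra V} (N : SUSYModule A M)

/-- The iterate of a field with the vacuum. -/
theorem Y_iterate_vac (s : Fin 2) (k n : ℤ) {p : Fin 2} {a : V} (ha : A.HasParity p a) (x : M) :
    N.Y 0 k (A.Y s n a A.vac) x = ∑ᶠ j : ℕ, ((-1 : ℂ) ^ j * ((Ring.choose n j : ℤ) : ℂ)) •
      (N.Y s (n - j) a (if k + j = -1 then x else 0)
        - (-1 : ℂ) ^ n • if n + k - j = -1 then N.Y s j a x else 0) := by
  have h := N.borcherds p 0 a A.vac ha A.hasParity_vac s 0 0 k n x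
  rw [finsum_eq_single _ 0] at h
  · simpa [N.vac_zero] using h
  · intro j hj
    rw [Ring.choose_zero_ite, if_neg hj]
    simp

/-- In `Y_iterate_vac` with `n = -1` the vacuum has a single nonzero mode, so one term survives: it
comes from the second product if `k ≥ 0` and from the first if `k < 0`. -/
theorem Y_zero_D (k : ℤ) (a : V) : N.Y 0 k (A.D a) = N.Y 1 k a := by
  refine A.hasParity_induction (P := fun a => N.Y 0 k (A.D a) = N.Y 1 k a)
    (fun u v hu hv => by rw [map_add, map_add, map_add, hu, hv]) (fun p a ha => ?_) a
  ext x
  rw [A.D_eq, N.Y_iterate_vac 1 k (-1) ha]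
  by_cases hk : 0 ≤ k
  · lift k to ℕ using hk
    rw [finsum_eq_single _ k]
    · have h1 : (k : ℤ) + k ≠ -1 := by omega
      simp [choose_neg_one, h1, ← mul_pow]
    · intro j hj
      have h1 : (k : ℤ) + j ≠ -1 := by omega
      have h2 : -1 + (k : ℤ) - j ≠ -1 := by omega
      simp [h1, h2]
  · obtain ⟨l, rfl⟩ : ∃ l : ℕ, k = -1 - l := ⟨(-1 - k).toNat, by omega⟩
    rw [finsum_eq_single _ l]
    · have h1 : -1 + (-1 - (l : ℤ)) - l ≠ -1 := by omega
      simp [choose_neg_one, h1, ← mul_pow]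
    · intro j hj
      have h1 : -1 - (l : ℤ) + j ≠ -1 := by omega
      have h2 : -1 + (-1 - (l : ℤ)) - j ≠ -1 := by omega
      simp [h1, h2]

/-- The same computation with `n = -2`; now the surviving binomial coefficient supplies the factor
`-k`, and at `k = 0` no term survives. -/
theorem Y_zero_T (k : ℤ) (a : V) : N.Y 0 k (A.T a) = (-k : ℂ) • N.Y 0 (k - 1) a := by
  refine A.hasParity_induction (P := fun a => N.Y 0 k (A.T a) = (-k : ℂ) • N.Y 0 (k - 1) a)
    (fun u v hu hv => by rw [map_add, map_add, map_add, hu, hv, smul_add]) (fun p a ha => ?_) a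
  ext x
  rw [A.T_eq, N.Y_iterate_vac 0 k (-2) ha]
  have hsq : ∀ j : ℕ, (-1 : ℂ) ^ j * ((-1) ^ j * (j + 1)) = j + 1 := fun j => by
    rw [← mul_assoc, ← mul_pow]; simp
  by_cases hk : 1 ≤ k
  · obtain ⟨l, rfl⟩ : ∃ l : ℕ, k = l + 1 := ⟨(k - 1).toNat, by omega⟩
    rw [finsum_eq_single _ l]
    · have h1 : (l : ℤ) + 1 + l ≠ -1 := by omega
      have h2 : -2 + ((l : ℤ) + 1) - l = -1 := by omega
      have h3 : (-1 : ℂ) ^ (-2 : ℤ) = 1 := by norm_num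
      simp only [h1, h2, h3, choose_neg_two, Int.cast_mul, Int.cast_pow, Int.cast_neg, Int.cast_one,
        Int.cast_add, Int.cast_natCast, hsq, if_true, if_false, map_zero, one_smul,
        LinearMap.smul_apply, add_sub_cancel_right]
      module
    · intro j hj
      have h1 : (l : ℤ) + 1 + j ≠ -1 := by omega
      have h2 : -2 + ((l : ℤ) + 1) - j ≠ -1 := by omega
      simp [h1, h2]
  · by_cases hk0 : k = 0
    · subst hk0
      rw [finsum_eq_zero_of_forall_eq_zero]
      · simp
      · intro j
        have h1 : (0 : ℤ) + j ≠ -1 := by omega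
        have h2 : -2 + (0 : ℤ) - j ≠ -1 := by omega
        simp only [h1, h2, if_false, map_zero, smul_zero, sub_zero]
    obtain ⟨l, rfl⟩ : ∃ l : ℕ, k = -1 - l := ⟨(-1 - k).toNat, by omega⟩
    rw [finsum_eq_single _ l]
    · have h1 : -2 + (-1 - (l : ℤ)) - l ≠ -1 := by omega
      have h2 : -1 - (l : ℤ) + l = -1 := by omega
      have h3 : -1 - (l : ℤ) - 1 = -2 - l := by ring
      simp only [h1, h2, h3, choose_neg_two, Int.cast_mul, Int.cast_pow, Int.cast_neg, Int.cast_one,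
        Int.cast_add, Int.cast_sub, Int.cast_natCast, hsq, if_true, if_false, smul_zero, sub_zero,
        LinearMap.smul_apply]
      congr 1
      ring
    · intro j hj
      have h1 : -1 - (l : ℤ) + j ≠ -1 := by omega
      have h2 : -2 + (-1 - (l : ℤ)) - j ≠ -1 := by omega
      simp [h1, h2]

theorem Y_one_D (k : ℤ) (a : V) : N.Y 1 k (A.D a) = 0 := by
  rw [← Y_zero_D, ← Module.End.mul_apply, A.D_D, LinearMap.zero_apply, map_zero]

theorem Y_T (s : Fin 2) (k : ℤ) (a : V) : N.Y s k (A.T a) = (-k : ℂ) • N.Y s (k - 1) a := by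
  fin_cases s
  · exact N.Y_zero_T k a
  · change N.Y 1 k (A.T a) = (-k : ℂ) • N.Y 1 (k - 1) a
    rw [← Y_zero_D, ← Module.End.mul_apply, ← A.T_D, Module.End.mul_apply, N.Y_zero_T, Y_zero_D]

/-! ### The Borcherds identity for a regular function -/

theorem finite_support_coeffOne (g : RatFunc ℂ) (s : Fin 2) (a b : V) (F : ℤ → V →ₗ[ℂ] M) :
    (Function.support fun l => coeffOne g l • F l (A.Y s l a b)).Finite := by
  obtain ⟨B, hB⟩ := coeffOne_bounded g
  obtain ⟨K, hK⟩ := A.trunc a b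
  refine (Set.finite_Ico B K).subset fun l hl => ?_
  contrapose! hl
  rw [Set.mem_Ico, not_and_or, not_le, not_lt] at hl
  rcases hl with hl | hl <;> simp [hB, hK, hl]

theorem finite_support_coeffInfty (g : RatFunc ℂ) (s : Fin 2) (a b : V) (K : ℤ) (x : M) :
    (Function.support fun l => coeffInfty g l • N.Y s l a (N.Y 0 (K - l) b x)).Finite := by
  obtain ⟨B, hB⟩ := coeffInfty_bounded g
  obtain ⟨k, hk⟩ := N.trunc b x
  refine (Set.finite_Icc (K - k) B).subset fun l hl => ?_
  contrapose! hl
  rw [Set.mem_Icc, not_and_or, not_le, not_le] at hl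
  rcases hl with hl | hl
  · simp [hk 0 (K - l) (by omega)]
  · simp [hB l hl]

theorem finite_support_coeffZero (g : RatFunc ℂ) (s : Fin 2) (a b : V) (K : ℤ) (x : M) :
    (Function.support fun l => coeffZero g l • N.Y 0 (K - l) b (N.Y s l a x)).Finite := by
  obtain ⟨B, hB⟩ := coeffZero_bounded g
  obtain ⟨k, hk⟩ := N.trunc a x
  refine (Set.finite_Ico B k).subset fun l hl => ?_
  contrapose! hl
  rw [Set.mem_Ico, not_and_or, not_le, not_lt] at hl
  rcases hl with hl | hl
  · simp [hB l hl]
  · simp [hk s l hl]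

/-- The residue theorem for a regular function `g` against a product of two fields: the total
residue at `x = 1` is the difference of the contributions of the expansions at `∞` and `0`. -/
def ResidueIdentity (r : ℕ) (s : Fin 2) (K : ℤ) (a b : V) (x : M) (g : RatFunc ℂ) : Prop :=
  ∑ᶠ l : ℤ, coeffOne g l • N.Y 0 (K - l) (A.Y s l a b) x
    = ∑ᶠ l : ℤ, coeffInfty g l • N.Y s l a (N.Y 0 (K - l) b x)
      - (-1 : ℂ) ^ r • ∑ᶠ l : ℤ, coeffZero g l • N.Y 0 (K - l) b (N.Y s l a x)

theorem residueIdentity_binomFun {p r : Fin 2} {a b : V} (ha : A.HasParity p a)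
    (hb : A.HasParity r b) (s : Fin 2) (K : ℤ) (x : M) (m n : ℤ) :
    N.ResidueIdentity (((p : ℕ) + s) * r) s K a b x (binomFun m n) := by
  -- The exponent of `w` is dictated by the total degree: `z ^ m (z - w) ^ n w ^ (K - m - n)` is the
  -- homogenization in degree `K` of `x ^ m (x - 1) ^ n`.
  have h := N.borcherds p r a b ha hb s 0 m (K - m - n) n x
  have e1 : (∑ᶠ l : ℤ, coeffOne (binomFun m n) l • N.Y 0 (K - l) (A.Y s l a b) x) =
      ∑ᶠ j : ℕ, ((Ring.choose m j : ℤ) : ℂ) • N.Y 0 (K - (n + j)) (A.Y s (n + j) a b) x := by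
    rw [finsum_eq_finsum_comp (φ := fun j : ℕ => n + j) (fun i j h => by simpa using h)]
    · simp only [coeffOne_binomFun]
    · intro l hl
      rw [coeffOne_binomFun_of_lt _ _ (by by_contra hn; exact hl (l - n).toNat (by omega)), zero_smul]
  have inj2 : Function.Injective fun j : ℕ => m + n - (j : ℤ) := fun i j h => by simpa using h
  have inj3 : Function.Injective fun j : ℕ => m + (j : ℤ) := fun i j h => by simpa using h
  have e2 : (∑ᶠ l : ℤ, coeffInfty (binomFun m n) l • N.Y s l a (N.Y 0 (K - l) b x)) =
      ∑ᶠ j : ℕ, ((-1 : ℂ) ^ j * ((Ring.choose n j : ℤ) : ℂ)) •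
        N.Y s (m + n - j) a (N.Y 0 (K - (m + n - j)) b x) := by
    rw [finsum_eq_finsum_comp inj2]
    · simp only [coeffInfty_binomFun]
    · intro l hl
      rw [coeffInfty_binomFun_of_gt _ _ (by by_contra hn; exact hl (m + n - l).toNat (by omega)),
        zero_smul]
  have e3 : (∑ᶠ l : ℤ, coeffZero (binomFun m n) l • N.Y 0 (K - l) b (N.Y s l a x)) =
      ∑ᶠ j : ℕ, ((-1 : ℂ) ^ n * ((-1 : ℂ) ^ j * ((Ring.choose n j : ℤ) : ℂ))) •
        N.Y 0 (K - (m + j)) b (N.Y s (m + j) a x) := by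
    rw [finsum_eq_finsum_comp inj3]
    · simp only [coeffZero_binomFun]
    · intro l hl
      rw [coeffZero_binomFun_of_lt _ _ (by by_contra hn; exact hl (l - m).toNat (by omega)),
        zero_smul]
  have f2 := (N.finite_support_coeffInfty (binomFun m n) s a b K x).preimage inj2.injOn
  have f3 := (N.finite_support_coeffZero (binomFun m n) s a b K x).preimage inj3.injOn
  rw [ResidueIdentity, e1, e2, e3, smul_finsum, ← finsum_sub_distrib]
  · simp only [Fin.val_zero, zero_mul, pow_zero, one_smul, Fin.zero_eq_one_iff, OfNat.ofNat_ne_one,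
      and_false, if_false, sub_zero, add_zero] at h
    refine (finsum_congr fun j => ?_).trans (h.trans (finsum_congr fun j => ?_))
    · rw [show m + (K - m - n) - (j : ℤ) = K - (n + j) by ring]
    · rw [show K - (m + n - (j : ℤ)) = K - m - n + j by ring,
        show K - (m + (j : ℤ)) = n + (K - m - n) - j by ring, mul_comm ((p : ℕ) + (s : ℕ))]
      module
  · refine f2.subset fun j hj => ?_
    simpa [coeffInfty_binomFun] using hj
  · refine f3.subset fun j hj => ?_
    simp only [Set.mem_preimage, Function.mem_support, coeffZero_binomFun] at hj ⊢
    exact fun h0 => hj (by rw [h0, smul_zero])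

/-- All three residues are linear in the rational function and are finite sums on a given vector, so
the spanning functions `binomFun` suffice. -/
theorem residueIdentity {p r : Fin 2} {a b : V} (ha : A.HasParity p a)
    (hb : A.HasParity r b) (s : Fin 2) (K : ℤ) (x : M) {g : RatFunc ℂ} (hg : IsRegularFunction g) :
    N.ResidueIdentity (((p : ℕ) + s) * r) s K a b x g := by
  refine hg.induction (fun g h hg hh => ?_) (fun c g hg => ?_)
    (fun m n => N.residueIdentity_binomFun ha hb s K x m n)
  · rw [ResidueIdentity] at *
    simp only [coeffOne_add, coeffInfty_add, coeffZero_add, add_smul]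
    have fin1 := fun g => finite_support_coeffOne (A := A) g s a b fun l => (N.Y 0 (K - l)).flip x
    simp only [LinearMap.flip_apply] at fin1
    rw [finsum_add_distrib (fin1 g) (fin1 h),
      finsum_add_distrib (N.finite_support_coeffInfty g s a b K x)
        (N.finite_support_coeffInfty h s a b K x),
      finsum_add_distrib (N.finite_support_coeffZero g s a b K x)
        (N.finite_support_coeffZero h s a b K x)]
    rw [hg, hh]
    module
  · rw [ResidueIdentity] at *
    simp only [coeffOne_C_mul, coeffInfty_C_mul, coeffZero_C_mul, mul_smul]
    rw [← smul_finsum, ← smul_finsum, ← smul_finsum, hg]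
    module

end SUSYModule

end

/-! ## The joint eigenspace decomposition -/

section

variable {W : Type*} [AddCommGroup W] [Module ℂ W] {S : SuperSpace W}

namespace AnnihilationRep

variable (R : AnnihilationRep S)

theorem mem_wt {p : ℤ × ℤ} {x : W} :
    x ∈ R.wt p ↔ R.L 0 x = (p.1 : ℂ) • x ∧ R.J 0 x = (p.2 : ℂ) • x := by
  simp [wt, jointEigenspace, Submodule.mem_inf]

theorem component_apply {p q : ℤ × ℤ} {x : W} (hx : x ∈ R.wt q) :
    (R.component p x : W) = if q = p then x else 0 := by
  have h : (LinearEquiv.ofBijective (DirectSum.coeLinearMap (jointEigenspace (R.L 0) (R.J 0)))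
      R.diagonal).symm x = DirectSum.lof ℂ (ℤ × ℤ)
        (fun p => jointEigenspace (R.L 0) (R.J 0) p) q ⟨x, hx⟩ := by
    exact (LinearEquiv.symm_apply_eq _).2 
      (DirectSum.coeLinearMap_lof (jointEigenspace (R.L 0) (R.J 0)) q ⟨x, hx⟩).symm
  have h' := congrArg (DirectSum.component ℂ (ℤ × ℤ)
    (fun p => jointEigenspace (R.L 0) (R.J 0) p) p) h
  refine (congrArg Subtype.val h').trans ?_
  rw [DirectSum.component.of]
  split_ifs with hqp
  · subst hqp; rfl
  · rfl

theorem proj_apply_of_mem {p q : ℤ × ℤ} {x : W} (hx : x ∈ R.wt q) :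
    R.proj p x = if q = p then x else 0 := R.component_apply hx

theorem proj_mem (p : ℤ × ℤ) (x : W) : R.proj p x ∈ R.wt p := (R.component p x).2

theorem proj_proj (p q : ℤ × ℤ) (x : W) :
    R.proj p (R.proj q x) = if q = p then R.proj q x else 0 :=
  R.proj_apply_of_mem (R.proj_mem q x)

/-- Diagonalizability in usable form: additive statements need only be checked on joint eigenvectors
of `L 0` and `J 0`. -/
theorem wt_induction {P : W → Prop} (h0 : P 0) (hadd : ∀ u v, P u → P v → P (u + v))
    (h : ∀ p, ∀ w ∈ R.wt p, P w) (w : W) : P w := by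
  have hw : w ∈ iSup (jointEigenspace (R.L 0) (R.J 0)) := by
    rw [R.diagonal.submodule_iSup_eq_top]; trivial
  exact Submodule.iSup_induction (motive := P) _ hw (fun p w hw => h p w hw) h0 hadd

theorem proj_support_finite (x : W) : (Function.support fun p => R.proj p x).Finite := by
  refine R.wt_induction (P := fun x => (Function.support fun p => R.proj p x).Finite)
    (by simp) (fun u v hu hv => ?_) (fun q w hw => ?_) x
  · refine (hu.union hv).subset fun p hp => ?_
    contrapose! hp
    simp only [Set.mem_union, Function.mem_support, not_or, not_not] at hp
    simp [hp]
  · refine (Set.finite_singleton q).subset fun p hp => ?_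
    by_contra hne
    exact hp (by simp only [R.proj_apply_of_mem hw]; rw [if_neg (fun h => hne h.symm)])

theorem finsum_proj (x : W) : ∑ᶠ p, R.proj p x = x := by
  refine R.wt_induction (P := fun x => ∑ᶠ p, R.proj p x = x)
    (by simp) (fun u v hu hv => ?_) (fun q w hw => ?_) x
  · simp only [map_add]
    rw [finsum_add_distrib (R.proj_support_finite u) (R.proj_support_finite v), hu, hv]
  · simp only [R.proj_apply_of_mem hw]
    rw [finsum_eq_single _ q (fun p hp => if_neg hp.symm), if_pos rfl]

theorem proj_eq_zero {p : ℤ × ℤ} (h : R.wt p = ⊥) : R.proj p = 0 := by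
  ext x
  have := R.proj_mem p x
  rw [h] at this
  exact this

theorem proj_eq_zero_of_neg {p : ℤ × ℤ} (h : p.1 < 0) : R.proj p = 0 :=
  R.proj_eq_zero (R.positive p h)

/-- A homogeneous operator intertwines the projections to the joint eigenspaces. -/
theorem proj_comm {X : Module.End ℂ W} {κ : ℤ × ℤ} (hX : ∀ p, ∀ x ∈ R.wt p, X x ∈ R.wt (p + κ))
    (w : ℤ × ℤ) (x : W) : R.proj (w + κ) (X x) = X (R.proj w x) := by
  refine R.wt_induction (P := fun x => R.proj (w + κ) (X x) = X (R.proj w x))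
    (by simp) (fun u v hu hv => by simp only [map_add, hu, hv]) (fun q x hx => ?_) x
  rw [R.proj_apply_of_mem (hX q x hx), R.proj_apply_of_mem hx]
  simp only [add_left_inj]
  split_ifs <;> simp

theorem L_zero_mem {p : ℤ × ℤ} {x : W} (hx : x ∈ R.wt p) : R.L 0 x ∈ R.wt p := by
  rw [(R.mem_wt.1 hx).1]; exact Submodule.smul_mem _ _ hx

theorem par_mem {p : ℤ × ℤ} {x : W} (hx : x ∈ R.wt p) : S.par x ∈ R.wt p := by
  rw [mem_wt] at hx ⊢
  rw [← R.L_even 0 (by norm_num), ← R.J_even 0 le_rfl, hx.1, hx.2, map_smul, map_smul]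
  exact ⟨rfl, rfl⟩

theorem H_zero_mem {p : ℤ × ℤ} {x : W} (hx : x ∈ R.wt p) : R.H 0 x ∈ R.wt (p + (0, -1)) := by
  rw [mem_wt] at hx ⊢
  have h1 := congrArg (fun T : Module.End ℂ W => T x) (R.L_H 0 0 (by norm_num) le_rfl)
  have h2 := congrArg (fun T : Module.End ℂ W => T x) (R.J_H 0 0 le_rfl le_rfl)
  simp only [LinearMap.sub_apply, Module.End.mul_apply, LinearMap.neg_apply,
    hx.1, hx.2, map_smul, Int.cast_zero, neg_zero, zero_smul, add_zero, sub_eq_iff_eq_add] at h1 h2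
  refine ⟨by simpa using h1, ?_⟩
  rw [h2, Prod.snd_add]
  push_cast
  module

theorem Q_zero_mem {p : ℤ × ℤ} {x : W} (hx : x ∈ R.wt p) : R.Q 0 x ∈ R.wt (p + (0, 1)) := by
  rw [mem_wt] at hx ⊢
  have h1 := congrArg (fun T : Module.End ℂ W => T x) (R.L_Q 0 0 (by norm_num) (by norm_num))
  have h2 := congrArg (fun T : Module.End ℂ W => T x) (R.J_Q 0 0 le_rfl (by norm_num))
  simp only [LinearMap.sub_apply, Module.End.mul_apply,
    hx.1, hx.2, map_smul, Int.cast_zero, sub_zero, zero_smul, add_zero, sub_eq_iff_eq_add] at h1 h2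
  refine ⟨by simpa using h1, ?_⟩
  rw [h2, Prod.snd_add]
  push_cast
  module

theorem proj_par (w : ℤ × ℤ) (x : W) : R.proj w (S.par x) = S.par (R.proj w x) := by
  simpa using R.proj_comm (X := S.par) (κ := 0) (fun p x hx => by simpa using R.par_mem hx) w x

theorem proj_H (w : ℤ × ℤ) (x : W) : R.proj (w + (0, -1)) (R.H 0 x) = R.H 0 (R.proj w x) :=
  R.proj_comm (fun _ _ hx => R.H_zero_mem hx) w x

theorem proj_Q (w : ℤ × ℤ) (x : W) : R.proj (w + (0, 1)) (R.Q 0 x) = R.Q 0 (R.proj w x) :=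
  R.proj_comm (fun _ _ hx => R.Q_zero_mem hx) w x

end AnnihilationRep

end

/-! ## Pointwise finite sums of operators -/

/-- The operators `X i` have only finitely many nonzero values on each vector, and sum to `Z`. -/
def HasPointwiseSum {ι E F : Type*} [AddCommGroup E] [Module ℂ E] [AddCommGroup F] [Module ℂ F]
    (X : ι → E →ₗ[ℂ] F) (Z : E →ₗ[ℂ] F) : Prop :=
  ∀ x, (Function.support fun i => X i x).Finite ∧ ∑ᶠ i, X i x = Z x

namespace HasPointwiseSum

variable {ι E F G : Type*} [AddCommGroup E] [Module ℂ E] [AddCommGroup F] [Module ℂ F]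
  [AddCommGroup G] [Module ℂ G] {X Y : ι → E →ₗ[ℂ] F} {Z U : E →ₗ[ℂ] F}

theorem comp_left (h : HasPointwiseSum X Z) (A : F →ₗ[ℂ] G) :
    HasPointwiseSum (fun i => A ∘ₗ X i) (A ∘ₗ Z) := fun x => by
  refine ⟨(h x).1.subset fun i hi => ?_, ?_⟩
  · contrapose! hi
    simp only [Function.mem_support, not_not] at hi
    simp [hi]
  · simp only [LinearMap.comp_apply, ← (h x).2]
    exact (A.toAddMonoidHom.map_finsum (h x).1).symm

theorem comp_right (h : HasPointwiseSum X Z) (B : G →ₗ[ℂ] E) :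
    HasPointwiseSum (fun i => X i ∘ₗ B) (Z ∘ₗ B) := fun x => h (B x)

theorem add (h : HasPointwiseSum X Z) (k : HasPointwiseSum Y U) :
    HasPointwiseSum (fun i => X i + Y i) (Z + U) := fun x => by
  refine ⟨((h x).1.union (k x).1).subset fun i hi => ?_, ?_⟩
  · contrapose! hi
    simp only [Set.mem_union, Function.mem_support, not_or, not_not] at hi
    simp [hi]
  · simp only [LinearMap.add_apply]
    rw [finsum_add_distrib (h x).1 (k x).1, (h x).2, (k x).2]

theorem smul (h : HasPointwiseSum X Z) (c : ℂ) :
    HasPointwiseSum (fun i => c • X i) (c • Z) := by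
  exact h.comp_left (c • LinearMap.id)

theorem sum {κ : Type*} (s : Finset κ) {X : κ → ι → E →ₗ[ℂ] F} {Z : κ → E →ₗ[ℂ] F}
    (h : ∀ k, HasPointwiseSum (X k) (Z k)) :
    HasPointwiseSum (fun i => ∑ k ∈ s, X k i) (∑ k ∈ s, Z k) := by
  classical
  induction s using Finset.induction_on with
  | empty => exact fun x => by simp
  | insert a s ha ih => simpa [Finset.sum_insert ha] using (h a).add ih

theorem comp_equiv {κ : Type*} (h : HasPointwiseSum X Z) (e : κ ≃ ι) :
    HasPointwiseSum (fun i => X (e i)) Z := fun x =>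
  ⟨(h x).1.preimage e.injective.injOn, by
    rw [← (h x).2]; exact finsum_comp_equiv e (f := fun i => X i x)⟩

/-- An operator vanishing on a finite basis is zero, so pointwise finiteness on a finite dimensional
source is genuine finiteness. Hence traces may be taken term by term. -/
theorem finite [FiniteDimensional ℂ E] (h : HasPointwiseSum X Z) :
    (Function.support X).Finite := by
  let b := Module.finBasis ℂ E
  refine (Set.finite_iUnion fun k => (h (b k)).1).subset fun i hi => ?_
  by_contra hn
  simp only [Set.mem_iUnion, Function.mem_support, not_exists, not_not] at hn
  exact hi (b.ext fun k => by simpa using hn k)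

theorem trace [FiniteDimensional ℂ E] {X : ι → E →ₗ[ℂ] E} {Z : E →ₗ[ℂ] E}
    (h : HasPointwiseSum X Z) :
    (Function.support fun i => LinearMap.trace ℂ E (X i)).Finite ∧
      ∑ᶠ i, LinearMap.trace ℂ E (X i) = LinearMap.trace ℂ E Z := by
  have hf := h.finite
  refine ⟨hf.subset fun i hi => ?_, ?_⟩
  · contrapose! hi
    simp only [Function.mem_support, not_not] at hi
    simp [hi]
  · have hZ : Z = ∑ᶠ i, X i := by
      ext x
      rw [← (h x).2]
      exact ((LinearMap.applyₗ x : (E →ₗ[ℂ] E) →ₗ[ℂ] E).toAddMonoidHom.map_finsum hf).symm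
    rw [hZ]
    exact ((LinearMap.trace ℂ E).toAddMonoidHom.map_finsum hf).symm

end HasPointwiseSum

/-! ## Supertraces -/

section

variable {W : Type*} [AddCommGroup W] [Module ℂ W] {S : SuperSpace W}

namespace AnnihilationRep

variable (R : AnnihilationRep S)

instance (p : ℤ × ℤ) : FiniteDimensional ℂ (R.wt p) := R.finite_dim p

/-- The trace of the diagonal block of `T` on a joint eigenspace. -/
noncomputable def wtTrace (w : ℤ × ℤ) (T : Module.End ℂ W) : ℂ :=
  LinearMap.trace ℂ (R.wt w) (R.component w ∘ₗ T ∘ₗ (R.wt w).subtype)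

theorem hasPointwiseSum_proj : HasPointwiseSum R.proj (LinearMap.id : Module.End ℂ W) := fun x =>
  ⟨R.proj_support_finite x, R.finsum_proj x⟩

theorem wtTrace_hasPointwiseSum {ι : Type*} {X : ι → Module.End ℂ W} {Z : Module.End ℂ W}
    (w : ℤ × ℤ) (h : HasPointwiseSum X Z) :
    (Function.support fun i => R.wtTrace w (X i)).Finite ∧
      ∑ᶠ i, R.wtTrace w (X i) = R.wtTrace w Z :=
  ((h.comp_right _).comp_left _).trace

/-- The operator factors through the finite dimensional space `R.wt w`, so the ordinary identity
tr(AB) = tr(BA) for maps between two finite dimensional spaces moves the trace from the block `p` to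
the block `w`. -/
theorem blockStr_mul_proj_mul (X Y : Module.End ℂ W) (w p : ℤ × ℤ) :
    R.blockStr (X * R.proj w * Y) p = R.wtTrace w (Y * R.proj p * S.par * X) := by
  have := LinearMap.trace_comp_comm' (R := ℂ) (M := R.wt w) (N := R.wt p)
    (R.component p ∘ₗ S.par ∘ₗ X ∘ₗ (R.wt w).subtype)
    (R.component w ∘ₗ Y ∘ₗ (R.wt p).subtype)
  exact this.symm

/-- After the trace is moved to the fixed block `w`, the sum over `p` is the pointwise decomposition
of the identity into the projections `R.proj p`, taken inside a finite dimensional trace. Thus an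
infinite supertrace becomes one finite trace. -/
theorem str_mul_proj_mul_aux (X Y : Module.End ℂ W) (w : ℤ × ℤ) :
    (Function.support (R.blockStr (X * R.proj w * Y))).Finite ∧
      R.str (X * R.proj w * Y) = R.wtTrace w (Y * S.par * X) := by
  have h := R.wtTrace_hasPointwiseSum w
    ((R.hasPointwiseSum_proj.comp_right (S.par * X)).comp_left Y)
  have e : R.blockStr (X * R.proj w * Y) = fun p => R.wtTrace w (Y * (R.proj p * (S.par * X))) := by
    funext p
    rw [blockStr_mul_proj_mul, mul_assoc, mul_assoc]
  refine ⟨by rw [e]; exact h.1, ?_⟩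
  rw [str, e, mul_assoc]
  exact h.2

theorem str_mul_proj_mul (X Y : Module.End ℂ W) (w : ℤ × ℤ) :
    R.str (X * R.proj w * Y) = R.wtTrace w (Y * S.par * X) := (R.str_mul_proj_mul_aux X Y w).2

/-- The two-sided ideal generated by the projections to the joint eigenspaces. -/
def traceable : Submodule ℂ (Module.End ℂ W) :=
  Submodule.span ℂ {T | ∃ X w Y, T = X * R.proj w * Y}

variable {R}

theorem mem_traceable (X Y : Module.End ℂ W) (w : ℤ × ℤ) : X * R.proj w * Y ∈ R.traceable :=
  Submodule.subset_span ⟨X, w, Y, rfl⟩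

theorem mul_mem_traceable (X : Module.End ℂ W) {T : Module.End ℂ W} (hT : T ∈ R.traceable) :
    X * T ∈ R.traceable := by
  refine Submodule.span_induction (p := fun T _ => X * T ∈ R.traceable) ?_ (by simp)
    (fun U T _ _ hU hT => by rw [mul_add]; exact add_mem hU hT)
    (fun c T _ hT => by rw [mul_smul_comm]; exact Submodule.smul_mem _ _ hT) hT
  rintro _ ⟨A, w, B, rfl⟩
  rw [← mul_assoc, ← mul_assoc]
  exact mem_traceable _ _ _

theorem mul_mem_traceable_right (X : Module.End ℂ W) {T : Module.End ℂ W} (hT : T ∈ R.traceable) :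
    T * X ∈ R.traceable := by
  refine Submodule.span_induction (p := fun T _ => T * X ∈ R.traceable) ?_ (by simp)
    (fun U T _ _ hU hT => by rw [add_mul]; exact add_mem hU hT)
    (fun c T _ hT => by rw [smul_mul_assoc]; exact Submodule.smul_mem _ _ hT) hT
  rintro _ ⟨A, w, B, rfl⟩
  rw [mul_assoc]
  exact mem_traceable _ _ _

variable (R)

theorem blockStr_add (T U : Module.End ℂ W) (p : ℤ × ℤ) :
    R.blockStr (T + U) p = R.blockStr T p + R.blockStr U p := by
  simp [blockStr, LinearMap.add_comp, LinearMap.comp_add]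

theorem blockStr_smul (c : ℂ) (T : Module.End ℂ W) (p : ℤ × ℤ) :
    R.blockStr (c • T) p = c * R.blockStr T p := by
  simp [blockStr, LinearMap.smul_comp, LinearMap.comp_smul]

variable {R}

theorem blockStr_support_finite {T : Module.End ℂ W} (hT : T ∈ R.traceable) :
    (Function.support (R.blockStr T)).Finite := by
  refine Submodule.span_induction (p := fun T _ => (Function.support (R.blockStr T)).Finite) ?_ ?_
    (fun U T _ _ hU hT => ?_) (fun c T _ hT => ?_) hT
  · rintro _ ⟨A, w, B, rfl⟩
    exact (R.str_mul_proj_mul_aux A B w).1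
  · have : R.blockStr 0 = 0 := by funext p; simp [blockStr]
    simp [this]
  · refine (hU.union hT).subset fun p hp => ?_
    contrapose! hp
    simp only [Set.mem_union, Function.mem_support, not_or, not_not] at hp
    simp [blockStr_add, hp]
  · refine hT.subset fun p hp => ?_
    contrapose! hp
    simp only [Function.mem_support, not_not] at hp
    simp [blockStr_smul, hp]

theorem str_add {T U : Module.End ℂ W} (hT : T ∈ R.traceable) (hU : U ∈ R.traceable) :
    R.str (T + U) = R.str T + R.str U := by
  simp only [str, blockStr_add]
  exact finsum_add_distrib (blockStr_support_finite hT) (blockStr_support_finite hU)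

theorem str_smul (c : ℂ) (T : Module.End ℂ W) : R.str (c • T) = c * R.str T := by
  simp only [str, blockStr_smul, ← smul_eq_mul]
  rw [smul_finsum]

theorem str_zero : R.str 0 = 0 := by simpa using str_smul (R := R) 0 0

end AnnihilationRep

/-- Conjugation of an operator by the parity involution. -/
def SuperSpace.conj (S : SuperSpace W) (T : Module.End ℂ W) : Module.End ℂ W :=
  S.par * T * S.par

theorem SuperSpace.par_mul_par (S : SuperSpace W) : S.par * S.par = 1 :=
  LinearMap.ext S.par_par

namespace AnnihilationRep

variable {R : AnnihilationRep S}

/-- The supertrace of a product depends only on its cyclic order. -/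
theorem str_mul_comm (X : Module.End ℂ W) {T : Module.End ℂ W} (hT : T ∈ R.traceable) :
    R.str (X * T) = R.str (T * S.conj X) := by
  refine Submodule.span_induction (p := fun T _ => R.str (X * T) = R.str (T * S.conj X)) ?_
    (by simp) (fun U T hU' hT' hU hT => ?_) (fun c T _ hT => ?_) hT
  · rintro _ ⟨A, w, B, rfl⟩
    -- Both sides are the trace over the block `w` of `B * S.par * X * A`; on the right the parity
    -- involution inside `S.conj X` cancels the one in the definition of the supertrace.
    rw [← mul_assoc, ← mul_assoc, str_mul_proj_mul, mul_assoc (A * R.proj w), str_mul_proj_mul,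
      SuperSpace.conj]
    congr 1
    simp only [mul_assoc]
    rw [← mul_assoc S.par S.par, S.par_mul_par, one_mul]
  · rw [mul_add, add_mul, str_add (mul_mem_traceable _ hU') (mul_mem_traceable _ hT'),
      str_add (mul_mem_traceable_right _ hU') (mul_mem_traceable_right _ hT'), hU, hT]
  · rw [mul_smul_comm, smul_mul_assoc, str_smul, str_smul, hT]

theorem str_conj {T : Module.End ℂ W} (hT : T ∈ R.traceable) : R.str (S.conj T) = R.str T := by
  rw [SuperSpace.conj, mul_assoc, str_mul_comm _ (mul_mem_traceable_right _ hT), SuperSpace.conj,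
    mul_assoc T, ← mul_assoc S.par, ← mul_assoc S.par, S.par_mul_par, one_mul, S.par_mul_par, mul_one]

/-- For a generator of the ideal the supertrace is a trace over one finite dimensional block, where
the pointwise sum is a finite sum. This is what lets the residue theorem, valid only vector by
vector, be applied under the trace. -/
theorem str_hasPointwiseSum {ι : Type*} {X : ι → Module.End ℂ W} {Z : Module.End ℂ W}
    (h : HasPointwiseSum X Z) {T : Module.End ℂ W} (hT : T ∈ R.traceable) :
    (Function.support fun i => R.str (X i * T)).Finite ∧ ∑ᶠ i, R.str (X i * T) = R.str (Z * T) := by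
  refine Submodule.span_induction (p := fun T _ => (Function.support fun i =>
    R.str (X i * T)).Finite ∧ ∑ᶠ i, R.str (X i * T) = R.str (Z * T)) ?_
    (by simp [str_zero]) (fun U T hU' hT' hU hT => ?_) (fun c T _ hT => ?_) hT
  · rintro _ ⟨A, w, B, rfl⟩
    simp only [← mul_assoc, str_mul_proj_mul]
    simp only [mul_assoc _ _ A]
    exact R.wtTrace_hasPointwiseSum w ((h.comp_right A).comp_left (B * S.par))
  · simp only [mul_add, str_add (mul_mem_traceable _ hU') (mul_mem_traceable _ hT')]
    refine ⟨(hU.1.union hT.1).subset fun p hp => ?_, ?_⟩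
    · contrapose! hp
      simp only [Set.mem_union, Function.mem_support, not_or, not_not] at hp
      simp [hp]
    · rw [finsum_add_distrib hU.1 hT.1, hU.2, hT.2]
  · simp only [mul_smul_comm, str_smul]
    refine ⟨hT.1.subset fun p hp => right_ne_zero_of_mul hp, ?_⟩
    simp only [← smul_eq_mul c]
    rw [← smul_finsum, hT.2]

end AnnihilationRep

end

/-! ## Covariance of the fields in components -/

section

variable {V M : Type*} [AddCommGroup V] [Module ℂ V] [AddCommGroup M] [Module ℂ M]
  {A : SUSYVertexAlgebra V} {C : QuasiConformal A} {N : SUSYModule A M}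

namespace PositiveEnergy

variable (P : PositiveEnergy C N)

/-- The covariance relation involves `L (-1)` and `Q (-1)` acting on `a`. These are `T` and `D`, and
the derivative formulas turn them into multiples of the same mode; the contribution of `D` is the
weight of `θ`. -/
theorem L_zero_Y (s : Fin 2) (k : ℤ) (a : V) (x : M) :
    P.L 0 (N.Y s k a x) = N.Y s k a (P.L 0 x) + N.Y s k (C.L 0 a) x
      + ((s : ℂ) - k - 1) • N.Y s k a x := by
  fin_cases s
  · have h := P.covariant.L_zero 1 k a x
    simp only [Finset.sum_range_succ, Finset.sum_range_zero, Nat.cast_one, sub_self, Nat.choose_zero_right,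
      Nat.cast_zero, zero_sub, C.L_neg_one, N.Y_zero_T, Nat.choose_self, sub_zero,
      add_sub_cancel_right, sub_eq_iff_eq_add, LinearMap.smul_apply] at h
    change P.L 0 (N.Y 0 k a x) = N.Y 0 k a (P.L 0 x) + N.Y 0 k (C.L 0 a) x
      + (((0 : ℕ) : ℂ) - k - 1) • N.Y 0 k a x
    rw [h]
    push_cast
    module
  · have h := P.covariant.L_one 1 k a x
    simp only [Finset.sum_range_succ, Finset.sum_range_zero, Nat.cast_one, sub_self, Nat.choose_zero_right,
      Nat.cast_zero, zero_sub, C.L_neg_one, N.Y_T, Nat.choose_self, sub_zero, zero_smul,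
      show (1 : ℤ) - 2 = -1 from rfl, C.Q_neg_one, N.Y_zero_D,
      add_sub_cancel_right, sub_eq_iff_eq_add, LinearMap.smul_apply] at h
    change P.L 0 (N.Y 1 k a x) = N.Y 1 k a (P.L 0 x) + N.Y 1 k (C.L 0 a) x
      + (((1 : ℕ) : ℂ) - k - 1) • N.Y 1 k a x
    rw [h]
    push_cast
    module

theorem J_zero_Y (s : Fin 2) (k : ℤ) (a : V) (x : M) :
    P.J 0 (N.Y s k a x) = N.Y s k a (P.J 0 x) + N.Y s k (C.J 0 a) x + (s : ℂ) • N.Y s k a x := by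
  fin_cases s
  · have h := P.covariant.J_zero 0 k a x
    simp only [Finset.sum_range_succ, Finset.sum_range_zero, Nat.choose_zero_right, Nat.cast_one,
      Nat.cast_zero, sub_zero, add_zero, zero_add, one_smul, sub_eq_iff_eq_add] at h
    change P.J 0 (N.Y 0 k a x) = N.Y 0 k a (P.J 0 x) + N.Y 0 k (C.J 0 a) x
      + ((0 : ℕ) : ℂ) • N.Y 0 k a x
    rw [h]
    push_cast
    module
  · have h := P.covariant.J_one 0 k a x
    simp only [Finset.sum_range_succ, Finset.sum_range_zero, Nat.choose_zero_right, Nat.cast_one,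
      Nat.cast_zero, zero_sub, sub_zero, add_zero, zero_add, one_smul, sub_eq_iff_eq_add,
      C.Q_neg_one, N.Y_zero_D] at h
    change P.J 0 (N.Y 1 k a x) = N.Y 1 k a (P.J 0 x) + N.Y 1 k (C.J 0 a) x
      + ((1 : ℕ) : ℂ) • N.Y 1 k a x
    rw [h]
    push_cast
    module

theorem Y_mem_wt {s : Fin 2} {k : ℤ} {a : V} {p w : ℤ × ℤ} (ha : a ∈ C.wt p) {x : M}
    (hx : x ∈ P.wt w) : N.Y s k a x ∈ P.wt (w + (p.1 - k - 1 + (s : ℕ), p.2 + (s : ℕ))) := by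
  rw [AnnihilationRep.mem_wt] at *
  rw [L_zero_Y, J_zero_Y, hx.1, hx.2, ha.1, ha.2]
  simp only [map_smul, LinearMap.smul_apply, Prod.fst_add, Prod.snd_add]
  push_cast
  exact ⟨by module, by module⟩

theorem H_Y_zero (k : ℤ) (a : V) (x : M) :
    P.H 0 (N.Y 0 k a x) = N.Y 0 k (A.par a) (P.H 0 x) + N.Y 0 k (C.H 0 a) x := by
  have h := P.covariant.H_zero 0 k a x
  simp only [Finset.sum_range_succ, Finset.sum_range_zero, Nat.choose_zero_right, Nat.cast_one,
    Nat.cast_zero, sub_zero, add_zero, zero_add, one_smul, sub_eq_iff_eq_add] at h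
  rw [h, add_comm]

theorem H_Y_one (k : ℤ) (a : V) (x : M) :
    P.H 0 (N.Y 1 k a x) = -N.Y 1 k (A.par a) (P.H 0 x) - N.Y 1 k (C.H 0 a) x
      - (k : ℂ) • N.Y 0 (k - 1) a x := by
  have h := P.covariant.H_one 0 k a x
  simp only [Finset.sum_range_succ, Finset.sum_range_zero, Nat.choose_zero_right, Nat.cast_one,
    Nat.cast_zero, sub_zero, add_zero, zero_add, one_smul, zero_smul, zero_sub, C.L_neg_one,
    N.Y_zero_T, LinearMap.smul_apply] at h
  rw [neg_eq_iff_eq_neg, ← eq_sub_iff_add_eq] at h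
  rw [h]
  module

theorem Q_Y_zero (k : ℤ) (a : V) (x : M) :
    P.Q 0 (N.Y 0 k a x) = N.Y 0 k (A.par a) (P.Q 0 x) + N.Y 0 k (C.Q 0 a) x
      + N.Y 1 (k + 1) a x := by
  have h := P.covariant.Q_zero 1 k a x
  simp only [Finset.sum_range_succ, Finset.sum_range_zero, Nat.cast_one, sub_self, Nat.choose_zero_right,
    Nat.cast_zero, zero_sub, C.Q_neg_one, N.Y_zero_D, Nat.choose_self, sub_zero, zero_add, one_smul,
    add_sub_cancel_right, sub_eq_iff_eq_add] at h
  rw [h]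
  abel

theorem Q_Y_one (k : ℤ) (a : V) (x : M) :
    P.Q 0 (N.Y 1 k a x) = -N.Y 1 k (A.par a) (P.Q 0 x) - N.Y 1 k (C.Q 0 a) x := by
  have h := P.covariant.Q_one 1 k a x
  simp only [Finset.sum_range_succ, Finset.sum_range_zero, Nat.cast_one, sub_self, Nat.choose_zero_right,
    Nat.cast_zero, zero_sub, C.Q_neg_one, N.Y_one_D, Nat.choose_self, sub_zero, zero_add, one_smul,
    add_sub_cancel_right, LinearMap.zero_apply, smul_zero] at h
  rw [neg_eq_iff_eq_neg, ← eq_sub_iff_add_eq] at h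
  rw [h]
  abel

end PositiveEnergy

end

/-! ## Operators with coefficients in the Grassmann algebra -/

section

variable {W : Type*} [AddCommGroup W] [Module ℂ W]

namespace SuperSpace

variable (S : SuperSpace W)

theorem conj_apply (T : Module.End ℂ W) (x : W) : S.conj T x = S.par (T (S.par x)) := rfl

@[simp] theorem conj_conj (T : Module.End ℂ W) : S.conj (S.conj T) = T := by
  ext x; simp [conj_apply, S.par_par]

@[simp] theorem conj_mul (T U : Module.End ℂ W) : S.conj (T * U) = S.conj T * S.conj U := by
  ext x; simp [conj_apply, S.par_par]

@[simp] theorem conj_add (T U : Module.End ℂ W) : S.conj (T + U) = S.conj T + S.conj U := by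
  ext x; simp [conj_apply]

@[simp] theorem conj_sub (T U : Module.End ℂ W) : S.conj (T - U) = S.conj T - S.conj U := by
  ext x; simp [conj_apply]

@[simp] theorem conj_neg (T : Module.End ℂ W) : S.conj (-T) = -S.conj T := by
  ext x; simp [conj_apply]

@[simp] theorem conj_smul (c : ℂ) (T : Module.End ℂ W) : S.conj (c • T) = c • S.conj T := by
  ext x; simp [conj_apply]

@[simp] theorem conj_zero : S.conj (0 : Module.End ℂ W) = 0 := by
  ext x; simp [conj_apply]

@[simp] theorem conj_one : S.conj (1 : Module.End ℂ W) = 1 := by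
  ext x; simp [conj_apply, S.par_par]

theorem conj_sum {ι : Type*} (s : Finset ι) (T : ι → Module.End ℂ W) :
    S.conj (∑ i ∈ s, T i) = ∑ i ∈ s, S.conj (T i) := by
  simp [conj, Finset.mul_sum, Finset.sum_mul]

theorem OddOp.conj_eq {S : SuperSpace W} {T : Module.End ℂ W} (h : S.OddOp T) : S.conj T = -T := by
  ext x; simp [conj_apply, h _, S.par_par]

/-- The product of operators with coefficients in `ℂ[ε, δ]`, the family `X` standing for
`∑ ε ^ e δ ^ d X e d`. -/
def gmul (X Y : Gr (Module.End ℂ W)) : Gr (Module.End ℂ W) :=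
  ![![X 0 0 * Y 0 0, X 0 1 * Y 0 0 + S.conj (X 0 0) * Y 0 1],
    ![X 1 0 * Y 0 0 + S.conj (X 0 0) * Y 1 0,
      X 1 1 * Y 0 0 + S.conj (X 1 0) * Y 0 1 - S.conj (X 0 1) * Y 1 0 + X 0 0 * Y 1 1]]

variable (X Y Z : Gr (Module.End ℂ W))

theorem gmul_zero_zero : S.gmul X Y 0 0 = X 0 0 * Y 0 0 := rfl

theorem gmul_zero_one : S.gmul X Y 0 1 = X 0 1 * Y 0 0 + S.conj (X 0 0) * Y 0 1 := rfl

theorem gmul_one_zero : S.gmul X Y 1 0 = X 1 0 * Y 0 0 + S.conj (X 0 0) * Y 1 0 := rfl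

theorem gmul_one_one : S.gmul X Y 1 1 =
    X 1 1 * Y 0 0 + S.conj (X 1 0) * Y 0 1 - S.conj (X 0 1) * Y 1 0 + X 0 0 * Y 1 1 := rfl

theorem _root_.Gr.ext_four {E : Type*} {X Y : Gr E} (h00 : X 0 0 = Y 0 0) (h01 : X 0 1 = Y 0 1)
    (h10 : X 1 0 = Y 1 0) (h11 : X 1 1 = Y 1 1) : X = Y := by
  funext e d
  fin_cases e <;> fin_cases d <;> assumption

theorem gmul_assoc : S.gmul (S.gmul X Y) Z = S.gmul X (S.gmul Y Z) := by
  apply Gr.ext_four <;>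
    simp only [gmul_zero_zero, gmul_zero_one, gmul_one_zero, gmul_one_one, conj_mul, conj_add,
      conj_conj] <;> noncomm_ring

theorem gmul_sum {ι : Type*} (s : Finset ι) (Y : ι → Gr (Module.End ℂ W)) :
    S.gmul X (∑ i ∈ s, Y i) = ∑ i ∈ s, S.gmul X (Y i) := by
  apply Gr.ext_four <;>
    simp only [gmul_zero_zero, gmul_zero_one, gmul_one_zero, gmul_one_one, Finset.sum_apply,
      Finset.mul_sum, Finset.sum_add_distrib, Finset.sum_sub_distrib]

theorem sum_gmul {ι : Type*} (s : Finset ι) (X : ι → Gr (Module.End ℂ W)) :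
    S.gmul (∑ i ∈ s, X i) Y = ∑ i ∈ s, S.gmul (X i) Y := by
  apply Gr.ext_four <;>
    simp only [gmul_zero_zero, gmul_zero_one, gmul_one_zero, gmul_one_one, Finset.sum_apply,
      Finset.sum_mul, Finset.sum_add_distrib, Finset.sum_sub_distrib, conj_sum]

/-- The parity automorphism of operators with coefficients in `ℂ[ε, δ]`. -/
def gconj (X : Gr (Module.End ℂ W)) : Gr (Module.End ℂ W) :=
  fun e d => (-1 : ℂ) ^ ((e : ℕ) + (d : ℕ)) • S.conj (X e d)

theorem gconj_gmul : S.gconj (S.gmul X Y) = S.gmul (S.gconj X) (S.gconj Y) := by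
  apply Gr.ext_four <;>
    simp only [gmul_zero_zero, gmul_zero_one, gmul_one_zero, gmul_one_one, conj_mul, conj_add,
      conj_conj, gconj, conj_sub, conj_smul, Fin.val_zero, Fin.val_one, add_zero, zero_add,
      pow_zero, pow_one, one_smul, smul_mul_assoc, mul_smul_comm, one_add_one_eq_two] <;> module

theorem gconj_sum {ι : Type*} (s : Finset ι) (X : ι → Gr (Module.End ℂ W)) :
    S.gconj (∑ i ∈ s, X i) = ∑ i ∈ s, S.gconj (X i) := by
  funext e d
  simp [gconj, Finset.sum_apply, conj_sum, Finset.smul_sum]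

end SuperSpace

/-- The three factors of `𝐪⁻¹`, and their product. -/
def AnnihilationRep.expQ {S : SuperSpace W} (R : AnnihilationRep S) : Gr (Module.End ℂ W) :=
  ![![1, R.Q 0], ![0, 0]]

def AnnihilationRep.expH {S : SuperSpace W} (R : AnnihilationRep S) : Gr (Module.End ℂ W) :=
  ![![1, 0], ![-R.H 0, 0]]

/-- In the `ε δ` entry, moving `ε` to the front past `Q₀` and past `δ` gives two signs that cancel;
the remaining minus is that of `exp (-ε H₀)`. -/
noncomputable def AnnihilationRep.qTuple {S : SuperSpace W} (R : AnnihilationRep S) (w : ℤ × ℤ) :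
    Gr (Module.End ℂ W) :=
  ![![R.proj w, R.Q 0 * R.proj w], ![-(R.proj w * R.H 0), -(R.Q 0 * R.proj w * R.H 0)]]

theorem AnnihilationRep.conj_proj {S : SuperSpace W} (R : AnnihilationRep S) (w : ℤ × ℤ) :
    S.conj (R.proj w) = R.proj w := by
  ext x; rw [S.conj_apply, R.proj_par, S.par_par]

theorem AnnihilationRep.conj_H {S : SuperSpace W} (R : AnnihilationRep S) :
    S.conj (R.H 0) = -R.H 0 := (R.H_odd 0 le_rfl).conj_eq

theorem AnnihilationRep.conj_Q {S : SuperSpace W} (R : AnnihilationRep S) :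
    S.conj (R.Q 0) = -R.Q 0 := (R.Q_odd 0 (by norm_num)).conj_eq

theorem AnnihilationRep.qTuple_eq {S : SuperSpace W} (R : AnnihilationRep S) (w : ℤ × ℤ) :
    R.qTuple w = S.gmul (S.gmul R.expQ (Gr.base (R.proj w))) R.expH := by
  apply Gr.ext_four <;>
    simp [SuperSpace.gmul_zero_zero, SuperSpace.gmul_zero_one, SuperSpace.gmul_one_zero,
      SuperSpace.gmul_one_one, qTuple, expQ, expH, Gr.base, R.conj_proj, R.conj_Q]

theorem AnnihilationRep.gconj_qTuple {S : SuperSpace W} (R : AnnihilationRep S) (w : ℤ × ℤ) :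
    S.gconj (R.qTuple w) = R.qTuple w := by
  apply Gr.ext_four <;>
    simp [SuperSpace.gconj, qTuple, R.conj_proj, R.conj_Q, R.conj_H]

theorem AnnihilationRep.qTuple_mem {S : SuperSpace W} (R : AnnihilationRep S) (w : ℤ × ℤ)
    (e d : Fin 2) : R.qTuple w e d ∈ R.traceable := by
  have h : R.proj w ∈ R.traceable := by simpa using mem_traceable (R := R) 1 1 w
  fin_cases e <;> fin_cases d
  · exact h
  · exact mul_mem_traceable _ h
  · exact neg_mem (mul_mem_traceable_right _ h)
  · exact neg_mem (mul_mem_traceable_right _ (mul_mem_traceable _ h))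

end

/-! ### Residues against distributions, and the odd factors of 𝐪⁻¹. -/

section

variable {V M : Type*} [AddCommGroup V] [Module ℂ V] [AddCommGroup M] [Module ℂ M]
  {A : SUSYVertexAlgebra V} {C : QuasiConformal A} {N : SUSYModule A M}

theorem SUSYModule.conj_Y (N : SUSYModule A M) (s : Fin 2) (n : ℤ) (a : V) :
    N.conj (N.Y s n a) = (-1 : ℂ) ^ (s : ℕ) • N.Y s n (A.par a) := by
  ext x
  rw [SuperSpace.conj_apply, N.Y_par, N.par_par, LinearMap.smul_apply]

theorem PositiveEnergy.traceOp_eq (P : PositiveEnergy C N) (v : V) (i j n : ℤ) (e d : Fin 2) :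
    P.traceOp v i j n e d = N.gmul (Gr.base (N.Y 0 n v)) (P.qTuple (i, j)) e d := by
  fin_cases e <;> fin_cases d <;> ext x <;>
    simp [traceOp, fieldMode, AnnihilationRep.qInv, Gr.comp, Gr.base, Gr.eps, Gr.del, Gr.odd,
      Gr.even, SuperSpace.gmul, AnnihilationRep.qTuple, N.conj_Y, A.par_par, pow_succ]

/-- The operator `res Y(F(x, θ), x, θ)` with coefficients in `ℂ[ε, δ]`, for the part of a
distribution `F` homogeneous of degree `D` in `(x, θ)`. -/
def SUSYModule.smear (N : SUSYModule A M) (F : Distr V) (p : ℤ × ℤ) (D : ℤ) :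
    Gr (Module.End ℂ M) :=
  fun e d => (-1 : ℂ) ^ ((e : ℕ) + (d : ℕ)) •
    (N.Y 0 (D - 1) (F (D - 1) p.1 p.2 1 e d) + N.Y 1 D (F D p.1 p.2 0 e d))

/-- The factor `exp (ε (H₀ + θ ∂_x))` of the action of `𝐪` on distributions. -/
def Distr.actH {S : SuperSpace V} (R : AnnihilationRep S) (F : Distr V) : Distr V :=
  (F + Distr.eps (Distr.thetaDx F)) + Distr.eps (Distr.odd (R.H 0) (F + Distr.eps (Distr.thetaDx F)))

/-- The factor `exp (-δ (Q₀ - x ∂_θ))` of the action of `𝐪` on distributions. -/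
def Distr.actQ {S : SuperSpace V} (R : AnnihilationRep S) (F : Distr V) : Distr V :=
  (F + Distr.del (Distr.xDtheta F)) - Distr.del (Distr.odd (R.Q 0) (F + Distr.del (Distr.xDtheta F)))

/-- Infinitesimal covariance under the first odd one-parameter group. The term of `[H₀, Y(a, x, θ)]`
that differentiates the field is compensated, after integration by parts in the residue, by `θ ∂_x`
acting on the distribution. Since `ε ^ 2 = 0`, the linear identity is the full one. -/
theorem PositiveEnergy.expH_smear (P : PositiveEnergy C N) (F : Distr V) (p : ℤ × ℤ) (D : ℤ) :
    N.gmul P.expH (N.smear (F.actH C.toAnnihilationRep) p D) = N.gmul (N.smear F p D) P.expH := by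
  apply Gr.ext_four <;> ext x <;>
    simp [SuperSpace.gmul_zero_zero, SuperSpace.gmul_zero_one, SuperSpace.gmul_one_zero,
      SuperSpace.gmul_one_one, AnnihilationRep.expH, SUSYModule.smear, Distr.actH, Distr.eps,
      Distr.thetaDx, Distr.odd, Gr.eps, Gr.odd, P.conj_H, N.conj_Y, P.H_Y_zero, P.H_Y_one] <;>
    module

/-- The counterpart for `Q₀`: the shifted mode `Y 1 (k + 1)` in `Q_Y_zero` is absorbed by `x ∂_θ`.
-/
theorem PositiveEnergy.expQ_smear (P : PositiveEnergy C N) (F : Distr V) (p : ℤ × ℤ) (D : ℤ) :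
    N.gmul P.expQ (N.smear (F.actQ C.toAnnihilationRep) p D) = N.gmul (N.smear F p D) P.expQ := by
  apply Gr.ext_four <;> ext x <;>
    simp [SuperSpace.gmul_zero_zero, SuperSpace.gmul_zero_one, SuperSpace.gmul_one_zero,
      SuperSpace.gmul_one_one, AnnihilationRep.expQ, SUSYModule.smear, Distr.actQ, Distr.del,
      Distr.xDtheta, Distr.odd, Gr.del, Gr.odd, P.conj_Q, N.conj_Y, P.Q_Y_zero, P.Q_Y_one] <;>
    module

end

/-! ## Distributions with finitely many weights -/

section

variable {V : Type*} [AddCommGroup V] [Module ℂ V] {S : SuperSpace V}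

namespace Distr

/-- The values of `F` have components only in the joint eigenspaces for `P`. -/
def WeightsIn (R : AnnihilationRep S) (F : Distr V) (P : Finset (ℤ × ℤ)) : Prop :=
  ∀ m i j s e d, ∀ p ∉ P, R.proj p (F m i j s e d) = 0

variable {R : AnnihilationRep S} {F G : Distr V} {P : Finset (ℤ × ℤ)}

theorem WeightsIn.sum_proj (h : F.WeightsIn R P) (m i j s e d) :
    ∑ p ∈ P, R.proj p (F m i j s e d) = F m i j s e d := by
  conv_rhs => rw [← R.finsum_proj (F m i j s e d)]
  refine (finsum_eq_sum_of_support_subset _ fun p hp => ?_).symm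
  by_contra hn
  exact hp (h m i j s e d p hn)

theorem WeightsIn.scaleVal_apply (h : F.WeightsIn R P) (c m i j : ℤ) (s e d : Fin 2) :
    scaleVal R c F m i j s e d = ∑ p ∈ P, R.proj p (F m (i + c * p.1) (j + c * p.2) s e d) := by
  refine finsum_eq_sum_of_support_subset _ fun p hp => ?_
  by_contra hn
  exact hp (h _ _ _ _ _ _ p hn)

theorem WeightsIn.scaleVal_add (hF : F.WeightsIn R P) (hG : G.WeightsIn R P) (c : ℤ) :
    scaleVal R c (F + G) = scaleVal R c F + scaleVal R c G := by
  have h : (F + G).WeightsIn R P := fun m i j s e d p hp => by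
    change R.proj p (F m i j s e d + G m i j s e d) = 0
    rw [map_add, hF _ _ _ _ _ _ p hp, hG _ _ _ _ _ _ p hp, add_zero]
  funext m i j s e d
  simp only [Pi.add_apply, h.scaleVal_apply, hF.scaleVal_apply, hG.scaleVal_apply, map_add,
    Finset.sum_add_distrib]

theorem scaleVal_eps_thetaDx (R : AnnihilationRep S) (c : ℤ) (F : Distr V) :
    scaleVal R c (eps (thetaDx F)) = eps (thetaDx (scaleVal R c F)) := by
  funext m i j s e d
  fin_cases s <;> fin_cases e <;> simp [scaleVal, eps, thetaDx, Gr.eps, smul_finsum]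

theorem WeightsIn.eps_thetaDx (h : F.WeightsIn R P) : (eps (thetaDx F)).WeightsIn R P := by
  intro m i j s e d p hp
  fin_cases s <;> fin_cases e <;> simp [eps, thetaDx, Gr.eps, h _ _ _ _ _ _ p hp]

theorem WeightsIn.actQ (h : F.WeightsIn R P) : ∃ P', (actQ R F).WeightsIn R P' := by
  classical
  refine ⟨P ∪ P.image (· + (0, 1)), fun m i j s e d p hp => ?_⟩
  simp only [Finset.mem_union, not_or, Finset.mem_image, not_exists, not_and] at hp
  have h1 : ∀ m i j s e d, R.proj p (F m i j s e d) = 0 := fun m i j s e d => h _ _ _ _ _ _ p hp.1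
  have h2 : ∀ m i j s e d, R.proj p (R.Q 0 (F m i j s e d)) = 0 := fun m i j s e d => by
    have := R.proj_Q (p - (0, 1)) (F m i j s e d)
    rw [sub_add_cancel] at this
    rw [this, h _ _ _ _ _ _ _ fun hm => hp.2 _ hm (sub_add_cancel _ _), map_zero]
  fin_cases s <;> fin_cases d <;>
    simp [Distr.actQ, del, odd, xDtheta, Gr.del, Gr.odd, h1, h2]

theorem WeightsIn.scale (h : F.WeightsIn R P) (c : ℤ) : (scale c F).WeightsIn R P :=
  fun _ _ _ _ _ _ p hp => h _ _ _ _ _ _ p hp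

/-- The action of the generator as a product of commuting factors. -/
theorem WeightsIn.act_eq (h : F.WeightsIn R P) :
    act R F = actH R (mulY (-1) (scaleVal R 1 (Distr.scale 1 (Distr.actQ R F)))) := by
  obtain ⟨P', hP'⟩ := h.actQ
  set U := Distr.scale 1 (Distr.actQ R F) with hU
  have hUP : U.WeightsIn R P' := hP'.scale 1
  set G := Distr.scale 1 (F + del (xDtheta F)) with hG
  -- The factors `1 + ε θ ∂_x` and `1 - δ Q₀` commute: one acts on coordinates, the other on values,
  -- and both are even. This allows all the coordinate changes in `ε` to be collected on the left.
  have e1 : (G + eps (thetaDx G)) - del (odd (R.Q 0) (G + eps (thetaDx G)))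
      = U + eps (thetaDx U) := by
    have : U = G - del (odd (R.Q 0) G) := rfl
    rw [this]
    funext m i j s e d
    fin_cases s <;> fin_cases e <;> fin_cases d <;>
      simp [del, odd, eps, thetaDx, Gr.eps, Gr.del, Gr.odd]
    module
  have e2 : act R F = mulY (-1) (scaleVal R 1 ((G + eps (thetaDx G)) -
      del (odd (R.Q 0) (G + eps (thetaDx G)))) + eps (odd (R.H 0) (scaleVal R 1
        ((G + eps (thetaDx G)) - del (odd (R.Q 0) (G + eps (thetaDx G))))))) := rfl
  rw [e2, e1, hUP.scaleVal_add hUP.eps_thetaDx, scaleVal_eps_thetaDx]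
  rfl

end Distr

namespace FormalSection

theorem inner_weightsIn (R : AnnihilationRep S) (f : FormalSection V) :
    ∃ P, f.inner.WeightsIn R P := by
  classical
  refine ⟨Finset.univ.biUnion fun k => (R.proj_support_finite (f.v k)).toFinset,
    fun m i j s e d p hp => ?_⟩
  simp only [Finset.mem_biUnion, Finset.mem_univ, true_and, Set.Finite.mem_toFinset,
    Function.mem_support, not_exists, not_not] at hp
  simp [inner, hp]

end FormalSection

end

/-! ### Covariance of the fields under 𝐪⁻¹. -/

section

variable {V M : Type*} [AddCommGroup V] [Module ℂ V] [AddCommGroup M] [Module ℂ M]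
  {A : SUSYVertexAlgebra V} {C : QuasiConformal A} {N : SUSYModule A M}

namespace PositiveEnergy

variable (P : PositiveEnergy C N)

theorem proj_mul_Y (t : Fin 2) (l : ℤ) (a : V) (p w : ℤ × ℤ) :
    P.proj w * N.Y t l (C.proj p a) = N.Y t l (C.proj p a) *
      P.proj (w - (p.1 - l - 1 + (t : ℕ), p.2 + (t : ℕ))) := by
  ext x
  have := P.proj_comm (X := N.Y t l (C.proj p a)) (κ := (p.1 - l - 1 + (t : ℕ), p.2 + (t : ℕ)))
    (fun q x hx => P.Y_mem_wt (C.proj_mem p a) hx) (w - (p.1 - l - 1 + (t : ℕ), p.2 + (t : ℕ))) x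
  rwa [sub_add_cancel] at this

/-- A mode of a vector of weight `p` shifts the weights of `M` by a fixed amount `κ p`, while `u'`
shifts the powers of `q` and `y` by the same amount. Splitting into weights `p`, the two sides
differ by the translation of `w` by `κ p`. The hypothesis on `I` makes both sums sums over all of `ℤ
× ℤ`, where such a translation is harmless. -/
theorem sum_proj_mul_Y (t : Fin 2) (l : ℤ) (u u' : ℤ × ℤ → V) (K : Finset (ℤ × ℤ))
    (hu : ∀ π, ∑ p ∈ K, C.proj p (u π) = u π)
    (hu' : ∀ π, u' π = ∑ p ∈ K, C.proj p (u (π + (p.1 - l - 1 + (t : ℕ), p.2 + (t : ℕ)))))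
    (ρ : ℤ × ℤ) (I : Finset (ℤ × ℤ))
    (hI : ∀ w ∉ I, P.proj w = 0 ∨ (u (ρ - w) = 0 ∧ u' (ρ - w) = 0)) :
    ∑ w ∈ I, P.proj w * N.Y t l (u' (ρ - w)) = ∑ w ∈ I, N.Y t l (u (ρ - w)) * P.proj w := by
  set κ : ℤ × ℤ → ℤ × ℤ := fun p => (p.1 - l - 1 + (t : ℕ), p.2 + (t : ℕ)) with hκ
  let h : ℤ × ℤ → ℤ × ℤ → Module.End ℂ M := fun p w =>
    N.Y t l (C.proj p (u (ρ - w))) * P.proj w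
  have h1 : ∀ p w, P.proj w * N.Y t l (C.proj p (u (ρ - w + κ p))) = h p (w - κ p) := fun p w => by
    rw [proj_mul_Y, ← show ρ - (w - κ p) = ρ - w + κ p by abel]
  have hl : ∀ w, P.proj w * N.Y t l (u' (ρ - w)) = ∑ p ∈ K, h p (w - κ p) := fun w => by
    rw [hu', map_sum, Finset.mul_sum]
    exact Finset.sum_congr rfl fun p _ => h1 p w
  have hr : ∀ w, N.Y t l (u (ρ - w)) * P.proj w = ∑ p ∈ K, h p w := fun w => by
    rw [← hu (ρ - w), map_sum, Finset.sum_mul]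
  simp only [hl, hr]
  rw [Finset.sum_comm, Finset.sum_comm (s := I)]
  refine Finset.sum_congr rfl fun p hp => ?_
  rw [← finsum_eq_sum_of_support_subset (s := I) (fun w => h p w),
    ← finsum_eq_sum_of_support_subset (s := I) (fun w => h p (w - κ p))]
  · exact finsum_comp_equiv (Equiv.subRight (κ p)) (f := h p)
  · intro w hw
    by_contra hn
    refine hw ?_
    change h p (w - κ p) = 0
    rw [← h1]
    rcases hI w hn with h0 | ⟨_, h0⟩
    · rw [h0, zero_mul]
    -- The summands of `u'` lie in different eigenspaces, so vanishing of `u'` forces each of them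
    -- to vanish.
    · have : C.proj p (u' (ρ - w)) = C.proj p (u (ρ - w + κ p)) := by
        rw [hu', map_sum, Finset.sum_eq_single p]
        · rw [C.proj_proj, if_pos rfl]
        · intro q _ hq
          rw [C.proj_proj, if_neg hq]
        · exact fun hn => absurd hp hn
      rw [← this, h0, map_zero, map_zero, mul_zero]
  · intro w hw
    by_contra hn
    refine hw ?_
    change N.Y t l (C.proj p (u (ρ - w))) * P.proj w = 0
    rcases hI w hn with h0 | ⟨h0, _⟩
    · rw [h0, mul_zero]
    · rw [h0, map_zero, map_zero, zero_mul]

theorem base_proj_gmul (w : ℤ × ℤ) (X : Gr (Module.End ℂ M)) (e d : Fin 2) :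
    N.gmul (Gr.base (P.proj w)) X e d = P.proj w * X e d := by
  fin_cases e <;> fin_cases d <;> simp [SuperSpace.gmul, Gr.base, P.conj_proj]

theorem gmul_base (T : Module.End ℂ M) (X : Gr (Module.End ℂ M)) (e d : Fin 2) :
    N.gmul X (Gr.base T) e d = X e d * T := by
  fin_cases e <;> fin_cases d <;> simp [SuperSpace.gmul, Gr.base]

theorem sum_proj_smear {F : Distr V} {K : Finset (ℤ × ℤ)} (hF : F.WeightsIn C.toAnnihilationRep K)
    (ρ : ℤ × ℤ) (D : ℤ) (I : Finset (ℤ × ℤ))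
    (hI : ∀ w ∉ I, P.proj w = 0 ∨ ∀ m s e d, F m (ρ - w).1 (ρ - w).2 s e d = 0 ∧
      Distr.mulY (-1) (Distr.scaleVal C.toAnnihilationRep 1 (Distr.scale 1 F))
        m (ρ - w).1 (ρ - w).2 s e d = 0) :
    ∑ w ∈ I, N.gmul (Gr.base (P.proj w)) (N.smear (Distr.mulY (-1)
        (Distr.scaleVal C.toAnnihilationRep 1 (Distr.scale 1 F))) (ρ - w) D)
      = ∑ w ∈ I, N.gmul (N.smear F (ρ - w) D) (Gr.base (P.proj w)) := by
  set F' := Distr.mulY (-1) (Distr.scaleVal C.toAnnihilationRep 1 (Distr.scale 1 F)) with hF'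
  have key : ∀ (t s : Fin 2) (l : ℤ) (e d : Fin 2), (t : ℕ) + s = 1 →
      ∑ w ∈ I, P.proj w * N.Y t l (F' l (ρ - w).1 (ρ - w).2 s e d)
        = ∑ w ∈ I, N.Y t l (F l (ρ - w).1 (ρ - w).2 s e d) * P.proj w := by
    intro t s l e d hts
    refine P.sum_proj_mul_Y t l (fun π => F l π.1 π.2 s e d) (fun π => F' l π.1 π.2 s e d) K
      (fun π => hF.sum_proj ..) (fun π => ?_) ρ I fun w hw => (hI w hw).imp id fun h => h l s e d
    change Distr.scaleVal C.toAnnihilationRep 1 (Distr.scale 1 F) l π.1 (π.2 - -1) s e d = _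
    rw [(hF.scale 1).scaleVal_apply]
    refine Finset.sum_congr rfl fun p _ => ?_
    -- A coefficient of `θ ^ s` is paired with the component `t = 1 - s` of the field. With this,
    -- the powers of `q` agree, and the Berezinian `y⁻¹` provides the missing unit in the power of
    -- `y`.
    have hs : ((t : ℕ) : ℤ) = 1 - (s : ℕ) := by omega
    simp only [Distr.scale, Prod.fst_add, Prod.snd_add, hs]
    congr 3 <;> ring
  funext e d
  simp only [Finset.sum_apply, base_proj_gmul, gmul_base, SUSYModule.smear, mul_smul_comm,
    smul_mul_assoc, mul_add, add_mul, ← Finset.smul_sum, Finset.sum_add_distrib]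
  rw [key 0 1 _ _ _ rfl, key 1 0 _ _ _ rfl]

/-- The covariance of the fields under `𝐪`: the operator `𝐪⁻¹` intertwines the residues against a
distribution and its translate. -/
theorem sum_qTuple_smear {F : Distr V} {K : Finset (ℤ × ℤ)} (hF : F.WeightsIn C.toAnnihilationRep K)
    (ρ : ℤ × ℤ) (D : ℤ) (I : Finset (ℤ × ℤ))
    (hI : ∀ w ∉ I, P.proj w = 0 ∨ ∀ m s e d, F m (ρ - w).1 (ρ - w).2 s e d = 0 ∧
      Distr.act C.toAnnihilationRep F m (ρ - w).1 (ρ - w).2 s e d = 0) :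
    ∑ w ∈ I, N.gmul (P.qTuple w) (N.smear (Distr.act C.toAnnihilationRep F) (ρ - w) D)
      = ∑ w ∈ I, N.gmul (N.smear F (ρ - w) D) (P.qTuple w) := by
  obtain ⟨K', hK'⟩ := hF.actQ
  have hB := P.sum_proj_smear hK' ρ D I fun w hw => (hI w hw).imp id fun h => by
    generalize ρ - w = π at h ⊢
    set F₂ := Distr.mulY (-1) (Distr.scaleVal C.toAnnihilationRep 1 (Distr.scale 1
      (Distr.actQ C.toAnnihilationRep F))) with hF₂
    have hact : ∀ m s e d, Distr.actH C.toAnnihilationRep F₂ m π.1 π.2 s e d = 0 :=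
      fun m s e d => by rw [hF₂, ← hF.act_eq]; exact (h m s e d).2
    -- `Distr.actH` is unipotent in `ε`: it leaves the part without `ε` unchanged, so that part
    -- vanishes first, and then the correction to the part with `ε` vanishes too.
    have h0 : ∀ m s d, F₂ m π.1 π.2 s 0 d = 0 := fun m s d => by
      have := hact m s 0 d
      simpa [Distr.actH, Distr.eps, Gr.eps] using this
    intro m s e d
    constructor
    · fin_cases s <;> fin_cases d <;> simp [Distr.actQ, Distr.del, Distr.odd, Distr.xDtheta, Gr.del,
        Gr.odd, fun m s e d => (h m s e d).1]
    · fin_cases e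
      · exact h0 m s d
      · have := hact m s 1 d
        fin_cases s <;>
          simpa [Distr.actH, Distr.eps, Gr.eps, Distr.odd, Distr.thetaDx, Gr.odd, h0] using this
  simp only [AnnihilationRep.qTuple_eq, SuperSpace.gmul_assoc]
  rw [hF.act_eq]
  simp only [P.expH_smear]
  simp only [← SuperSpace.gmul_assoc]
  simp only [← SuperSpace.sum_gmul]
  congr 1
  simp only [SuperSpace.gmul_assoc]
  simp only [← SuperSpace.gmul_sum]
  rw [hB, SuperSpace.gmul_sum]
  refine Finset.sum_congr rfl fun w _ => ?_
  rw [← SuperSpace.gmul_assoc, P.expQ_smear, SuperSpace.gmul_assoc]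

end PositiveEnergy

end

/-! ## A linear supertrace -/

section

variable {W : Type*} [AddCommGroup W] [Module ℂ W] {S : SuperSpace W}

namespace AnnihilationRep

/-- The supertrace is a `finsum` and is additive only on the traceable ideal. An arbitrary linear
extension to all operators frees later computations from side conditions; its values off the ideal
play no role. -/
theorem exists_strLin (R : AnnihilationRep S) :
    ∃ ℓ : Module.End ℂ W →ₗ[ℂ] ℂ, ∀ T ∈ R.traceable, ℓ T = R.str T := by
  let ℓ₀ : R.traceable →ₗ[ℂ] ℂ :=
    { toFun T := R.str T
      map_add' T U := str_add T.2 U.2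
      map_smul' c T := str_smul c _ }
  obtain ⟨ℓ, hℓ⟩ := LinearMap.exists_extend ℓ₀
  exact ⟨ℓ, fun T hT => congrArg (fun m : R.traceable →ₗ[ℂ] ℂ => m ⟨T, hT⟩) hℓ⟩

/-- A linear functional on all operators extending the supertrace on the ideal of traceable ones. -/
noncomputable def strLin (R : AnnihilationRep S) : Module.End ℂ W →ₗ[ℂ] ℂ := R.exists_strLin.choose

variable {R : AnnihilationRep S}

theorem strLin_eq {T : Module.End ℂ W} (hT : T ∈ R.traceable) : R.strLin T = R.str T :=
  R.exists_strLin.choose_spec T hT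

theorem strLin_mul_comm (X : Module.End ℂ W) {T : Module.End ℂ W} (hT : T ∈ R.traceable) :
    R.strLin (X * T) = R.strLin (T * S.conj X) := by
  rw [strLin_eq (mul_mem_traceable _ hT), strLin_eq (mul_mem_traceable_right _ hT), str_mul_comm X hT]

theorem strLin_conj {T : Module.End ℂ W} (hT : T ∈ R.traceable) :
    R.strLin (S.conj T) = R.strLin T := by
  have hc : S.conj T ∈ R.traceable := mul_mem_traceable_right _ (mul_mem_traceable _ hT)
  rw [strLin_eq hT, strLin_eq hc, str_conj hT]

theorem strLin_hasPointwiseSum {ι : Type*} {X : ι → Module.End ℂ W} {Z : Module.End ℂ W}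
    (h : HasPointwiseSum X Z) {T : Module.End ℂ W} (hT : T ∈ R.traceable) :
    (Function.support fun i => R.strLin (X i * T)).Finite ∧
      ∑ᶠ i, R.strLin (X i * T) = R.strLin (Z * T) := by
  simp only [strLin_eq (mul_mem_traceable _ hT)]
  exact str_hasPointwiseSum h hT

theorem gmul_mem {X Y : Gr (Module.End ℂ W)} (hY : ∀ e d, Y e d ∈ R.traceable) (e d : Fin 2) :
    S.gmul X Y e d ∈ R.traceable := by
  have h := fun T e d => mul_mem_traceable T (hY e d)
  fin_cases e <;> fin_cases d
  · exact h _ _ _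
  · exact add_mem (h _ _ _) (h _ _ _)
  · exact add_mem (h _ _ _) (h _ _ _)
  · exact add_mem (sub_mem (add_mem (h _ _ _) (h _ _ _)) (h _ _ _)) (h _ _ _)

/-- The supertrace over `ℂ[ε, δ]` depends only on the cyclic order of a product, up to the sign
rule. -/
theorem strLin_gmul_comm (r : Fin 2) (X : Gr (Module.End ℂ W)) {U : Gr (Module.End ℂ W)}
    (hU : ∀ e d, U e d ∈ R.traceable)
    (hp : ∀ e d : Fin 2, S.conj (U e d) = (-1 : ℂ) ^ ((r : ℕ) + e + d) • U e d) (e d : Fin 2) :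
    R.strLin (S.gmul X U e d) = R.strLin (S.gmul U (S.gconj^[r] X) e d) := by
  have m1 : ∀ T e d, R.strLin (T * U e d) = R.strLin (U e d * S.conj T) := fun T e d =>
    strLin_mul_comm T (hU e d)
  -- The supertrace is invariant under conjugation by the parity, and `U e d` is homogeneous of
  -- parity `r + e + d`; hence the conjugation of `T` can be traded for a sign.
  have m2 : ∀ T (e d : Fin 2), R.strLin (U e d * S.conj T)
      = (-1 : ℂ) ^ ((r : ℕ) + e + d) * R.strLin (U e d * T) := fun T e d => by
    rw [← strLin_conj (mul_mem_traceable_right _ (hU e d)), S.conj_mul, S.conj_conj, hp,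
      smul_mul_assoc, map_smul, smul_eq_mul]
  have h : ∀ T e d, R.strLin (T * U e d)
      = (-1 : ℂ) ^ ((r : ℕ) + e + d) * R.strLin (U e d * T) := fun T e d => by rw [m1, m2]
  fin_cases r <;> fin_cases e <;> fin_cases d <;>
    simp [SuperSpace.gmul, SuperSpace.gconj, h, m2, hp] <;> ring

end AnnihilationRep

end

/-! ## The functional is well defined -/

section

variable {V M : Type*} [AddCommGroup V] [Module ℂ V] [AddCommGroup M] [Module ℂ M]
  {A : SUSYVertexAlgebra V} {C : QuasiConformal A} {N : SUSYModule A M}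

theorem finsum_finset_comm {α β E : Type*} [AddCommMonoid E] (s : Finset α) (F : α → β → E)
    (h : ∀ a ∈ s, (Function.support (F a)).Finite) :
    ∑ a ∈ s, ∑ᶠ b, F a b = ∑ᶠ b, ∑ a ∈ s, F a b :=
  (finsum_sum_comm s (fun b a => F a b) h).symm

namespace PositiveEnergy

variable (P : PositiveEnergy C N)

theorem conj_iterate_Y (k : ℕ) (n : ℤ) (v : V) :
    N.conj^[k] (N.Y 0 n v) = N.Y 0 n ((A.par ^ k) v) := by
  induction k generalizing v with
  | zero => simp
  | succ k ih => simp [Function.iterate_succ_apply, N.conj_Y, ih, pow_succ]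

theorem base_gmul (T : Module.End ℂ M) (X : Gr (Module.End ℂ M)) (e d : Fin 2) :
    N.gmul (Gr.base T) X e d = N.conj^[(e : ℕ) + (d : ℕ)] T * X e d := by
  fin_cases e <;> fin_cases d <;> simp [SuperSpace.gmul, Gr.base]

theorem traceOp_eq_mul (v : V) (i j n : ℤ) (e d : Fin 2) :
    P.traceOp v i j n e d = N.Y 0 n ((A.par ^ ((e : ℕ) + (d : ℕ))) v) * P.qTuple (i, j) e d := by
  rw [traceOp_eq, base_gmul, conj_iterate_Y]

theorem traceOp_mem (v : V) (i j n : ℤ) (e d : Fin 2) :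
    P.traceOp v i j n e d ∈ P.traceable := by
  rw [traceOp_eq_mul]
  exact AnnihilationRep.mul_mem_traceable _ (P.qTuple_mem _ _ _)

theorem proj_L_zero (w : ℤ × ℤ) (x : M) : P.proj w (P.L 0 x) = (w.1 : ℂ) • P.proj w x := by
  have := P.proj_comm (X := P.L 0) (κ := 0) (fun p x hx => by simpa using P.L_zero_mem hx) w x
  rw [add_zero] at this
  rw [this, (P.mem_wt.1 (P.proj_mem w x)).1]

/-- For `v` of conformal weight `p.1`, only the mode `n = p.1 - 1` preserves conformal weights, and
`X`, `Z` preserve them by hypothesis; all other modes have no diagonal part. -/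
theorem strLin_Y_support_finite {X Z : Module.End ℂ M} (hX : Commute (P.L 0) X)
    (hZ : Commute (P.L 0) Z) (w : ℤ × ℤ) (v : V) :
    (Function.support fun n => P.strLin (N.Y 0 n v * (X * P.proj w * Z))).Finite := by
  refine C.wt_induction (P := fun v => (Function.support fun n =>
    P.strLin (N.Y 0 n v * (X * P.proj w * Z))).Finite) (by simp) (fun u v hu hv => ?_)
    (fun p v hv => ?_) v
  · refine (hu.union hv).subset fun n hn => ?_
    contrapose! hn
    simp only [Set.mem_union, Function.mem_support, not_or, not_not] at hn
    simp [add_mul, hn]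
  · refine (Set.finite_singleton (p.1 - 1)).subset fun n hn => ?_
    by_contra hne
    refine hn ?_
    change P.strLin (N.Y 0 n v * (X * P.proj w * Z)) = 0
    rw [← mul_assoc, ← mul_assoc, AnnihilationRep.strLin_eq (AnnihilationRep.mem_traceable _ _ _),
      AnnihilationRep.str_mul_proj_mul, AnnihilationRep.wtTrace]
    convert map_zero (LinearMap.trace ℂ (P.wt w))
    ext x
    have hXx := congrArg (fun T : Module.End ℂ M => T x) hX.eq
    simp only [Module.End.mul_apply, (P.mem_wt.1 x.2).1, map_smul] at hXx
    set y := Z (N.par (N.Y 0 n v (X x))) with hy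
    -- Its `L 0`-eigenvalue would have to be `w.1` for `y` to have a component in the block `w`,
    -- which leaves only `n = p.1 - 1`.
    have hLy : P.L 0 y = ((w.1 : ℂ) + p.1 - n - 1) • y := by
      have h1 := congrArg (fun T : Module.End ℂ M => T (N.par (N.Y 0 n v (X x)))) hZ.eq
      simp only [Module.End.mul_apply] at h1
      rw [hy, h1, ← P.L_even 0 (by norm_num), P.L_zero_Y, hXx, (C.mem_wt.1 hv).1]
      simp only [map_smul, LinearMap.smul_apply, ← add_smul]
      congr 1
      push_cast [Fin.val_zero]
      ring
    have h2 := P.proj_L_zero w y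
    rw [hLy, map_smul, ← sub_eq_zero, ← sub_smul, smul_eq_zero] at h2
    rcases h2 with h2 | h2
    · refine absurd ?_ hne
      have : ((p.1 : ℂ) - 1) = n := by linear_combination h2
      exact_mod_cast this.symm
    · exact h2

theorem strLin_qTuple_support_finite (w : ℤ × ℤ) (e d : Fin 2) (v : V) :
    (Function.support fun n => P.strLin (N.Y 0 n v * P.qTuple w e d)).Finite := by
  have hH : Commute (P.L 0) (P.H 0) := by
    have := P.L_H 0 0 (by norm_num) le_rfl
    simpa [sub_eq_zero, commute_iff_eq] using this
  have hQ : Commute (P.L 0) (P.Q 0) := by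
    have := P.L_Q 0 0 (by norm_num) (by norm_num)
    simpa [sub_eq_zero, commute_iff_eq] using this
  have h1 : Commute (P.L 0) 1 := Commute.one_right _
  fin_cases e <;> fin_cases d
  · simpa [AnnihilationRep.qTuple] using P.strLin_Y_support_finite h1 h1 w v
  · simpa [AnnihilationRep.qTuple] using P.strLin_Y_support_finite hQ h1 w v
  · simpa [AnnihilationRep.qTuple, Function.support_fun_neg] using
      P.strLin_Y_support_finite h1 hH w v
  · simpa [AnnihilationRep.qTuple, Function.support_fun_neg] using
      P.strLin_Y_support_finite hQ hH w v

theorem str_traceOp (v : V) (i j n : ℤ) (e d : Fin 2) : P.str (P.traceOp v i j n e d) =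
    P.strLin (N.conj^[(e : ℕ) + (d : ℕ)] (N.Y 0 n v) * P.qTuple (i, j) e d) := by
  rw [← AnnihilationRep.strLin_eq (P.traceOp_mem _ _ _ _ _ _), traceOp_eq, base_gmul]

theorem strLin_conj_Y_support_finite (k : ℕ) (w : ℤ × ℤ) (e d : Fin 2) (v : V) :
    (Function.support fun n => P.strLin (N.conj^[k] (N.Y 0 n v) * P.qTuple w e d)).Finite := by
  simp only [conj_iterate_Y]
  exact P.strLin_qTuple_support_finite _ _ _ _

theorem str_traceOp_support_finite (v : V) (i j : ℤ) (e d : Fin 2) :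
    (Function.support fun n => P.str (P.traceOp v i j n e d)).Finite := by
  simp only [str_traceOp]
  exact P.strLin_conj_Y_support_finite _ _ _ _ _

theorem phi_apply (v : V) (i j : ℤ) (e d : Fin 2) : P.phi v i j e d =
    ∑ᶠ n : ℤ, P.strLin (N.conj^[(e : ℕ) + (d : ℕ)] (N.Y 0 n v) * P.qTuple (i, j) e d) := by
  simp only [phi, str_traceOp]

theorem phi_isLinearMap (i j : ℤ) : IsLinearMap ℂ (fun v => P.phi v i j) where
  map_add u v := by
    funext e d
    simp only [Pi.add_apply, phi_apply]
    rw [← finsum_add_distrib (P.strLin_conj_Y_support_finite _ _ _ _ _)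
      (P.strLin_conj_Y_support_finite _ _ _ _ _)]
    simp only [conj_iterate_Y]
    simp only [map_add, add_mul]
  map_smul c v := by
    funext e d
    simp only [Pi.smul_apply, phi_apply, conj_iterate_Y]
    simp only [map_smul, smul_mul_assoc]
    rw [smul_finsum]

theorem qTuple_eq_zero {w : ℤ × ℤ} (h : P.proj w = 0) : P.qTuple w = 0 := by
  apply Gr.ext_four <;> simp [AnnihilationRep.qTuple, h]

theorem phi_eq_zero {i j : ℤ} (h : P.proj (i, j) = 0) (v : V) : P.phi v i j = 0 := by
  funext e d
  simp [phi_apply, P.qTuple_eq_zero h]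

/-! ## The residue theorem for supertraces -/

/-- The family `Z` of operators has the same supertraces as the family of modes of `u`, after
summation. -/
def TraceEquiv (u : V) (Z : ℤ → Module.End ℂ M) : Prop :=
  ∀ (k : ℕ) (w : ℤ × ℤ) (e d : Fin 2),
    (Function.support fun n => P.strLin (N.conj^[k] (Z n) * P.qTuple w e d)).Finite ∧
      ∑ᶠ n, P.strLin (N.conj^[k] (Z n) * P.qTuple w e d)
        = ∑ᶠ n, P.strLin (N.conj^[k] (N.Y 0 n u) * P.qTuple w e d)

theorem conj_iterate_add (k : ℕ) (T U : Module.End ℂ M) :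
    N.conj^[k] (T + U) = N.conj^[k] T + N.conj^[k] U := by
  induction k generalizing T U with
  | zero => rfl
  | succ k ih => simp [Function.iterate_succ_apply, ih]

theorem conj_iterate_smul (k : ℕ) (c : ℂ) (T : Module.End ℂ M) :
    N.conj^[k] (c • T) = c • N.conj^[k] T := by
  induction k generalizing T with
  | zero => rfl
  | succ k ih => simp [Function.iterate_succ_apply, ih]

theorem conj_iterate_sum (k : ℕ) {ι : Type*} (s : Finset ι) (T : ι → Module.End ℂ M) :
    N.conj^[k] (∑ i ∈ s, T i) = ∑ i ∈ s, N.conj^[k] (T i) := by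
  induction k generalizing T with
  | zero => rfl
  | succ k ih => simp [Function.iterate_succ_apply, ih, SuperSpace.conj_sum]

variable {P}

/-- At `x = 1` the power of `x` attached to a mode is forgotten, so relabelling modes does not alter
the sum. This permits grouping by total degree in the residue theorem. -/
theorem TraceEquiv.shift (u : V) (c : ℤ) : P.TraceEquiv u fun n => N.Y 0 (n - c) u :=
  fun k w e d =>
    ⟨(P.strLin_conj_Y_support_finite k w e d u).preimage (sub_left_injective (b := c)).injOn,
      finsum_comp_equiv (Equiv.subRight c)
        (f := fun n => P.strLin (N.conj^[k] (N.Y 0 n u) * P.qTuple w e d))⟩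

theorem TraceEquiv.add {u v : V} {Z U : ℤ → Module.End ℂ M} (h : P.TraceEquiv u Z)
    (h' : P.TraceEquiv v U) : P.TraceEquiv (u + v) fun n => Z n + U n := fun k w e d => by
  have e1 := (h k w e d).1
  have e2 := (h' k w e d).1
  simp only [conj_iterate_add, map_add, add_mul]
  refine ⟨(e1.union e2).subset fun n hn => ?_, ?_⟩
  · contrapose! hn
    simp only [Set.mem_union, Function.mem_support, not_or, not_not] at hn
    simp [hn]
  · rw [finsum_add_distrib e1 e2, (h k w e d).2, (h' k w e d).2, finsum_add_distrib
      (P.strLin_conj_Y_support_finite _ _ _ _ _) (P.strLin_conj_Y_support_finite _ _ _ _ _)]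

theorem TraceEquiv.smul {u : V} {Z : ℤ → Module.End ℂ M} (h : P.TraceEquiv u Z) (c : ℂ) :
    P.TraceEquiv (c • u) fun n => c • Z n := fun k w e d => by
  simp only [conj_iterate_smul, map_smul, smul_mul_assoc]
  refine ⟨(h k w e d).1.subset fun n hn => right_ne_zero_of_mul hn, ?_⟩
  rw [← smul_finsum, ← smul_finsum, (h k w e d).2]

theorem TraceEquiv.zero : P.TraceEquiv (0 : V) fun _ => 0 := by
  simpa using TraceEquiv.shift (P := P) (0 : V) 0

theorem TraceEquiv.sum {ι : Type*} (s : Finset ι) {u : ι → V} {Z : ι → ℤ → Module.End ℂ M}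
    (h : ∀ i, P.TraceEquiv (u i) (Z i)) : P.TraceEquiv (∑ i ∈ s, u i) fun n => ∑ i ∈ s, Z i n := by
  classical
  induction s using Finset.induction_on with
  | empty => simpa using TraceEquiv.zero
  | insert a s ha ih => simpa [Finset.sum_insert ha] using (h a).add ih

variable (P)

/-- Extending `φ_M` linearly over the odd parameters amounts to multiplying by `P.qTuple` in the
algebra `N.gmul`: the conjugations in `phi_apply` are exactly the signs from moving a field past `ε`
and `δ`. -/
theorem phiTerm_eq {U : ℤ → ℤ → Gr V} {i j : ℤ} {p : ℤ × ℤ} {Z : ℤ → Gr (Module.End ℂ M)}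
    (h : ∀ e d, P.TraceEquiv (U p.1 p.2 e d) fun n => Z n e d) (e d : Fin 2) :
    (Function.support fun n => P.strLin (N.gmul (Z n) (P.qTuple ((i, j) - p)) e d)).Finite ∧
      P.phiTerm U i j p e d = ∑ᶠ n, P.strLin (N.gmul (Z n) (P.qTuple ((i, j) - p)) e d) := by
  set w := (i, j) - p with hw
  have key : ∀ (e' d' e d : Fin 2),
      (Function.support fun n => P.strLin (N.conj^[(e : ℕ) + d] (Z n e' d') * P.qTuple w e d)).Finite ∧
      P.phi (U p.1 p.2 e' d') (i - p.1) (j - p.2) e d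
        = ∑ᶠ n, P.strLin (N.conj^[(e : ℕ) + d] (Z n e' d') * P.qTuple w e d) := fun e' d' e d => by
    refine ⟨(h e' d' _ w e d).1, ?_⟩
    rw [(h e' d' _ w e d).2, phi_apply]
    rfl
  have sadd : ∀ {f g : ℤ → ℂ}, (Function.support f).Finite → (Function.support g).Finite →
      (Function.support fun n => f n + g n).Finite := fun {f g} hf hg =>
    (hf.union hg).subset (Function.support_add f g)
  have sneg : ∀ {f : ℤ → ℂ}, (Function.support f).Finite →
      (Function.support fun n => -f n).Finite := fun {f} hf => by
    rwa [Function.support_fun_neg]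
  simp only [Fin.forall_fin_two, Fin.val_zero, Fin.val_one, add_zero,
    Function.iterate_succ, Function.iterate_zero, Function.comp_apply, id_eq,
    N.conj_conj] at key
  obtain ⟨⟨⟨⟨a0, a1⟩, a2, a3⟩, ⟨b0, -⟩, b2, -⟩, ⟨⟨c0, c1⟩, -, -⟩, ⟨d0, -⟩, -, -⟩ := key
  fin_cases e <;> fin_cases d
  · simp only [SuperSpace.gmul_zero_zero, Fin.zero_eta]
    refine ⟨a0.1, ?_⟩
    simp only [phiTerm, Fin.sum_univ_two]
    simp [Gr.eps, Gr.del, a0.2]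
  · simp only [SuperSpace.gmul_zero_one, Fin.zero_eta, Fin.mk_one, map_add]
    refine ⟨sadd b0.1 a1.1, ?_⟩
    rw [finsum_add_distrib b0.1 a1.1]
    simp only [phiTerm, Fin.sum_univ_two]
    simp [Gr.eps, Gr.del, b0.2, a1.2, add_comm]
  · simp only [SuperSpace.gmul_one_zero, Fin.zero_eta, Fin.mk_one, map_add]
    refine ⟨sadd c0.1 a2.1, ?_⟩
    rw [finsum_add_distrib c0.1 a2.1]
    simp only [phiTerm, Fin.sum_univ_two]
    simp [Gr.eps, Gr.del, c0.2, a2.2, add_comm]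
  · simp only [SuperSpace.gmul_one_one, Fin.mk_one, map_add, map_sub]
    simp only [sub_eq_add_neg]
    refine ⟨sadd (sadd (sadd d0.1 c1.1) (sneg b2.1)) a3.1, ?_⟩
    rw [finsum_add_distrib (sadd (sadd d0.1 c1.1) (sneg b2.1)) a3.1,
      finsum_add_distrib (sadd d0.1 c1.1) (sneg b2.1), finsum_add_distrib d0.1 c1.1,
      finsum_neg_distrib]
    simp only [phiTerm, Fin.sum_univ_two]
    simp [Gr.eps, Gr.del, a3.2, c1.2, b2.2, d0.2]
    ring

theorem strLin_gmul_hasPointwiseSum {ι : Type*} {X : ι → Gr (Module.End ℂ M)}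
    {Z : Gr (Module.End ℂ M)} (h : ∀ e d, HasPointwiseSum (fun i => X i e d) (Z e d)) (w : ℤ × ℤ)
    (e d : Fin 2) : (Function.support fun i => P.strLin (N.gmul (X i) (P.qTuple w) e d)).Finite ∧
      ∑ᶠ i, P.strLin (N.gmul (X i) (P.qTuple w) e d) = P.strLin (N.gmul Z (P.qTuple w) e d) := by
  have key : ∀ (e' d' e d : Fin 2),
      (Function.support fun i => P.strLin (X i e' d' * P.qTuple w e d)).Finite ∧
      ∑ᶠ i, P.strLin (X i e' d' * P.qTuple w e d) = P.strLin (Z e' d' * P.qTuple w e d) :=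
    fun e' d' e d => AnnihilationRep.strLin_hasPointwiseSum (h e' d') (P.qTuple_mem w e d)
  have keyc : ∀ (e' d' e d : Fin 2),
      (Function.support fun i => P.strLin (N.conj (X i e' d') * P.qTuple w e d)).Finite ∧
      ∑ᶠ i, P.strLin (N.conj (X i e' d') * P.qTuple w e d)
        = P.strLin (N.conj (Z e' d') * P.qTuple w e d) := fun e' d' e d =>
    AnnihilationRep.strLin_hasPointwiseSum
      (((h e' d').comp_left N.par).comp_right N.par) (P.qTuple_mem w e d)
  have sadd : ∀ {f g : ι → ℂ}, (Function.support f).Finite → (Function.support g).Finite →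
      (Function.support fun n => f n + g n).Finite := fun {f g} hf hg =>
    (hf.union hg).subset (Function.support_add f g)
  have ssub : ∀ {f g : ι → ℂ}, (Function.support f).Finite → (Function.support g).Finite →
      (Function.support fun n => f n - g n).Finite := fun {f g} hf hg =>
    (hf.union hg).subset (Function.support_sub f g)
  fin_cases e <;> fin_cases d
  · exact key 0 0 0 0
  · have a := key 0 1 0 0
    have b := keyc 0 0 0 1
    simp only [Fin.zero_eta, Fin.mk_one, SuperSpace.gmul_zero_one, map_add]
    exact ⟨sadd a.1 b.1, by rw [finsum_add_distrib a.1 b.1, a.2, b.2]⟩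
  · have a := key 1 0 0 0
    have b := keyc 0 0 1 0
    simp only [Fin.zero_eta, Fin.mk_one, SuperSpace.gmul_one_zero, map_add]
    exact ⟨sadd a.1 b.1, by rw [finsum_add_distrib a.1 b.1, a.2, b.2]⟩
  · have a := key 1 1 0 0
    have b := keyc 1 0 0 1
    have c := keyc 0 1 1 0
    have d := key 0 0 1 1
    simp only [Fin.mk_one, SuperSpace.gmul_one_one, map_add, map_sub]
    exact ⟨sadd (ssub (sadd a.1 b.1) c.1) d.1, by
      rw [finsum_add_distrib (ssub (sadd a.1 b.1) c.1) d.1, finsum_sub_distrib (sadd a.1 b.1) c.1,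
        finsum_add_distrib a.1 b.1, a.2, b.2, c.2, d.2]⟩

end PositiveEnergy

end

/-! ### The residue theorem for sections. -/

section

variable {V M : Type*} [AddCommGroup V] [Module ℂ V] [AddCommGroup M] [Module ℂ M]
  {A : SUSYVertexAlgebra V} {C : QuasiConformal A} {N : SUSYModule A M}

namespace SUSYModule

theorem finite_support_coeffOne_op (g : RatFunc ℂ) (s : Fin 2) (a b : V) (c : ℤ) :
    (Function.support fun l => coeffOne g l • N.Y 0 (c - l) (A.Y s l a b)).Finite := by
  obtain ⟨B, hB⟩ := coeffOne_bounded g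
  obtain ⟨K, hK⟩ := A.trunc a b
  refine (Set.finite_Ico B K).subset fun l hl => ?_
  contrapose! hl
  rw [Set.mem_Ico, not_and_or, not_le, not_lt] at hl
  rcases hl with hl | hl <;> simp [hB, hK, hl]

/-- The residue at `x = 1` of a regular function against an iterate of fields. -/
noncomputable def residueOne (N : SUSYModule A M) (g : RatFunc ℂ) (s : Fin 2) (a b : V) (K : ℤ) :
    Module.End ℂ M :=
  ∑ᶠ l : ℤ, coeffOne g l • N.Y 0 (K - l) (A.Y s l a b)

/-- Encoding the sign by `N.conj^[r]` makes the statement additive in `a`, so no parity has to be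
assumed for the values of the section; the homogeneous case is `residueIdentity`. -/
theorem hasPointwiseSum_residueOne {r : Fin 2} {b : V} (hb : A.HasParity r b) {g : RatFunc ℂ}
    (hg : IsRegularFunction g) (s : Fin 2) (a : V) (K : ℤ) :
    HasPointwiseSum (fun l : ℤ => N.Y s l (coeffInfty g l • a) * N.Y 0 (K - l) b
      - N.Y 0 (K - l) b * N.conj^[r] (N.Y s l (coeffZero g l • a))) (N.residueOne g s a b K) := by
  refine A.hasParity_induction (P := fun a => HasPointwiseSum (fun l : ℤ =>
    N.Y s l (coeffInfty g l • a) * N.Y 0 (K - l) b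
      - N.Y 0 (K - l) b * N.conj^[r] (N.Y s l (coeffZero g l • a))) (N.residueOne g s a b K))
    (fun u v hu hv => ?_) (fun p a ha x => ?_) a
  · convert hu.add hv using 1
    · funext l
      simp only [smul_add, map_add, PositiveEnergy.conj_iterate_add, add_mul, mul_add]
      abel
    · rw [residueOne, residueOne, residueOne, ← finsum_add_distrib
        (finite_support_coeffOne_op g s u b K) (finite_support_coeffOne_op g s v b K)]
      simp only [map_add, LinearMap.add_apply, smul_add]
  · have hconj : ∀ l, N.conj^[r] (N.Y s l a) = (-1 : ℂ) ^ (((p : ℕ) + s) * r) • N.Y s l a := by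
      intro l
      have hp : A.par a = (-1 : ℂ) ^ (p : ℕ) • a := ha
      fin_cases r
      · simp
      · simp only [Function.iterate_one, N.conj_Y, hp, map_smul, smul_smul]
        rw [← pow_add, mul_one, add_comm]
    have f2 := N.finite_support_coeffInfty g s a b K x
    have f3 := N.finite_support_coeffZero g s a b K x
    have hX : ∀ l, (N.Y s l (coeffInfty g l • a) * N.Y 0 (K - l) b
        - N.Y 0 (K - l) b * N.conj^[r] (N.Y s l (coeffZero g l • a))) x =
        coeffInfty g l • N.Y s l a (N.Y 0 (K - l) b x) - (-1 : ℂ) ^ (((p : ℕ) + s) * r) •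
          coeffZero g l • N.Y 0 (K - l) b (N.Y s l a x) := fun l => by
      simp only [map_smul, PositiveEnergy.conj_iterate_smul, hconj, LinearMap.sub_apply,
        Module.End.mul_apply, LinearMap.smul_apply]
      rw [smul_comm]
    have f3' : (Function.support fun l => (-1 : ℂ) ^ (((p : ℕ) + s) * r) •
          coeffZero g l • N.Y 0 (K - l) b (N.Y s l a x)).Finite :=
      f3.subset fun l hl => by
        contrapose! hl
        simp only [Function.mem_support, not_not] at hl
        simp [hl]
    simp only [hX]
    refine ⟨(f2.union f3').subset (Function.support_sub _ _), ?_⟩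
    rw [finsum_sub_distrib f2 f3', ← smul_finsum]
    refine (N.residueIdentity ha hb s K x hg).symm.trans ?_
    exact ((LinearMap.applyₗ x : Module.End ℂ M →ₗ[ℂ] M).toAddMonoidHom.map_finsum
      (finite_support_coeffOne_op g s a b K)).symm

end SUSYModule

namespace FormalSection

/-- The operators `Y(h(f) b, x, 0)`, for each power of `q, y` and rearranged according to the total
degree. -/
noncomputable def hOp (N : SUSYModule A M) (f : FormalSection V) (b : V) (π : ℤ × ℤ) (n : ℤ) :
    Gr (Module.End ℂ M) :=
  fun e d => (-1 : ℂ) ^ ((e : ℕ) + (d : ℕ)) • ∑ k,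
    (N.residueOne (f.g k π.1 π.2 1 e d) 0 (f.v k) b (n - 1)
      + N.residueOne (f.g k π.1 π.2 0 e d) 1 (f.v k) b n)

/-- Only finitely many orders at `x = 1` contribute, since the poles of `g` and of the operator
product are bounded. Each contributes the modes of one vector, shifted by `c + l`. -/
theorem traceEquiv_residueOne (P : PositiveEnergy C N) (g : RatFunc ℂ) (s : Fin 2) (a b : V)
    (c : ℤ) : P.TraceEquiv (∑ᶠ l : ℤ, coeffOne g l • A.Y s l a b)
      fun n => N.residueOne g s a b (n - c) := by
  obtain ⟨B, hB⟩ := coeffOne_bounded g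
  obtain ⟨K, hK⟩ := A.trunc a b
  have h0 : ∀ l ∉ Finset.Ico B K, coeffOne g l = 0 ∨ A.Y s l a b = 0 := fun l hl => by
    rw [Finset.mem_Ico, not_and_or, not_le, not_lt] at hl
    exact hl.imp (hB l) (hK s l)
  have e1 : ∑ᶠ l : ℤ, coeffOne g l • A.Y s l a b = ∑ l ∈ Finset.Ico B K, coeffOne g l • A.Y s l a b := by
    refine finsum_eq_sum_of_support_subset _ fun l hl => ?_
    by_contra hn
    rcases h0 l hn with h | h <;> exact hl (by simp [h])
  have e2 : (fun n => N.residueOne g s a b (n - c)) = fun n => ∑ l ∈ Finset.Ico B K,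
      coeffOne g l • N.Y 0 (n - (c + l)) (A.Y s l a b) := by
    funext n
    rw [SUSYModule.residueOne, finsum_eq_sum_of_support_subset (s := Finset.Ico B K)]
    · simp only [sub_sub]
    · intro l hl
      by_contra hn
      rcases h0 l hn with h | h <;> exact hl (by simp [h])
  rw [e1, e2]
  exact PositiveEnergy.TraceEquiv.sum _ fun l =>
    (PositiveEnergy.TraceEquiv.shift (A.Y s l a b) (c + l)).smul _

theorem hAct_eq (f : FormalSection V) (b : V) (i j : ℤ) (e d : Fin 2) :
    f.hAct A b i j e d = (-1 : ℂ) ^ ((e : ℕ) + (d : ℕ)) • ∑ k,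
      (∑ᶠ l : ℤ, coeffOne (f.g k i j 1 e d) l • A.Y 0 l (f.v k) b
        + ∑ᶠ l : ℤ, coeffOne (f.g k i j 0 e d) l • A.Y 1 l (f.v k) b) := by
  rw [hAct]
  congr 1
  refine Finset.sum_congr rfl fun k _ => finsum_add_distrib ?_ ?_ <;>
    exact SUSYModule.finite_support_coeffOne _ _ _ _ fun _ => LinearMap.id

theorem traceEquiv_hOp (P : PositiveEnergy C N) (f : FormalSection V) (b : V) (π : ℤ × ℤ)
    (e d : Fin 2) : P.TraceEquiv (f.hAct A b π.1 π.2 e d) fun n => f.hOp N b π n e d := by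
  rw [hAct_eq]
  refine (PositiveEnergy.TraceEquiv.sum _ fun k => ?_).smul _
  refine (traceEquiv_residueOne P _ 0 (f.v k) b 1).add ?_
  simpa using traceEquiv_residueOne P (f.g k π.1 π.2 0 e d) 1 (f.v k) b 0

theorem smear_outer (N : SUSYModule A M) (f : FormalSection V) (π : ℤ × ℤ) (D : ℤ) (e d : Fin 2) :
    N.smear f.outer π D e d = (-1 : ℂ) ^ ((e : ℕ) + (d : ℕ)) • ∑ k,
      (N.Y 0 (D - 1) (coeffInfty (f.g k π.1 π.2 1 e d) (D - 1) • f.v k)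
        + N.Y 1 D (coeffInfty (f.g k π.1 π.2 0 e d) D • f.v k)) := by
  simp only [SUSYModule.smear, outer, map_sum, Finset.sum_add_distrib]

theorem smear_inner (N : SUSYModule A M) (f : FormalSection V) (π : ℤ × ℤ) (D : ℤ) (e d : Fin 2) :
    N.smear f.inner π D e d = (-1 : ℂ) ^ ((e : ℕ) + (d : ℕ)) • ∑ k,
      (N.Y 0 (D - 1) (coeffZero (f.g k π.1 π.2 1 e d) (D - 1) • f.v k)
        + N.Y 1 D (coeffZero (f.g k π.1 π.2 0 e d) D • f.v k)) := by
  simp only [SUSYModule.smear, inner, map_sum, Finset.sum_add_distrib]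

/-- The operator `Y(h(f) b, x, 0)` is the commutator of residues of the two expansions of `f` with
`Y(b, x, 0)`. -/
theorem hasPointwiseSum_hOp (f : FormalSection V) {r : Fin 2} {b : V} (hb : A.HasParity r b)
    (π : ℤ × ℤ) (n : ℤ) (e d : Fin 2) :
    HasPointwiseSum (fun D : ℤ => N.smear f.outer π D e d * N.Y 0 (n - D) b
      - N.Y 0 (n - D) b * N.conj^[r] (N.smear f.inner π D e d)) (f.hOp N b π n e d) := by
  -- The coefficient of `θ` in degree `D` multiplies `x ^ (D - 1)`, that without `θ` multiplies `x ^
  -- D`; shifting the first family by one lines up the two.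
  have h := (HasPointwiseSum.sum Finset.univ fun k =>
    ((SUSYModule.hasPointwiseSum_residueOne (N := N) hb (f.regular k π.1 π.2 1 e d) 0 (f.v k)
      (n - 1)).comp_equiv (Equiv.subRight 1)).add
    (SUSYModule.hasPointwiseSum_residueOne (N := N) hb (f.regular k π.1 π.2 0 e d) 1 (f.v k) n)).smul
      ((-1 : ℂ) ^ ((e : ℕ) + (d : ℕ)))
  change HasPointwiseSum _ ((-1 : ℂ) ^ ((e : ℕ) + (d : ℕ)) • ∑ k, _)
  convert h using 1
  funext D
  simp only [smear_outer, smear_inner, Equiv.subRight_apply, sub_sub_sub_cancel_right,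
    PositiveEnergy.conj_iterate_smul, PositiveEnergy.conj_iterate_sum,
    PositiveEnergy.conj_iterate_add, smul_mul_assoc, mul_smul_comm, ← smul_sub, Finset.sum_mul,
    Finset.mul_sum, ← Finset.sum_sub_distrib, add_mul, mul_add]
  congr 1
  exact Finset.sum_congr rfl fun k _ => by abel

end FormalSection

/-! ### The conformal block property. -/

namespace PositiveEnergy

variable (P : PositiveEnergy C N)

theorem gconj_iterate_apply (r : Fin 2) (X : Gr (Module.End ℂ M)) (e d : Fin 2) :
    N.gconj^[r] X e d = ((-1 : ℂ) ^ (r : ℕ)) ^ ((e : ℕ) + (d : ℕ)) • N.conj^[r] (X e d) := by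
  fin_cases r <;> simp [SuperSpace.gconj]

theorem gconj_iterate_gmul (r : Fin 2) (X Y : Gr (Module.End ℂ M)) :
    N.gconj^[r] (N.gmul X Y) = N.gmul (N.gconj^[r] X) (N.gconj^[r] Y) := by
  fin_cases r <;> simp [SuperSpace.gconj_gmul]

theorem gconj_iterate_sum (r : Fin 2) {ι : Type*} (s : Finset ι) (X : ι → Gr (Module.End ℂ M)) :
    N.gconj^[r] (∑ i ∈ s, X i) = ∑ i ∈ s, N.gconj^[r] (X i) := by
  fin_cases r <;> simp [SuperSpace.gconj_sum]

theorem gconj_iterate_qTuple (r : Fin 2) (w : ℤ × ℤ) :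
    N.gconj^[r] (P.qTuple w) = P.qTuple w := by
  fin_cases r <;> simp [P.gconj_qTuple]

theorem base_gmul_gconj {r : Fin 2} {B : Module.End ℂ M} (hB : N.conj B = (-1 : ℂ) ^ (r : ℕ) • B)
    (X : Gr (Module.End ℂ M)) (e d : Fin 2) :
    N.gmul (Gr.base B) (N.gconj^[r] X) e d = B * N.conj^[r] (X e d) := by
  have h : ∀ k, N.conj^[k] B = ((-1 : ℂ) ^ (r : ℕ)) ^ k • B := fun k => by
    induction k with
    | zero => simp
    | succ k ih => rw [Function.iterate_succ_apply, hB, conj_iterate_smul, ih, smul_smul, pow_succ']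
  rw [base_gmul, gconj_iterate_apply, h, smul_mul_smul_comm, ← mul_pow, ← mul_pow]
  simp

theorem conj_base_gmul_qTuple {r : Fin 2} {B : Module.End ℂ M}
    (hB : N.conj B = (-1 : ℂ) ^ (r : ℕ) • B) (w : ℤ × ℤ) (e d : Fin 2) :
    N.conj (N.gmul (Gr.base B) (P.qTuple w) e d)
      = (-1 : ℂ) ^ ((r : ℕ) + e + d) • N.gmul (Gr.base B) (P.qTuple w) e d := by
  fin_cases e <;> fin_cases d <;>
    simp [base_gmul, AnnihilationRep.qTuple, hB, P.conj_proj, P.conj_H, P.conj_Q, pow_add]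

/-- For an equivariant section, the supertraces of the commutators with the residues cancel. -/
theorem sum_strLin_commutator (f : FormalSection V) (hf : f.IsEquivariant C.toAnnihilationRep)
    {r : Fin 2} {b : V} (hb : A.HasParity r b) (ρ : ℤ × ℤ) (I : Finset (ℤ × ℤ))
    (hI : ∀ w ∉ I, P.proj w = 0 ∨ ∀ k, f.g k (ρ - w).1 (ρ - w).2 = 0) (D n : ℤ) (e d : Fin 2) :
    ∑ w ∈ I, P.strLin (N.gmul (fun e d => N.smear f.outer (ρ - w) D e d * N.Y 0 n b
      - N.Y 0 n b * N.conj^[r] (N.smear f.inner (ρ - w) D e d)) (P.qTuple w) e d) = 0 := by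
  set B := N.Y 0 n b with hBdef
  have hB : N.conj B = (-1 : ℂ) ^ (r : ℕ) • B := by
    have hp : A.par b = (-1 : ℂ) ^ (r : ℕ) • b := hb
    rw [hBdef, N.conj_Y, hp, map_smul]
    simp
  obtain ⟨K, hK⟩ := f.inner_weightsIn C.toAnnihilationRep
  -- Equivariance replaces the translate of the inner expansion by the outer one, so covariance
  -- compares the two expansions of `f` on either side of `𝐪⁻¹`.
  have hM := P.sum_qTuple_smear hK ρ D I fun w hw => (hI w hw).imp id fun h m s e d => by
    rw [← hf]
    simp [FormalSection.inner, FormalSection.outer, h, -Prod.fst_sub, -Prod.snd_sub]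
  rw [← hf] at hM
  have e1 : ∀ w, P.strLin (N.gmul (fun e d => N.smear f.outer (ρ - w) D e d * B
      - B * N.conj^[r] (N.smear f.inner (ρ - w) D e d)) (P.qTuple w) e d)
      = P.strLin (N.gmul (N.gmul (N.smear f.outer (ρ - w) D) (Gr.base B)) (P.qTuple w) e d)
        - P.strLin (N.gmul (N.gmul (Gr.base B) (N.gconj^[r] (N.smear f.inner (ρ - w) D)))
          (P.qTuple w) e d) := fun w => by
    rw [← map_sub]
    congr 1
    have : (fun e d => N.smear f.outer (ρ - w) D e d * B
      - B * N.conj^[r] (N.smear f.inner (ρ - w) D e d)) =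
      N.gmul (N.smear f.outer (ρ - w) D) (Gr.base B)
        - N.gmul (Gr.base B) (N.gconj^[r] (N.smear f.inner (ρ - w) D)) := by
      funext e d
      simp only [Pi.sub_apply, gmul_base, base_gmul_gconj hB]
    rw [this]
    fin_cases e <;> fin_cases d <;> simp [SuperSpace.gmul] <;> noncomm_ring
  -- The residue is carried around the trace; passing `𝐪⁻¹` and the field of parity `r` conjugates
  -- it `r` times, the same conjugation that occurs in the second product.
  have e2 : ∀ w, P.strLin (N.gmul (N.gmul (N.smear f.outer (ρ - w) D) (Gr.base B))
      (P.qTuple w) e d) = P.strLin (N.gmul (Gr.base B) (N.gconj^[r]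
        (N.gmul (P.qTuple w) (N.smear f.outer (ρ - w) D))) e d) := fun w => by
    rw [SuperSpace.gmul_assoc, AnnihilationRep.strLin_gmul_comm r _
      (AnnihilationRep.gmul_mem (P.qTuple_mem w)) (P.conj_base_gmul_qTuple hB w),
      SuperSpace.gmul_assoc, gconj_iterate_gmul, gconj_iterate_qTuple]
  have e3 : ∀ w, N.gmul (N.gmul (Gr.base B) (N.gconj^[r] (N.smear f.inner (ρ - w) D)))
      (P.qTuple w) = N.gmul (Gr.base B) (N.gconj^[r]
        (N.gmul (N.smear f.inner (ρ - w) D) (P.qTuple w))) := fun w => by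
    rw [SuperSpace.gmul_assoc, gconj_iterate_gmul, gconj_iterate_qTuple]
  have e4 : ∀ X : ℤ × ℤ → Gr (Module.End ℂ M), ∑ w ∈ I, P.strLin (N.gmul (Gr.base B)
      (N.gconj^[r] (X w)) e d) = P.strLin (N.gmul (Gr.base B) (N.gconj^[r] (∑ w ∈ I, X w)) e d) :=
    fun X => by
      rw [gconj_iterate_sum, SuperSpace.gmul_sum, Finset.sum_apply, Finset.sum_apply, map_sum]
  simp only [e1, e2, e3, Finset.sum_sub_distrib]
  rw [e4, e4, hM, sub_self]

/-- The residues of an equivariant section against a homogeneous vector have vanishing trace. -/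
theorem annihilates_of_hasParity (f : FormalSection V) (hf : f.IsEquivariant C.toAnnihilationRep)
    (hc : f.CompatibleWith P.toAnnihilationRep) {r : Fin 2} {b : V} (hb : A.HasParity r b) :
    P.Annihilates (f.hAct A b) := by
  intro i j
  set ρ : ℤ × ℤ := (i, j) with hρ
  -- Positive energy bounds the weight below, the lower bound on powers of `q` in `f` bounds it
  -- above, and compatibility leaves finitely many charges for each weight.
  have hfin : {w : ℤ × ℤ | P.wt w ≠ ⊥ ∧ ∃ k, f.g k (ρ - w).1 (ρ - w).2 ≠ 0}.Finite := by
    obtain ⟨Bd, hBd⟩ := f.bounded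
    refine ((Set.finite_Icc 0 (i - Bd)).biUnion fun n _ =>
      ((hc (i - n) n j).image fun c => (n, c))).subset fun w hw => ?_
    obtain ⟨hw1, k, hk⟩ := hw
    have h0 : 0 ≤ w.1 := by
      by_contra hn
      exact hw1 (P.positive w (by omega))
    have h1 : w.1 ≤ i - Bd := by
      by_contra hn
      exact hk (hBd k _ _ (by simp only [hρ, Prod.fst_sub]; omega))
    simp only [Set.mem_iUnion]
    exact ⟨w.1, ⟨h0, h1⟩, w.2, ⟨hw1, k, hk⟩, rfl⟩
  set I := hfin.toFinset with hIdef
  have hI : ∀ w ∉ I, P.proj w = 0 ∨ ∀ k, f.g k (ρ - w).1 (ρ - w).2 = 0 := fun w hw => by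
    rw [hIdef, Set.Finite.mem_toFinset, Set.mem_ofPred_eq, not_and_or, not_not, not_exists] at hw
    exact hw.imp P.proj_eq_zero fun h k => not_not.1 (h k)
  have hterm : ∀ w e d, (Function.support fun n =>
        P.strLin (N.gmul (f.hOp N b (ρ - w) n) (P.qTuple w) e d)).Finite ∧
      P.phiTerm (f.hAct A b) i j (ρ - w) e d
        = ∑ᶠ n, P.strLin (N.gmul (f.hOp N b (ρ - w) n) (P.qTuple w) e d) := fun w e d => by
    have := P.phiTerm_eq (i := i) (j := j) (p := ρ - w) (Z := f.hOp N b (ρ - w))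
      (fun e d => f.traceEquiv_hOp P b (ρ - w) e d) e d
    rwa [show ((i, j) : ℤ × ℤ) - (ρ - w) = w from sub_sub_cancel _ _] at this
  have hzero : ∀ w ∉ I, P.phiTerm (f.hAct A b) i j (ρ - w) = 0 := fun w hw => by
    funext e d
    rw [(hterm w e d).2]
    refine finsum_eq_zero_of_forall_eq_zero fun n => ?_
    rcases hI w hw with h | h
    · rw [P.qTuple_eq_zero h]
      fin_cases e <;> fin_cases d <;> simp [SuperSpace.gmul]
    · have : f.hOp N b (ρ - w) n = 0 := by
        funext e d
        simp [FormalSection.hOp, h, SUSYModule.residueOne, -Prod.fst_sub, -Prod.snd_sub]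
      rw [this]
      fin_cases e <;> fin_cases d <;> simp [SuperSpace.gmul]
  have hsupp : (Function.support fun w => P.phiTerm (f.hAct A b) i j (ρ - w)) ⊆ I := fun w hw => by
    by_contra hn
    exact hw (hzero w hn)
  constructor
  · refine ((I.finite_toSet.image fun w => ρ - w)).subset fun p hp => ?_
    refine ⟨ρ - p, hsupp ?_, sub_sub_cancel _ _⟩
    simpa using hp
  · rw [← finsum_comp_equiv (Equiv.subLeft ρ)]
    simp only [Equiv.subLeft_apply]
    rw [finsum_eq_sum_of_support_subset _ hsupp]
    funext e d
    rw [Finset.sum_apply, Finset.sum_apply]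
    simp only [(hterm _ e d).2]
    -- The sum over `w` must be innermost, because the commutators cancel only after summing over
    -- `w`. It is therefore exchanged first with the sum over modes and then with the sum over
    -- degrees.
    rw [finsum_finset_comm _ _ fun w _ => (hterm w e d).1]
    refine finsum_eq_zero_of_forall_eq_zero fun n => ?_
    have hD : ∀ w, (Function.support fun D => P.strLin (N.gmul (fun e d =>
        N.smear f.outer (ρ - w) D e d * N.Y 0 (n - D) b
      - N.Y 0 (n - D) b * N.conj^[r] (N.smear f.inner (ρ - w) D e d)) (P.qTuple w) e d)).Finite ∧
        ∑ᶠ D, P.strLin (N.gmul (fun e d => N.smear f.outer (ρ - w) D e d * N.Y 0 (n - D) b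
      - N.Y 0 (n - D) b * N.conj^[r] (N.smear f.inner (ρ - w) D e d)) (P.qTuple w) e d)
      = P.strLin (N.gmul (f.hOp N b (ρ - w) n) (P.qTuple w) e d) := fun w =>
      P.strLin_gmul_hasPointwiseSum (fun e d => f.hasPointwiseSum_hOp hb (ρ - w) n e d) w e d
    simp only [← (hD _).2]
    rw [finsum_finset_comm _ _ fun w _ => (hD w).1]
    exact finsum_eq_zero_of_forall_eq_zero fun D => P.sum_strLin_commutator f hf hb ρ I hI D _ e d

theorem Annihilates.add {U U' : ℤ → ℤ → Gr V} (h : P.Annihilates U) (h' : P.Annihilates U') :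
    P.Annihilates (U + U') := fun i j => by
  have e : P.phiTerm (U + U') i j = fun p => P.phiTerm U i j p + P.phiTerm U' i j p := by
    funext p
    simp only [phiTerm, Pi.add_apply, (P.phi_isLinearMap _ _).map_add, map_add,
      Finset.sum_add_distrib]
  rw [e]
  exact ⟨((h i j).1.union (h' i j).1).subset (Function.support_add _ _), by
    rw [finsum_add_distrib (h i j).1 (h' i j).1, (h i j).2, (h' i j).2, add_zero]⟩

theorem annihilates_hAct (f : FormalSection V) (hf : f.IsEquivariant C.toAnnihilationRep)
    (hc : f.CompatibleWith P.toAnnihilationRep) (b : V) : P.Annihilates (f.hAct A b) := by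
  refine A.hasParity_induction (P := fun b => P.Annihilates (f.hAct A b))
    (fun u v hu hv => ?_) (fun r b hb => P.annihilates_of_hasParity f hf hc hb) b
  convert hu.add P hv using 1
  funext i j e d
  simp only [Pi.add_apply, FormalSection.hAct_eq, ← smul_add, ← Finset.sum_add_distrib]
  congr 1
  refine Finset.sum_congr rfl fun k _ => ?_
  have hs := fun g s u => SUSYModule.finite_support_coeffOne (A := A) g s (f.v k) u
    fun _ => LinearMap.id
  simp only [LinearMap.id_apply] at hs
  simp only [map_add, smul_add]
  rw [finsum_add_distrib (hs _ _ _) (hs _ _ _), finsum_add_distrib (hs _ _ _) (hs _ _ _)]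
  abel

end PositiveEnergy

end

/-! ## Laurent expansions with finitely many terms -/

section

theorem coeffZero_sum {ι : Type*} (s : Finset ι) (g : ι → RatFunc ℂ) (m : ℤ) :
    coeffZero (∑ k ∈ s, g k) m = ∑ k ∈ s, coeffZero (g k) m := by
  simp [coeffZero_eq, HahnSeries.coeff_sum]

theorem coeffInfty_sum {ι : Type*} (s : Finset ι) (g : ι → RatFunc ℂ) (m : ℤ) :
    coeffInfty (∑ k ∈ s, g k) m = ∑ k ∈ s, coeffInfty (g k) m := by
  simp [coeffInfty_eq, HahnSeries.coeff_sum]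

theorem coeffZero_X_zpow (n m : ℤ) : coeffZero (RatFunc.X ^ n) m = if m = n then 1 else 0 := by
  rw [coeffZero_eq, map_zpow₀, evalZero_X, single_zpow_int, one_mul, HahnSeries.coeff_single]
  congr

theorem coeffInfty_X_zpow (n m : ℤ) : coeffInfty (RatFunc.X ^ n) m = if m = n then 1 else 0 := by
  rw [coeffInfty_eq, map_zpow₀, evalInfty_X, single_zpow_int, neg_one_mul, HahnSeries.coeff_single]
  simp only [neg_inj]

/-- Expansion at `0` is injective, being a ring homomorphism out of a field. A finite expansion
therefore identifies `h` with a Laurent polynomial, whose expansion at infinity is the same. -/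
theorem coeffInfty_eq_coeffZero_of_finite {h : RatFunc ℂ}
    (hh : (Function.support (coeffZero h)).Finite) : coeffInfty h = coeffZero h := by
  have e : h = ∑ n ∈ hh.toFinset, RatFunc.C (coeffZero h n) * RatFunc.X ^ n := by
    refine evalZero.injective (HahnSeries.ext (funext fun m => ?_))
    rw [← coeffZero_eq, ← coeffZero_eq, coeffZero_sum]
    simp only [coeffZero_C_mul, coeffZero_X_zpow, mul_ite, mul_one, mul_zero,
      Finset.sum_ite_eq, Set.Finite.mem_toFinset, Function.mem_support]
    split_ifs with h0
    · rfl
    · exact not_not.mp h0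
  funext m
  rw [e, coeffInfty_sum, coeffZero_sum]
  simp only [coeffZero_C_mul, coeffInfty_C_mul, coeffZero_X_zpow, coeffInfty_X_zpow]

/-- A combination of rational functions with finitely many nonzero coefficients at `0` is a Laurent
polynomial, with the same expansion at infinity. -/
theorem sum_coeffInfty_smul_of_finite {ι V : Type*} [Fintype ι] [AddCommGroup V] [Module ℂ V]
    (g : ι → RatFunc ℂ) (v : ι → V)
    (h : (Function.support fun m => ∑ k, coeffZero (g k) m • v k).Finite) (m : ℤ) :
    ∑ k, coeffInfty (g k) m • v k = ∑ k, coeffZero (g k) m • v k := by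
  -- Linear functionals separate points; the vectors `v k` may be dependent, and each functional
  -- reduces the claim to a single rational function.
  rw [← sub_eq_zero, ← Module.forall_dual_apply_eq_zero_iff ℂ]
  intro φ
  have h0 : ∀ m, coeffZero (∑ k, RatFunc.C (φ (v k)) * g k) m
      = φ (∑ k, coeffZero (g k) m • v k) := fun m => by
    simp only [coeffZero_sum, coeffZero_C_mul, map_sum, map_smul, smul_eq_mul]
    exact Finset.sum_congr rfl fun k _ => mul_comm _ _
  have h1 : ∀ m, coeffInfty (∑ k, RatFunc.C (φ (v k)) * g k) m
      = φ (∑ k, coeffInfty (g k) m • v k) := fun m => by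
    simp only [coeffInfty_sum, coeffInfty_C_mul, map_sum, map_smul, smul_eq_mul]
    exact Finset.sum_congr rfl fun k _ => mul_comm _ _
  rw [map_sub, sub_eq_zero, ← h0, ← h1, coeffInfty_eq_coeffZero_of_finite]
  refine h.subset fun m hm => ?_
  rw [Function.mem_support, h0] at hm
  exact fun h => hm (by rw [show ∑ k, coeffZero (g k) m • v k = 0 from h, map_zero])

end

/-! ## The action of the generator on weight components -/

section

/-- Indices `(p, m, i, j, s, e, d)` of the component of weight `p` of the coefficient of
`x ^ m q ^ i y ^ j ε ^ e δ ^ d θ ^ s`. -/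
abbrev WeightIndex := (ℤ × ℤ) × ℤ × ℤ × ℤ × Fin 2 × Fin 2 × Fin 2

namespace WeightIndex

/-- The degree in `x, θ`. -/
def deg (x : WeightIndex) : ℤ := x.2.1 + (x.2.2.2.2.1 : ℕ)

/-- The conformal weight. -/
def weight (x : WeightIndex) : ℤ := x.1.1

/-- The total charge. -/
def charge (x : WeightIndex) : ℤ :=
  x.1.2 - (x.2.2.2.2.1 : ℕ) + (x.2.2.2.2.2.1 : ℕ) - (x.2.2.2.2.2.2 : ℕ)

/-- The power of `q`. -/
def qPow (x : WeightIndex) : ℤ := x.2.2.1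

end WeightIndex

open WeightIndex

variable {V : Type*} [AddCommGroup V] [Module ℂ V]

/-- Each value of `Φ F` depends on finitely many values of `F`, of the same degree, weight and
charge, and of a power of `q` shifted by `β` times the weight minus `α` times the degree. -/
def IsLocalOp (Φ : Module.End ℂ (WeightIndex → V)) (α β : ℤ) : Prop :=
  ∀ x, ∃ s : Finset WeightIndex,
    (∀ x' ∈ s, deg x' = deg x ∧ weight x' = weight x ∧ charge x' = charge x ∧
      qPow x' = qPow x - α * deg x + β * weight x) ∧
    ∀ F, (∀ x' ∈ s, F x' = 0) → Φ F x = 0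

namespace IsLocalOp

variable {Φ Ψ : Module.End ℂ (WeightIndex → V)} {α β α' β' : ℤ}

theorem one : IsLocalOp (1 : Module.End ℂ (WeightIndex → V)) 0 0 :=
  fun x => ⟨{x}, by simp, fun F h => h x (by simp)⟩

theorem mul (hΦ : IsLocalOp Φ α β) (hΨ : IsLocalOp Ψ α' β') :
    IsLocalOp (Φ * Ψ) (α + α') (β + β') := by
  classical
  intro x
  obtain ⟨s, hs, hs'⟩ := hΦ x
  choose t ht ht' using hΨ
  refine ⟨s.biUnion t, fun y hy => ?_, fun F hF => hs' _ fun x' hx' => ht' _ _ fun y hy =>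
    hF y (Finset.mem_biUnion.mpr ⟨x', hx', hy⟩)⟩
  obtain ⟨x', hx', hy⟩ := Finset.mem_biUnion.mp hy
  obtain ⟨h1, h2, h3, h4⟩ := hs x' hx'
  obtain ⟨k1, k2, k3, k4⟩ := ht x' y hy
  refine ⟨k1.trans h1, k2.trans h2, k3.trans h3, ?_⟩
  rw [k4, h4, h1, h2]
  ring

theorem pow (hΦ : IsLocalOp Φ α β) (k : ℕ) : IsLocalOp (Φ ^ k) (k * α) (k * β) := by
  induction k with
  | zero => simpa using one
  | succ k ih =>
    rw [pow_succ']
    convert hΦ.mul ih using 1 <;> push_cast <;> ring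

theorem add (hΦ : IsLocalOp Φ α β) (hΨ : IsLocalOp Ψ α β) : IsLocalOp (Φ + Ψ) α β := by
  classical
  intro x
  obtain ⟨s, hs, hs'⟩ := hΦ x
  obtain ⟨t, ht, ht'⟩ := hΨ x
  refine ⟨s ∪ t, fun y hy => (Finset.mem_union.mp hy).elim (hs y) (ht y), fun F hF => ?_⟩
  rw [LinearMap.add_apply, Pi.add_apply, hs' F fun y hy => hF y (Finset.mem_union_left _ hy),
    ht' F fun y hy => hF y (Finset.mem_union_right _ hy), add_zero]

theorem neg (hΦ : IsLocalOp Φ α β) : IsLocalOp (-Φ) α β := fun x =>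
  (hΦ x).imp fun s hs => ⟨hs.1, fun F hF => by
    rw [LinearMap.neg_apply, Pi.neg_apply, hs.2 F hF, neg_zero]⟩

theorem sub (hΦ : IsLocalOp Φ α β) (hΨ : IsLocalOp Ψ α β) : IsLocalOp (Φ - Ψ) α β :=
  sub_eq_add_neg Φ Ψ ▸ hΦ.add hΨ.neg

theorem exists_ne_zero (hΦ : IsLocalOp Φ α β) {F : WeightIndex → V} {x : WeightIndex}
    (h : Φ F x ≠ 0) : ∃ x', F x' ≠ 0 ∧ deg x' = deg x ∧ weight x' = weight x ∧ charge x' = charge x ∧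
      qPow x' = qPow x - α * deg x + β * weight x := by
  obtain ⟨s, hs, hs'⟩ := hΦ x
  by_contra! hn
  refine h (hs' F fun x' hx' => ?_)
  by_contra h0
  obtain ⟨h1, h2, h3, h4⟩ := hs x' hx'
  exact hn x' h0 h1 h2 h3 h4

/-- A local operator commutes with pointwise finite sums. -/
theorem finsum (hΦ : IsLocalOp Φ α β) {ι : Type*} {F : ι → WeightIndex → V} {G : WeightIndex → V}
    (hF : ∀ x, (Function.support fun n => F n x).Finite) (hG : ∀ x, G x = ∑ᶠ n, F n x)
    (x : WeightIndex) :
    (Function.support fun n => Φ (F n) x).Finite ∧ Φ G x = ∑ᶠ n, Φ (F n) x := by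
  classical
  obtain ⟨s, -, hs⟩ := hΦ x
  -- All members of the family that are visible to `Φ` at `x`: outside `t` they vanish on the whole
  -- dependence set `s`, so only a finite sum remains.
  set t := s.biUnion fun x' => (hF x').toFinset with ht
  have hn : ∀ n ∉ t, ∀ x' ∈ s, F n x' = 0 := fun n hn x' hx' => by
    by_contra h0
    exact hn (Finset.mem_biUnion.mpr ⟨x', hx', (hF x').mem_toFinset.mpr h0⟩)
  have hsub : (Function.support fun n => Φ (F n) x) ⊆ t := fun n h => by
    by_contra h0
    exact h (hs _ (hn n h0))
  refine ⟨t.finite_toSet.subset hsub, ?_⟩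
  rw [finsum_eq_sum_of_support_subset _ hsub, ← sub_eq_zero, ← Finset.sum_apply, ← map_sum,
    ← Pi.sub_apply, ← map_sub]
  refine hs _ fun x' hx' => ?_
  rw [Pi.sub_apply, Finset.sum_apply, hG, sub_eq_zero]
  refine finsum_eq_sum_of_support_subset _ fun n h => ?_
  by_contra h0
  exact h (hn n h0 x' hx')

end IsLocalOp

/-- The operator whose value at `x` is `k x` times `T` of the value at `σ x`. -/
def weightedComp (k : WeightIndex → ℂ) (T : Module.End ℂ V) (σ : WeightIndex → WeightIndex) :
    Module.End ℂ (WeightIndex → V) where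
  toFun F x := k x • T (F (σ x))
  map_add' F G := by funext x; simp
  map_smul' c F := by funext x; simp [smul_comm c]

theorem isLocalOp_weightedComp {k : WeightIndex → ℂ} {T : Module.End ℂ V}
    {σ : WeightIndex → WeightIndex} {α β : ℤ}
    (h : ∀ x, k x ≠ 0 → deg (σ x) = deg x ∧ weight (σ x) = weight x ∧ charge (σ x) = charge x ∧
      qPow (σ x) = qPow x - α * deg x + β * weight x) : IsLocalOp (weightedComp k T σ) α β := by
  intro x
  by_cases hk : k x = 0
  · exact ⟨∅, by simp, fun F _ => by simp [weightedComp, hk]⟩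
  · exact ⟨{σ x}, by simpa using h x hk, fun F hF => by simp [weightedComp, hF]⟩

namespace AnnihilationRep

variable {S : SuperSpace V} (R : AnnihilationRep S)

/-- `ε H₀` on weight components. -/
def wtEpsH : Module.End ℂ (WeightIndex → V) :=
  weightedComp (fun x => if x.2.2.2.2.2.1 = 1 then
      (-1) ^ ((x.2.2.2.2.1 : ℕ) + (x.2.2.2.2.2.2 : ℕ)) else 0) (R.H 0)
    fun x => ((x.1.1, x.1.2 + 1), x.2.1, x.2.2.1, x.2.2.2.1, x.2.2.2.2.1, 0, x.2.2.2.2.2.2)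

/-- `δ Q₀` on weight components. -/
def wtDelQ : Module.End ℂ (WeightIndex → V) :=
  weightedComp (fun x => if x.2.2.2.2.2.2 = 1 then (-1) ^ (x.2.2.2.2.1 : ℕ) else 0) (R.Q 0)
    fun x => ((x.1.1, x.1.2 - 1), x.2.1, x.2.2.1, x.2.2.2.1, x.2.2.2.2.1, x.2.2.2.2.2.1, 0)

end AnnihilationRep

variable (V)

/-- `ε θ ∂_x` on weight components. -/
def wtEpsThetaDx : Module.End ℂ (WeightIndex → V) :=
  weightedComp (fun x => if x.2.2.2.2.1 = 1 ∧ x.2.2.2.2.2.1 = 1 then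
      (-1) ^ (x.2.2.2.2.2.2 : ℕ) * ((x.2.1 : ℂ) + 1) else 0) 1
    fun x => (x.1, x.2.1 + 1, x.2.2.1, x.2.2.2.1, 0, 0, x.2.2.2.2.2.2)

/-- `δ x ∂_θ` on weight components. -/
def wtDelXDtheta : Module.End ℂ (WeightIndex → V) :=
  weightedComp (fun x => if x.2.2.2.2.1 = 0 ∧ x.2.2.2.2.2.2 = 1 then 1 else 0) 1
    fun x => (x.1, x.2.1 - 1, x.2.2.1, x.2.2.2.1, 1, x.2.2.2.2.2.1, 0)

/-- `y ^ (c θ ∂_θ) q ^ (c (x ∂_x + θ ∂_θ))` on weight components. -/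
def wtScale (c : ℤ) : Module.End ℂ (WeightIndex → V) :=
  weightedComp 1 1 fun x => (x.1, x.2.1, x.2.2.1 - c * (x.2.1 + (x.2.2.2.2.1 : ℕ)),
    x.2.2.2.1 - c * (x.2.2.2.2.1 : ℕ), x.2.2.2.2)

/-- `y ^ (-c J₀) q ^ (-c L₀)` on weight components. -/
def wtScaleVal (c : ℤ) : Module.End ℂ (WeightIndex → V) :=
  weightedComp 1 1 fun x => (x.1, x.2.1, x.2.2.1 + c * x.1.1, x.2.2.2.1 + c * x.1.2, x.2.2.2.2)

/-- `y ^ c` on weight components. -/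
def wtMulY (c : ℤ) : Module.End ℂ (WeightIndex → V) :=
  weightedComp 1 1 fun x => (x.1, x.2.1, x.2.2.1, x.2.2.2.1 - c, x.2.2.2.2)

variable {V}

namespace AnnihilationRep

variable {S : SuperSpace V} (R : AnnihilationRep S)

/-- The action of the generator on weight components. -/
def wtAct : Module.End ℂ (WeightIndex → V) :=
  wtMulY V (-1) * ((1 + R.wtEpsH) * wtScaleVal V 1 * (1 - R.wtDelQ) *
    ((1 + wtEpsThetaDx V) * wtScale V 1 * (1 + wtDelXDtheta V)))

/-- The action of the inverse of the generator on weight components. -/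
def wtActInv : Module.End ℂ (WeightIndex → V) :=
  wtMulY V 1 * ((1 + R.wtDelQ) * wtScaleVal V (-1) * (1 - R.wtEpsH) *
    ((1 - wtDelXDtheta V) * wtScale V (-1) * (1 - wtEpsThetaDx V)))

theorem isLocalOp_wtEpsH : IsLocalOp R.wtEpsH 0 0 := by
  refine isLocalOp_weightedComp ?_
  rintro ⟨p, m, i, j, s, e, d⟩ hx
  have : e = 1 := by by_contra h; simp [h] at hx
  subst this
  simp [deg, weight, charge, qPow]
  ring

theorem isLocalOp_wtDelQ : IsLocalOp R.wtDelQ 0 0 := by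
  refine isLocalOp_weightedComp ?_
  rintro ⟨p, m, i, j, s, e, d⟩ hx
  have : d = 1 := by by_contra h; simp [h] at hx
  subst this
  simp [deg, weight, charge, qPow]
  ring

theorem _root_.isLocalOp_wtEpsThetaDx : IsLocalOp (wtEpsThetaDx V) 0 0 := by
  refine isLocalOp_weightedComp ?_
  rintro ⟨p, m, i, j, s, e, d⟩ hx
  have : s = 1 ∧ e = 1 := by by_contra h; simp [h] at hx
  obtain ⟨rfl, rfl⟩ := this
  simp [deg, weight, charge, qPow]

theorem _root_.isLocalOp_wtDelXDtheta : IsLocalOp (wtDelXDtheta V) 0 0 := by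
  refine isLocalOp_weightedComp ?_
  rintro ⟨p, m, i, j, s, e, d⟩ hx
  have : s = 0 ∧ d = 1 := by by_contra h; simp [h] at hx
  obtain ⟨rfl, rfl⟩ := this
  simp [deg, weight, charge, qPow]
  ring

theorem _root_.isLocalOp_wtScale (c : ℤ) : IsLocalOp (wtScale V c) c 0 :=
  isLocalOp_weightedComp fun x _ => by simp [deg, weight, charge, qPow]

theorem _root_.isLocalOp_wtScaleVal (c : ℤ) : IsLocalOp (wtScaleVal V c) 0 c :=
  isLocalOp_weightedComp fun x _ => by simp [deg, weight, charge, qPow]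

theorem _root_.isLocalOp_wtMulY (c : ℤ) : IsLocalOp (wtMulY V c) 0 0 :=
  isLocalOp_weightedComp fun x _ => by simp [deg, weight, charge, qPow]

theorem isLocalOp_wtAct : IsLocalOp R.wtAct 1 1 :=
  (isLocalOp_wtMulY (-1)).mul ((((IsLocalOp.one.add R.isLocalOp_wtEpsH).mul
    (isLocalOp_wtScaleVal 1)).mul (IsLocalOp.one.sub R.isLocalOp_wtDelQ)).mul
    (((IsLocalOp.one.add isLocalOp_wtEpsThetaDx).mul (isLocalOp_wtScale 1)).mul
      (IsLocalOp.one.add isLocalOp_wtDelXDtheta)))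

theorem isLocalOp_wtActInv : IsLocalOp R.wtActInv (-1) (-1) :=
  (isLocalOp_wtMulY 1).mul ((((IsLocalOp.one.add R.isLocalOp_wtDelQ).mul
    (isLocalOp_wtScaleVal (-1))).mul (IsLocalOp.one.sub R.isLocalOp_wtEpsH)).mul
    (((IsLocalOp.one.sub isLocalOp_wtDelXDtheta).mul (isLocalOp_wtScale (-1))).mul
      (IsLocalOp.one.sub isLocalOp_wtEpsThetaDx)))

theorem wtEpsH_mul_self : R.wtEpsH * R.wtEpsH = 0 := by
  ext F x
  simp [wtEpsH, weightedComp]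

theorem wtDelQ_mul_self : R.wtDelQ * R.wtDelQ = 0 := by
  ext F x
  simp [wtDelQ, weightedComp]

theorem _root_.wtEpsThetaDx_mul_self : wtEpsThetaDx V * wtEpsThetaDx V = 0 := by
  ext F x
  simp [wtEpsThetaDx, weightedComp]

theorem _root_.wtDelXDtheta_mul_self : wtDelXDtheta V * wtDelXDtheta V = 0 := by
  ext F x
  simp [wtDelXDtheta, weightedComp]

theorem _root_.wtScale_mul_neg : wtScale V 1 * wtScale V (-1) = 1 := by
  ext F x
  simp [wtScale, weightedComp]
  ring_nf

theorem _root_.wtScaleVal_mul_neg : wtScaleVal V 1 * wtScaleVal V (-1) = 1 := by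
  ext F x
  simp [wtScaleVal, weightedComp]

theorem _root_.wtMulY_mul_neg : wtMulY V (-1) * wtMulY V 1 = 1 := by
  ext F x
  simp [wtMulY, weightedComp]

theorem commute_wtEpsH_wtEpsThetaDx : Commute R.wtEpsH (wtEpsThetaDx V) := by
  ext F ⟨p, m, i, j, s, e, d⟩
  simp [wtEpsH, wtEpsThetaDx, weightedComp]

theorem commute_wtEpsH_wtDelXDtheta : Commute R.wtEpsH (wtDelXDtheta V) := by
  ext F ⟨p, m, i, j, s, e, d⟩
  fin_cases s <;> fin_cases e <;> fin_cases d <;> simp [wtEpsH, wtDelXDtheta, weightedComp]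

theorem commute_wtDelQ_wtEpsThetaDx : Commute R.wtDelQ (wtEpsThetaDx V) := by
  ext F ⟨p, m, i, j, s, e, d⟩
  fin_cases s <;> fin_cases e <;> fin_cases d <;> simp [wtDelQ, wtEpsThetaDx, weightedComp]
  module

theorem commute_wtDelQ_wtDelXDtheta : Commute R.wtDelQ (wtDelXDtheta V) := by
  ext F ⟨p, m, i, j, s, e, d⟩
  simp [wtDelQ, wtDelXDtheta, weightedComp]

theorem commute_wtEpsH_wtScale (c : ℤ) : Commute R.wtEpsH (wtScale V c) := by
  ext F x
  simp [wtEpsH, wtScale, weightedComp]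

theorem commute_wtDelQ_wtScale (c : ℤ) : Commute R.wtDelQ (wtScale V c) := by
  ext F x
  simp [wtDelQ, wtScale, weightedComp]

theorem _root_.commute_wtScaleVal_wtScale (c c' : ℤ) :
    Commute (wtScaleVal V c) (wtScale V c') := by
  ext F x
  simp [wtScaleVal, wtScale, weightedComp]
  ring_nf

theorem _root_.commute_wtScaleVal_wtEpsThetaDx (c : ℤ) :
    Commute (wtScaleVal V c) (wtEpsThetaDx V) := by
  ext F x
  simp [wtScaleVal, wtEpsThetaDx, weightedComp]

theorem _root_.commute_wtScaleVal_wtDelXDtheta (c : ℤ) :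
    Commute (wtScaleVal V c) (wtDelXDtheta V) := by
  ext F x
  simp [wtScaleVal, wtDelXDtheta, weightedComp]

theorem wtEpsH_comm_mulY (c : ℤ) : Commute R.wtEpsH (wtMulY V c) := by
  ext F x
  simp [wtEpsH, wtMulY, weightedComp]

theorem wtDelQ_comm_mulY (c : ℤ) : Commute R.wtDelQ (wtMulY V c) := by
  ext F x
  simp [wtDelQ, wtMulY, weightedComp]

theorem _root_.commute_wtScaleVal_wtMulY (c c' : ℤ) :
    Commute (wtScaleVal V c) (wtMulY V c') := by
  ext F x
  simp [wtScaleVal, wtMulY, weightedComp]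
  ring_nf

theorem _root_.commute_wtScale_wtMulY (c c' : ℤ) :
    Commute (wtScale V c) (wtMulY V c') := by
  ext F x
  simp [wtScale, wtMulY, weightedComp]
  ring_nf

theorem _root_.commute_wtEpsThetaDx_wtMulY (c : ℤ) :
    Commute (wtEpsThetaDx V) (wtMulY V c) := by
  ext F x
  simp [wtEpsThetaDx, wtMulY, weightedComp]

theorem _root_.commute_wtDelXDtheta_wtMulY (c : ℤ) :
    Commute (wtDelXDtheta V) (wtMulY V c) := by
  ext F x
  simp [wtDelXDtheta, wtMulY, weightedComp]

end AnnihilationRep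

end

/-! ### Invertibility of the generator, and passage to weight components. -/

section

open WeightIndex

variable {V : Type*} [AddCommGroup V] [Module ℂ V] {S : SuperSpace V}

namespace AnnihilationRep

variable (R : AnnihilationRep S)

/-- The action on values `X` and the action on coordinates `Z` have inverses `X'` and `Z'` by
cancelling unipotent and scaling factors. Since `X'` commutes with `Z`, and powers of `y` commute
with everything involved, the order of the factors does not matter. -/
theorem wtAct_mul_wtActInv : R.wtAct * R.wtActInv = 1 := by
  set X := (1 + R.wtEpsH) * wtScaleVal V 1 * (1 - R.wtDelQ) with hX
  set Z := (1 + wtEpsThetaDx V) * wtScale V 1 * (1 + wtDelXDtheta V) with hZ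
  set X' := (1 + R.wtDelQ) * wtScaleVal V (-1) * (1 - R.wtEpsH) with hX'
  set Z' := (1 - wtDelXDtheta V) * wtScale V (-1) * (1 - wtEpsThetaDx V) with hZ'
  have hone : ∀ T : Module.End ℂ (WeightIndex → V), Commute 1 T := Commute.one_left
  have hcX : Commute (X * Z) (wtMulY V 1) :=
    ((((hone _).add_left (R.wtEpsH_comm_mulY 1)).mul_left
      (commute_wtScaleVal_wtMulY 1 1)).mul_left
        ((hone _).sub_left (R.wtDelQ_comm_mulY 1))).mul_left
    ((((hone _).add_left (commute_wtEpsThetaDx_wtMulY 1)).mul_left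
      (commute_wtScale_wtMulY 1 1)).mul_left
        ((hone _).add_left (commute_wtDelXDtheta_wtMulY 1)))
  have h1 : ∀ {T : Module.End ℂ (WeightIndex → V)}, Commute R.wtEpsH T → Commute R.wtDelQ T →
      Commute (wtScaleVal V (-1)) T → Commute X' T := fun a b c =>
    (((hone _).add_left b).mul_left c).mul_left ((hone _).sub_left a)
  have hc : Commute X' Z :=
    (((Commute.one_right _).add_right (h1 R.commute_wtEpsH_wtEpsThetaDx
      R.commute_wtDelQ_wtEpsThetaDx (commute_wtScaleVal_wtEpsThetaDx _))).mul_right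
      (h1 (R.commute_wtEpsH_wtScale 1) (R.commute_wtDelQ_wtScale 1)
        (commute_wtScaleVal_wtScale _ _))).mul_right
      ((Commute.one_right _).add_right (h1 R.commute_wtEpsH_wtDelXDtheta
      R.commute_wtDelQ_wtDelXDtheta (commute_wtScaleVal_wtDelXDtheta _)))
  have hXX : X * X' = 1 := by
    have e1 : (1 - R.wtDelQ) * (1 + R.wtDelQ) = 1 := by
      rw [sub_mul, mul_add, mul_add, wtDelQ_mul_self]; simp
    have e2 : (1 + R.wtEpsH) * (1 - R.wtEpsH) = 1 := by
      rw [add_mul, mul_sub, mul_sub, wtEpsH_mul_self]; simp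
    calc X * X' = (1 + R.wtEpsH) * (wtScaleVal V 1 * ((1 - R.wtDelQ) * (1 + R.wtDelQ)) *
          wtScaleVal V (-1)) * (1 - R.wtEpsH) := by simp only [hX, hX', mul_assoc]
      _ = 1 := by rw [e1, mul_one, wtScaleVal_mul_neg, mul_one, e2]
  have hZZ : Z * Z' = 1 := by
    have e1 : (1 + wtDelXDtheta V) * (1 - wtDelXDtheta V) = 1 := by
      rw [add_mul, mul_sub, mul_sub, wtDelXDtheta_mul_self]; simp
    have e2 : (1 + wtEpsThetaDx V) * (1 - wtEpsThetaDx V) = 1 := by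
      rw [add_mul, mul_sub, mul_sub, wtEpsThetaDx_mul_self]; simp
    calc Z * Z' = (1 + wtEpsThetaDx V) * (wtScale V 1 * ((1 + wtDelXDtheta V) *
          (1 - wtDelXDtheta V)) * wtScale V (-1)) * (1 - wtEpsThetaDx V) := by
          simp only [hZ, hZ', mul_assoc]
      _ = 1 := by rw [e1, mul_one, wtScale_mul_neg, mul_one, e2]
  calc R.wtAct * R.wtActInv = wtMulY V (-1) * (X * Z * wtMulY V 1) * (X' * Z') := by
        simp only [wtAct, wtActInv, ← hX, ← hZ, ← hX', ← hZ', mul_assoc]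
    _ = wtMulY V (-1) * wtMulY V 1 * (X * (Z * X') * Z') := by
        rw [hcX.eq]; simp only [mul_assoc]
    _ = 1 := by
        rw [wtMulY_mul_neg, one_mul, ← hc.eq, ← mul_assoc X, hXX, one_mul, hZZ]

end AnnihilationRep

namespace Distr

/-- The weight components of a distribution. -/
noncomputable def wtComp (R : AnnihilationRep S) (F : Distr V) : WeightIndex → V :=
  fun x => R.proj x.1 (F x.2.1 x.2.2.1 x.2.2.2.1 x.2.2.2.2.1 x.2.2.2.2.2.1 x.2.2.2.2.2.2)

variable {R : AnnihilationRep S} {F G : Distr V} {P : Finset (ℤ × ℤ)}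

theorem wtComp_injective (h : wtComp R F = wtComp R G) : F = G := by
  funext m i j s e d
  rw [← R.finsum_proj (F m i j s e d), ← R.finsum_proj (G m i j s e d)]
  exact finsum_congr fun p => congrFun h (p, m, i, j, s, e, d)

theorem wtComp_add : wtComp R (F + G) = wtComp R F + wtComp R G :=
  funext fun _ => map_add _ _ _

theorem wtComp_sub : wtComp R (F - G) = wtComp R F - wtComp R G :=
  funext fun _ => map_sub _ _ _

theorem wtComp_scale (c : ℤ) : wtComp R (scale c F) = wtScale V c (wtComp R F) := by
  funext x
  simp [wtComp, wtScale, weightedComp, scale]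

theorem wtComp_mulY (c : ℤ) : wtComp R (mulY c F) = wtMulY V c (wtComp R F) := by
  funext x
  simp [wtComp, wtMulY, weightedComp, mulY]

theorem wtComp_eps_thetaDx : wtComp R (eps (thetaDx F)) = wtEpsThetaDx V (wtComp R F) := by
  funext ⟨p, m, i, j, s, e, d⟩
  fin_cases s <;> fin_cases e <;>
    simp [wtComp, wtEpsThetaDx, weightedComp, eps, thetaDx, Gr.eps]

theorem wtComp_del_xDtheta : wtComp R (del (xDtheta F)) = wtDelXDtheta V (wtComp R F) := by
  funext ⟨p, m, i, j, s, e, d⟩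
  fin_cases s <;> fin_cases e <;> fin_cases d <;>
    simp [wtComp, wtDelXDtheta, weightedComp, del, xDtheta, Gr.del]

theorem wtComp_eps_odd_H : wtComp R (eps (odd (R.H 0) F)) = R.wtEpsH (wtComp R F) := by
  funext ⟨p, m, i, j, s, e, d⟩
  have h : ∀ x, R.proj p (R.H 0 x) = R.H 0 (R.proj (p.1, p.2 + 1) x) := fun x => by
    rw [← R.proj_H]; simp
  fin_cases s <;> fin_cases e <;> fin_cases d <;>
    simp [wtComp, AnnihilationRep.wtEpsH, weightedComp, eps, odd, Gr.eps, Gr.odd, h]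

theorem wtComp_del_odd_Q : wtComp R (del (odd (R.Q 0) F)) = R.wtDelQ (wtComp R F) := by
  funext ⟨p, m, i, j, s, e, d⟩
  have h : ∀ x, R.proj p (R.Q 0 x) = R.Q 0 (R.proj (p.1, p.2 - 1) x) := fun x => by
    rw [← R.proj_Q]; simp
  fin_cases s <;> fin_cases e <;> fin_cases d <;>
    simp [wtComp, AnnihilationRep.wtDelQ, weightedComp, del, odd, Gr.del, Gr.odd, h]

/-- Finiteness of the weights guards against the junk value of an infinite `finsum` in `scaleVal`.
On weight components the operator is defined without any such condition. -/
theorem WeightsIn.wtComp_scaleVal (h : F.WeightsIn R P) (c : ℤ) :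
    wtComp R (scaleVal R c F) = wtScaleVal V c (wtComp R F) := by
  funext ⟨p, m, i, j, s, e, d⟩
  simp only [wtComp, h.scaleVal_apply, map_sum, R.proj_proj, wtScaleVal, weightedComp,
    LinearMap.coe_mk, AddHom.coe_mk, Pi.one_apply, one_smul, Module.End.one_apply,
    Finset.sum_ite_eq']
  split_ifs with hp
  · rfl
  · exact (h _ _ _ _ _ _ p hp).symm

theorem WeightsIn.of_isLocalOp (h : F.WeightsIn R P) {Φ : Module.End ℂ (WeightIndex → V)} {α β : ℤ}
    (hΦ : IsLocalOp Φ α β) (hG : wtComp R G = Φ (wtComp R F)) : ∃ P', G.WeightsIn R P' := by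
  -- Weight and total charge are conserved, so the charge of the value can change only through the
  -- exponents of `θ`, `ε`, `δ`: three changes of at most one each.
  refine ⟨P ×ˢ Finset.Icc (-3) 3 |>.image fun z => (z.1.1, z.1.2 + z.2),
    fun m i j s e d p hp => ?_⟩
  by_contra h0
  have h1 : Φ (wtComp R F) (p, m, i, j, s, e, d) ≠ 0 := by rwa [← hG]
  obtain ⟨⟨p', m', i', j', s', e', d'⟩, hx', -, hw, hc, -⟩ := hΦ.exists_ne_zero h1
  have hp' : p' ∈ P := by
    by_contra hn
    exact hx' (h _ _ _ _ _ _ p' hn)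
  refine hp (Finset.mem_image.mpr ⟨(p', p.2 - p'.2), Finset.mem_product.mpr ⟨hp', ?_⟩, ?_⟩)
  · simp only [charge] at hc
    rw [Finset.mem_Icc]
    omega
  · simp only [weight] at hw
    ext <;> simp [hw]

theorem wtComp_pullback : wtComp R (pullback F) = ((1 + wtEpsThetaDx V) * wtScale V 1 *
    (1 + wtDelXDtheta V)) (wtComp R F) := by
  simp [pullback, wtComp_add, wtComp_scale, wtComp_eps_thetaDx, wtComp_del_xDtheta]

theorem wtComp_pullbackInv : wtComp R (pullbackInv F) = ((1 - wtDelXDtheta V) * wtScale V (-1) *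
    (1 - wtEpsThetaDx V)) (wtComp R F) := by
  simp [pullbackInv, wtComp_sub, wtComp_scale, wtComp_eps_thetaDx, wtComp_del_xDtheta]

theorem WeightsIn.wtComp_actVal (h : F.WeightsIn R P) : wtComp R (actVal R F) =
    ((1 + R.wtEpsH) * wtScaleVal V 1 * (1 - R.wtDelQ)) (wtComp R F) := by
  obtain ⟨P', h'⟩ := h.of_isLocalOp (G := F - del (odd (R.Q 0) F))
    (IsLocalOp.one.sub R.isLocalOp_wtDelQ) (by simp [wtComp_sub, wtComp_del_odd_Q])
  simp [actVal, wtComp_add, wtComp_sub, wtComp_eps_odd_H, h'.wtComp_scaleVal, wtComp_del_odd_Q]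

theorem WeightsIn.wtComp_actValInv (h : F.WeightsIn R P) : wtComp R (actValInv R F) =
    ((1 + R.wtDelQ) * wtScaleVal V (-1) * (1 - R.wtEpsH)) (wtComp R F) := by
  obtain ⟨P', h'⟩ := h.of_isLocalOp (G := F - eps (odd (R.H 0) F))
    (IsLocalOp.one.sub R.isLocalOp_wtEpsH) (by simp [wtComp_sub, wtComp_eps_odd_H])
  simp [actValInv, wtComp_add, wtComp_sub, wtComp_eps_odd_H, h'.wtComp_scaleVal, wtComp_del_odd_Q]

theorem WeightsIn.wtComp_act (h : F.WeightsIn R P) :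
    wtComp R (act R F) = R.wtAct (wtComp R F) := by
  obtain ⟨P', h'⟩ := h.of_isLocalOp (((IsLocalOp.one.add isLocalOp_wtEpsThetaDx).mul
    (isLocalOp_wtScale 1)).mul (IsLocalOp.one.add isLocalOp_wtDelXDtheta)) wtComp_pullback
  rw [act, wtComp_mulY, h'.wtComp_actVal, wtComp_pullback]
  rfl

theorem WeightsIn.wtComp_actInv (h : F.WeightsIn R P) :
    wtComp R (actInv R F) = R.wtActInv (wtComp R F) := by
  obtain ⟨P', h'⟩ := h.of_isLocalOp (((IsLocalOp.one.sub isLocalOp_wtDelXDtheta).mul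
    (isLocalOp_wtScale (-1))).mul (IsLocalOp.one.sub isLocalOp_wtEpsThetaDx)) wtComp_pullbackInv
  rw [actInv, wtComp_mulY, h'.wtComp_actValInv, wtComp_pullbackInv]
  rfl

theorem WeightsIn.act_iterate (h : F.WeightsIn R P) (k : ℕ) :
    (∃ P', ((act R)^[k] F).WeightsIn R P') ∧
      wtComp R ((act R)^[k] F) = (R.wtAct ^ k) (wtComp R F) := by
  induction k with
  | zero => exact ⟨⟨P, h⟩, rfl⟩
  | succ k ih =>
    obtain ⟨⟨P', h'⟩, e⟩ := ih
    rw [Function.iterate_succ_apply', h'.wtComp_act, e, pow_succ']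
    exact ⟨h'.of_isLocalOp R.isLocalOp_wtAct h'.wtComp_act, rfl⟩

theorem WeightsIn.actInv_iterate (h : F.WeightsIn R P) (k : ℕ) :
    (∃ P', ((actInv R)^[k] F).WeightsIn R P') ∧
      wtComp R ((actInv R)^[k] F) = (R.wtActInv ^ k) (wtComp R F) := by
  induction k with
  | zero => exact ⟨⟨P, h⟩, rfl⟩
  | succ k ih =>
    obtain ⟨⟨P', h'⟩, e⟩ := ih
    rw [Function.iterate_succ_apply', h'.wtComp_actInv, e, pow_succ']
    exact ⟨h'.of_isLocalOp R.isLocalOp_wtActInv h'.wtComp_actInv, rfl⟩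

end Distr

/-! ## Orbit sums -/

namespace FormalSection

open Distr

variable (R : AnnihilationRep S) (a f : FormalSection V)

theorem outer_weightsIn : ∃ P, a.outer.WeightsIn R P := by
  classical
  refine ⟨Finset.univ.biUnion fun k => (R.proj_support_finite (a.v k)).toFinset,
    fun m i j s e d p hp => ?_⟩
  simp only [Finset.mem_biUnion, Finset.mem_univ, true_and, Set.Finite.mem_toFinset,
    Function.mem_support, not_exists, not_not] at hp
  simp [outer, hp]

theorem wtComp_translate_ofNat (k : ℕ) :
    wtComp R (a.translate R k) = (R.wtAct ^ k) (wtComp R a.inner) := by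
  obtain ⟨P, hP⟩ := inner_weightsIn R a
  exact (hP.act_iterate k).2

theorem wtComp_translate_negSucc (k : ℕ) :
    wtComp R (a.translate R (Int.negSucc k)) = (R.wtActInv ^ (k + 1)) (wtComp R a.outer) := by
  obtain ⟨P, hP⟩ := outer_weightsIn R a
  exact (hP.actInv_iterate (k + 1)).2

/-- The generator moves each translate to the next. At `n = -1` it returns the outer expansion of
`a`, whereas the translate with index `0` is the inner one; this jump is the contribution of the
pole crossing the annulus. -/
theorem wtAct_wtComp_translate (n : ℤ) : R.wtAct (wtComp R (a.translate R n)) =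
    wtComp R (a.translate R (n + 1)) +
      if n = -1 then wtComp R a.outer - wtComp R a.inner else 0 := by
  have hinv : ∀ F, R.wtAct (R.wtActInv F) = F := fun F => by
    rw [← Module.End.mul_apply, R.wtAct_mul_wtActInv, Module.End.one_apply]
  rcases n with k | k
  · rw [if_neg (by simp), add_zero, Int.ofNat_eq_natCast, wtComp_translate_ofNat,
      show (k : ℤ) + 1 = ((k + 1 : ℕ) : ℤ) by push_cast; rfl, wtComp_translate_ofNat, pow_succ']
    rfl
  · rw [wtComp_translate_negSucc, pow_succ', Module.End.mul_apply, hinv]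
    rcases k with _ | k
    · have := wtComp_translate_ofNat R a 0
      rw [show Int.negSucc 0 + 1 = ((0 : ℕ) : ℤ) by rfl, this, if_pos (by rfl)]
      simp
    · rw [if_neg (by simp [Int.negSucc_eq]; omega), add_zero,
        show Int.negSucc (k + 1) + 1 = Int.negSucc k by simp [Int.negSucc_eq],
        wtComp_translate_negSucc]

variable {R a f}

/-- Degree and weight are conserved by the action, so the `n`-th translate shifts powers of `q` by
exactly `n` times their difference. -/
theorem exists_qPow_of_wtComp_translate {n : ℤ} {x : WeightIndex}
    (h : wtComp R (a.translate R n) x ≠ 0) :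
    ∃ j k, a.g k (qPow x - n * deg x + n * weight x) j ≠ 0 := by
  rcases n with n | n
  · rw [Int.ofNat_eq_natCast, wtComp_translate_ofNat] at h
    obtain ⟨⟨p, m, i, j, s, e, d⟩, hx, -, -, -, hq⟩ := (R.isLocalOp_wtAct.pow n).exists_ne_zero h
    refine ⟨j, ?_⟩
    by_contra! hn
    simp only [mul_one] at hq
    refine hx ?_
    simp only [qPow, Int.ofNat_eq_natCast] at hq hn
    simp [wtComp, inner, hq, hn]
  · rw [wtComp_translate_negSucc] at h
    obtain ⟨⟨p, m, i, j, s, e, d⟩, hx, -, -, -, hq⟩ :=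
      (R.isLocalOp_wtActInv.pow (n + 1)).exists_ne_zero h
    refine ⟨j, ?_⟩
    by_contra! hn
    rw [show ((n + 1 : ℕ) : ℤ) * -1 = Int.negSucc n by rw [Int.negSucc_eq]; push_cast; ring] at hq
    refine hx ?_
    simp only [qPow] at hq hn
    simp [wtComp, outer, hq, hn]

theorem IsOrbitSum.wtComp_inner (h : a.IsOrbitSum R f) (x : WeightIndex) :
    (Function.support fun n => wtComp R (a.translate R n) x).Finite ∧
      wtComp R f.inner x = ∑ᶠ n, wtComp R (a.translate R n) x := by
  obtain ⟨p, m, i, j, s, e, d⟩ := x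
  obtain ⟨hfin, hsum⟩ := h m i j s e d
  refine ⟨hfin.subset fun n hn h0 => hn ?_, ?_⟩
  · simp only [Distr.wtComp]
    rw [show a.translate R n m i j s e d = 0 from h0, map_zero]
  · simp only [Distr.wtComp]
    rw [hsum]
    exact (R.proj p).toAddMonoidHom.map_finsum hfin

/-- The expansions of an orbit sum and of the section differ from each other by the same
distribution in both annuli. -/
theorem IsOrbitSum.outer_sub (ha : a.IsAlgebraic) (h : a.IsOrbitSum R f) :
    wtComp R f.outer - wtComp R a.outer = wtComp R f.inner - wtComp R a.inner := by
  funext ⟨p, m, i, j, s, e, d⟩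
  let g : Fin f.r ⊕ Fin a.r → RatFunc ℂ :=
    Sum.elim (fun k => f.g k i j s e d) (fun k => a.g k i j s e d)
  let v : Fin f.r ⊕ Fin a.r → V :=
    Sum.elim (fun k => R.proj p (f.v k)) (fun k => -R.proj p (a.v k))
  have h0 : ∀ m, (wtComp R f.inner - wtComp R a.inner) (p, m, i, j, s, e, d)
      = ∑ k, coeffZero (g k) m • v k := fun m => by
    simp [Distr.wtComp, inner, g, v, sub_eq_add_neg]
  have h1 : (wtComp R f.outer - wtComp R a.outer) (p, m, i, j, s, e, d)
      = ∑ k, coeffInfty (g k) m • v k := by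
    simp [Distr.wtComp, outer, g, v, sub_eq_add_neg]
  rw [h0, h1]
  refine sum_coeffInfty_smul_of_finite g v ?_ m
  refine Set.Finite.subset ((ha.image Prod.fst).biUnion fun i' _ =>
    Set.finite_Icc (p.1 - (s : ℕ) - |i - i'|) (p.1 - (s : ℕ) + |i - i'|)) fun m hm => ?_
  rw [Function.mem_support, ← h0] at hm
  -- Subtracting `a` removes the term `n = 0`, the only one in which the power of `q` places no
  -- bound on the degree.
  obtain ⟨n, hn0, hn⟩ : ∃ n : ℤ, n ≠ 0 ∧
      wtComp R (a.translate R n) (p, m, i, j, s, e, d) ≠ 0 := by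
    by_contra! hn
    refine hm ?_
    rw [Pi.sub_apply, (h.wtComp_inner _).2, finsum_eq_single _ 0 hn, sub_eq_zero]
    rfl
  obtain ⟨j', k, hk⟩ := exists_qPow_of_wtComp_translate hn
  simp only [qPow, deg, weight] at hk
  refine Set.mem_biUnion (x := i - n * (m + (s : ℕ)) + n * p.1) ⟨(_, j'), ⟨k, hk⟩, rfl⟩ ?_
  -- Since `|n| ≥ 1`, the distance between degree and weight is at most the shift `|i - i'|` in the
  -- power of `q`, and `i'` takes finitely many values because `a` is algebraic.
  have h2 : |m + (s : ℕ) - p.1| ≤ |i - (i - n * (m + (s : ℕ)) + n * p.1)| := by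
    rw [show i - (i - n * (m + (s : ℕ)) + n * p.1) = n * (m + (s : ℕ) - p.1) by ring, abs_mul]
    exact le_mul_of_one_le_left (abs_nonneg _) (Int.one_le_abs hn0)
  obtain ⟨h3, h4⟩ := abs_le.mp h2
  exact ⟨by linarith, by linarith⟩

/-- An orbit sum is equivariant. -/
theorem IsOrbitSum.isEquivariant (ha : a.IsAlgebraic) (h : a.IsOrbitSum R f) :
    f.IsEquivariant R := by
  refine wtComp_injective (R := R) (funext fun x => ?_)
  obtain ⟨P, hP⟩ := inner_weightsIn R f
  have hfin := fun x => (h.wtComp_inner x).1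
  have hshift : (Function.support fun n : ℤ => wtComp R (a.translate R (n + 1)) x).Finite :=
    (hfin x).preimage (add_left_injective (1 : ℤ)).injOn
  rw [hP.wtComp_act, (R.isLocalOp_wtAct.finsum hfin (fun x => (h.wtComp_inner x).2) x).2]
  simp only [wtAct_wtComp_translate, Pi.add_apply]
  have hcor : ∀ n : ℤ, n ≠ -1 →
      (if n = -1 then wtComp R a.outer - wtComp R a.inner else 0) x = 0 := fun n hn => by
    rw [if_neg hn]; rfl
  rw [finsum_add_distrib hshift ((Set.finite_singleton (-1 : ℤ)).subset fun n hn =>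
      not_not.mp fun h0 => hn (hcor n h0)),
    show ∑ᶠ n : ℤ, wtComp R (a.translate R (n + 1)) x = ∑ᶠ n : ℤ, wtComp R (a.translate R n) x from
      finsum_comp_equiv (Equiv.addRight (1 : ℤ)) (f := fun n => wtComp R (a.translate R n) x),
    ← (h.wtComp_inner x).2, finsum_eq_single _ (-1) hcor, if_pos rfl]
  -- The jump of `a` across the marked point equals that of `f`, which turns the inner expansion
  -- plus the jump into the outer expansion.
  have := congrFun (h.outer_sub ha) x
  simp only [Pi.sub_apply] at this ⊢
  rw [add_sub_left_comm, ← this]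
  abel

end FormalSection

end

theorem mainTheorem4 {V M : Type*} [AddCommGroup V] [Module ℂ V] [AddCommGroup M] [Module ℂ M]
    (A : SUSYVertexAlgebra V) (C : QuasiConformal A) (N : SUSYModule A M)
    (P : PositiveEnergy C N) :
    -- the functional is well defined, linear, and a series in nonnegative powers of `q`
    (∀ i j : ℤ,
      (∀ v n e d, (Function.support (P.blockStr (P.traceOp v i j n e d))).Finite) ∧
      (∀ v e d, (Function.support fun n : ℤ => P.str (P.traceOp v i j n e d)).Finite) ∧
      IsLinearMap ℂ (fun v => P.phi v i j) ∧
      (i < 0 → ∀ v, P.phi v i j = 0)) ∧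
    -- it is a conformal block: it kills `h(f) b` for all equivariant sections `f`
    (∀ f : FormalSection V, f.IsEquivariant C.toAnnihilationRep → f.CompatibleWith P.toAnnihilationRep →
      ∀ b : V, P.Annihilates (f.hAct A b)) ∧
    -- in particular it kills `h(π_* a) b`
    (∀ a f : FormalSection V, a.IsAlgebraic → a.IsOrbitSum C.toAnnihilationRep f →
      f.IsEquivariant C.toAnnihilationRep ∧
      (f.CompatibleWith P.toAnnihilationRep → ∀ b : V, P.Annihilates (f.hAct A b))) :=
  ⟨fun i j => ⟨fun v n e d => AnnihilationRep.blockStr_support_finite (P.traceOp_mem v i j n e d),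
      fun v e d => P.str_traceOp_support_finite v i j e d, P.phi_isLinearMap i j,
      fun hi v => P.phi_eq_zero (P.proj_eq_zero_of_neg hi) v⟩,
    fun f hf hc b => P.annihilates_hAct f hf hc b,
    fun _ f ha h => ⟨h.isEquivariant ha, fun hc b =>
      P.annihilates_hAct f (h.isEquivariant ha) hc b⟩⟩
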